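/- Fix constants $M$, $0<\epsilon<1$ and $C>0$. For $B\in\mathbb R^{d\times d}$ let $\|B\|_p=\max_{\|v\|_p=1}\|Bv\|_p$, let $\|v\|_0$ be the number of nonzero entries of a vector $v$, and let $B_{*j}$, $B_{j*}$ be the $j$-th column and row of $B$. Put $$\mathcal M(s)=\{B:\ \max_j\|B_{*j}\|_0\le s,\ \|B\|_1\le M,\ \|B\|_2\le 1-\epsilon\},\qquad \mathcal L=\{B \text{ invertible}:\ \|B^{-1}\|_1\le M,\ \|B\|_2\le M\}.$$ For every $T\in\mathbb N$ let $d=d_T\ge 2$, $m=m_T\in\{1,\dots,d\}$, $s=s_T\in\mathbb N$, and let $A=A_T$, $\Sigma_0=\Sigma_{0,T}$, $\Psi=\Psi_T$ be real $d\times d$ matrices with $\Sigma_0\in\mathcal L$, $A\in\mathcal M(s)$ and $\min_j\Psi_{jj}\ge C$. Let $v^{*T}=(\Sigma_0^{-1})_{1*}$, $s_v=\|v^*\|_0$ and $\theta^*=A_{1m}$. **Model and procedure.** Let $(X_t)_{t\in\mathbb Z}$ be a stationary Gaussian lag-1 vector autoregression in $\mathbb R^d$ with these parameters: $X_t=A^TX_{t-1}+W_t$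 almost surely, where the $W_t\sim N(0,\Psi)$ are i.i.d., $W_t$ is independent of $(X_r)_{r<t}$, and $X_t\sim N(0,\Sigma_0)$ for every $t\in\mathbb Z$. (The process, and the probability space that carries it, may change with $T$.) From $X_1,\dots,X_T$ form $$S_0=\frac1T\sum_{t=1}^TX_tX_t^T,\qquad S_1=\frac1{T-1}\sum_{t=1}^{T-1}X_tX_{t+1}^T .$$ For tuning parameters $\lambda,\lambda'>0$, with $e_1=(1,0,\dots,0)$, let $$\hat\beta\in\operatorname*{argmin}\{\|\beta\|_1:\ \|S_0\beta-S_{1,*m}\|_\infty\le\lambda\},\qquad \hat v\in\operatorname*{argmin}\{\|v\|_1:\ \|v^TS_0-e_1\|_\infty\le\lambda'\}$$ be any minimizers, and, writing $\hat\beta_\theta$ for $\hat\beta$ with its first entry replaced by $\theta$, let $\tilde\theta$ be a root of $\theta\mapsto\hat v^T(S_0\hat\beta_\theta-S_{1,*m})$. On outcomes where a program is infeasible or no root exists, the corresponding quantity is given an arbitrary value. Put $$\hat\Delta=(S_{0,mm}-\hat\beta^TS_0\hat\beta)(\hat v^TS_0\hat v),\qquad \hat U_T=\hat\Delta^{-1/2}\,T^{1/2}(\tilde\theta-\theta^*),$$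 where $\hat U_T:=0$ if $\hat\Delta\le0$. **Claim.** There are deterministic positive sequences $\lambda=\lambda_T\asymp\sqrt{\log d/T}$ and $\lambda'=\lambda'_T\asymp\sqrt{\log d/T}$ (which may depend on the parameter sequences) such that, if $$\max(s_v,s)\log d=o(\sqrt T)\qquad(T\to\infty),$$ then, for every such sequence of processes and every choice of the minimizers and roots: 1. with probability tending to one both programs are feasible, the root $\tilde\theta$ exists and is unique, and $\hat\Delta>0$; 2. for every $t\in\mathbb R$, $\ \lim_{T\to\infty}\big|P(\hat U_T\le t)-\Phi(t)\big|=0$, where $\Phi$ is the standard normal distribution function. -/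

import Mathlib

open MeasureTheory ProbabilityTheory Filter Topology Matrix

namespace VARInference

noncomputable section

/-- The number of nonzero entries of a vector. -/
def l0 {d : ℕ} (v : Fin d → ℝ) : ℕ := (Finset.univ.filter fun i => v i ≠ 0).card

/-- The `ℓ¹` norm of a vector. -/
def l1 {d : ℕ} (v : Fin d → ℝ) : ℝ := ∑ i, |v i|

/-- The operator norm of `B` on `ℝ^d` equipped with the `ℓ^p` norm,
`max {‖B v‖_p : ‖v‖_p = 1}`. -/
def opNorm {d : ℕ} (p : ENNReal) [Fact (1 ≤ p)] (B : Matrix (Fin d) (Fin d) ℝ) : ℝ :=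
  ‖LinearMap.toContinuousLinearMap (Matrix.toLpLin p p B)‖

/-- The class `𝓜(s)` of column-sparse transition matrices, with constants `M` and `ε`. -/
def classM {d : ℕ} (M ε : ℝ) (s : ℕ) : Set (Matrix (Fin d) (Fin d) ℝ) :=
  {B | (∀ j, l0 (fun i => B i j) ≤ s) ∧ opNorm 1 B ≤ M ∧ opNorm 2 B ≤ 1 - ε}

/-- The class `𝓛` of invertible matrices, with constant `M`. -/
def classL {d : ℕ} (M : ℝ) : Set (Matrix (Fin d) (Fin d) ℝ) :=
  {B | IsUnit B.det ∧ opNorm 1 B⁻¹ ≤ M ∧ opNorm 2 B ≤ M}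

/-- `X` is a stationary Gaussian lag-1 vector autoregression `X_t = Aᵀ X_{t-1} + W_t`, `t ∈ ℤ`,
with innovations `W_t` i.i.d. `N(0, Ψ)`, each `W_t` independent of the history `(X_r)_{r < t}`,
and with stationary distribution `X_t ∼ N(0, Σ₀)` for every `t`. -/
structure IsStationaryVAR {Ω : Type*} [MeasurableSpace Ω] (μ : Measure Ω) {d : ℕ}
    (A Sig0 Psi : Matrix (Fin d) (Fin d) ℝ)
    (X W : ℤ → Ω → EuclideanSpace ℝ (Fin d)) : Prop where
  measurable_X : ∀ t, Measurable (X t)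
  measurable_W : ∀ t, Measurable (W t)
  posSemidef_Sig0 : Sig0.PosSemidef
  posSemidef_Psi : Psi.PosSemidef
  recursion : ∀ t, ∀ᵐ ω ∂μ, ∀ j, X t ω j = (Aᵀ *ᵥ (X (t - 1) ω).ofLp) j + W t ω j
  law_W : ∀ t, μ.map (W t) = multivariateGaussian 0 Psi
  iIndep_W : iIndepFun W μ
  indep_history : ∀ t, IndepFun (W t) (fun ω (r : Set.Iio t) => X r ω) μ
  law_X : ∀ t, μ.map (X t) = multivariateGaussian 0 Sig0

/-- `S₀ = T⁻¹ ∑_{t=1}^T X_t X_tᵀ`, computed from a path `x`. -/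
def S0 {d : ℕ} (T : ℕ) (x : ℤ → EuclideanSpace ℝ (Fin d)) : Matrix (Fin d) (Fin d) ℝ :=
  fun i j => (T : ℝ)⁻¹ * ∑ t ∈ Finset.Icc 1 T, x (t : ℤ) i * x (t : ℤ) j

/-- `S₁ = (T-1)⁻¹ ∑_{t=1}^{T-1} X_t X_{t+1}ᵀ`, computed from a path `x`. -/
def S1 {d : ℕ} (T : ℕ) (x : ℤ → EuclideanSpace ℝ (Fin d)) : Matrix (Fin d) (Fin d) ℝ :=
  fun i j => ((T : ℝ) - 1)⁻¹ * ∑ t ∈ Finset.Icc 1 (T - 1), x (t : ℤ) i * x ((t : ℤ) + 1) j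

/-- The estimating equation `t(β) = S₀ β - S_{1,*m}` for the `m`-th column of `A`. -/
def estEq {d : ℕ} (T : ℕ) (x : ℤ → EuclideanSpace ℝ (Fin d)) (m : Fin d) (β : Fin d → ℝ) :
    Fin d → ℝ :=
  S0 T x *ᵥ β - fun i => S1 T x i m

/-- The constraint set `‖S₀ β - S_{1,*m}‖_∞ ≤ lam`. -/
def feasibleBeta {d : ℕ} (T : ℕ) (x : ℤ → EuclideanSpace ℝ (Fin d)) (m : Fin d) (lam : ℝ) :
    Set (Fin d → ℝ) :=
  {β | ∀ i, |estEq T x m β i| ≤ lam}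

/-- The constraint set `‖vᵀ S₀ - e_k‖_∞ ≤ lam'`. -/
def feasibleV {d : ℕ} (T : ℕ) (x : ℤ → EuclideanSpace ℝ (Fin d)) (k : Fin d) (lam' : ℝ) :
    Set (Fin d → ℝ) :=
  {v | ∀ i, |(v ᵥ* S0 T x) i - (Pi.single k 1 : Fin d → ℝ) i| ≤ lam'}

/-- `b` is a point of least `ℓ¹` norm in `F`. -/
def IsL1Argmin {d : ℕ} (F : Set (Fin d → ℝ)) (b : Fin d → ℝ) : Prop :=
  b ∈ F ∧ ∀ c ∈ F, l1 b ≤ l1 c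

/-- The projected estimating equation `Ŝ(θ, γ̂) = v̂ᵀ (S₀ β̂_θ - S_{1,*m})`, where `β̂_θ` is `β̂`
with its `k`-th entry replaced by `θ`. -/
def projEq {d : ℕ} (T : ℕ) (x : ℤ → EuclideanSpace ℝ (Fin d)) (k m : Fin d)
    (β v : Fin d → ℝ) (θ : ℝ) : ℝ :=
  v ⬝ᵥ estEq T x m (Function.update β k θ)

/-- The variance estimator `Δ̂ = (S_{0,mm} - β̂ᵀ S₀ β̂) (v̂ᵀ S₀ v̂)`. -/
def DeltaHat {d : ℕ} (T : ℕ) (x : ℤ → EuclideanSpace ℝ (Fin d)) (m : Fin d)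
    (β v : Fin d → ℝ) : ℝ :=
  (S0 T x m m - β ⬝ᵥ (S0 T x *ᵥ β)) * (v ⬝ᵥ (S0 T x *ᵥ v))

/-- The inferential procedure run on a path `x` for the `k`-th entry of column `m`, with tuning
parameters `lam`, `lam'`: `β` and `v` solve their programs whenever these are feasible, and `θ` is
a root of the projected equation whenever there is one. In the remaining cases the three values
are unrestricted. -/
structure IsZEstimate {d : ℕ} (T : ℕ) (x : ℤ → EuclideanSpace ℝ (Fin d)) (k m : Fin d)
    (lam lam' : ℝ) (β v : Fin d → ℝ) (θ : ℝ) : Prop where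
  argmin_beta : (feasibleBeta T x m lam).Nonempty → IsL1Argmin (feasibleBeta T x m lam) β
  argmin_v : (feasibleV T x k lam').Nonempty → IsL1Argmin (feasibleV T x k lam') v
  root : (∃ τ, projEq T x k m β v τ = 0) → projEq T x k m β v θ = 0

/-- Every step of the procedure makes sense on the path `x`: both programs are feasible, the
projected equation has exactly one root, and the variance estimator is positive. -/
structure WellPosed {d : ℕ} (T : ℕ) (x : ℤ → EuclideanSpace ℝ (Fin d)) (k m : Fin d)
    (lam lam' : ℝ) (β v : Fin d → ℝ) : Prop where
  feasible_beta : (feasibleBeta T x m lam).Nonempty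
  feasible_v : (feasibleV T x k lam').Nonempty
  unique_root : ∃! τ, projEq T x k m β v τ = 0
  pos : 0 < DeltaHat T x m β v

/-- The studentized estimator `Δ̂^{-1/2} T^{1/2} (θ̃ - θ*)`. -/
def UHat {d : ℕ} (T : ℕ) (x : ℤ → EuclideanSpace ℝ (Fin d)) (m : Fin d)
    (β v : Fin d → ℝ) (θ θstar : ℝ) : ℝ :=
  Real.sqrt T * (θ - θstar) / Real.sqrt (DeltaHat T x m β v)

/-- `a ≍ b` at infinity, for a positive sequence `a`. -/
def SameOrder (a b : ℕ → ℝ) : Prop :=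
  (∀ n, 0 < a n) ∧ a =Θ[atTop] b

end

end VARInference

/-! Write `a*` for the `m`-th column of `A`, `v*` for row `k` of `Sig0⁻¹`, and ρ = √(log d / T). The
projected equation is affine in θ, and its slope `(S0 v̂)_k` is within the tuning parameter of 1
(`projEq_update`). Because `v*` inverts `Sig0`, errors in β̂ and v̂ enter the root only through
products of an ℓ¹ estimation error O(sρ) with a sup-norm residual O(ρ)
(`EstimationBounds.expansion`). After multiplication by √T these are of order s log d / √T, which
vanishes by assumption. What remains of √T(θ̃ - θ*) is the score, `v*` paired with ∑ X_t w_{t+1,m}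
and divided by √T. Since Δ̂ is consistent for its limiting variance, Slutsky's argument applies.

Asymptotic normality of the score uses no general martingale theorem. Given the past, each
innovation is Gaussian, so the exponential martingale with imaginary argument integrates to exactly
1 (`integral_cexp_martingale`). Hence the characteristic function differs from the Gaussian one by
at most E|1 - exp(l Z)|, where Z is the centred sum of squares of `v*`·X_t
(`norm_charFun_score_sub_le`). Exponential moments of such sums (`exp_sum_sq_gaussian`) come from
diagonalising the covariance matrix of the path, whose row sums are bounded because autocovariances
decay geometrically. The same moments, with the real exponential martingale, give uniform
concentration of `S0` and of the score noise (`measureReal_not_goodPath_le`).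

The dimension need not tend to infinity, so a failure probability of order 1/d need not be small,
while the tuning constant must be fixed in advance. For d ≥ N the true vectors are feasible and
sparsity gives the rate (`estimationBounds_sparse`). For d < N concentration is demanded with a
larger constant; the truth may then violate the constraints, but `S0` is invertible, so the programs
are feasible anyway and every feasible point is close to the truth (`estimationBounds_low_dim`).

All statements about the estimators are deterministic on good paths, so no measurability of
minimizers or roots is needed. -/

namespace VARInference

/-! ### Operator norm bounds. -/

lemma sum_abs_col_le_opNorm_one {d : ℕ} (B : Matrix (Fin d) (Fin d) ℝ) (j : Fin d) :
    ∑ i, |B i j| ≤ opNorm 1 B := by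
  have h := (LinearMap.toContinuousLinearMap (Matrix.toLpLin 1 1 B)).le_opNorm
    (WithLp.toLp 1 (Pi.single j 1))
  rw [LinearMap.coe_toContinuousLinearMap', Matrix.toLpLin_toLp, PiLp.norm_eq_of_L1,
    PiLp.norm_eq_of_L1] at h
  have h2 : ∑ i, |(Pi.single j (1 : ℝ) : Fin d → ℝ) i| = 1 := by
    rw [Finset.sum_eq_single j] <;> simp +contextual
  simpa [h2, opNorm] using h

lemma norm_mulVec_le_opNorm_two {d : ℕ} (B : Matrix (Fin d) (Fin d) ℝ) (w : Fin d → ℝ) :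
    ‖(WithLp.toLp 2 (B *ᵥ w) : EuclideanSpace ℝ (Fin d))‖ ≤
      opNorm 2 B * ‖(WithLp.toLp 2 w : EuclideanSpace ℝ (Fin d))‖ :=
  (LinearMap.toContinuousLinearMap (Matrix.toLpLin 2 2 B)).le_opNorm (WithLp.toLp 2 w)

lemma opNorm_nonneg {d : ℕ} (p : ENNReal) [Fact (1 ≤ p)] (B : Matrix (Fin d) (Fin d) ℝ) :
    0 ≤ opNorm p B := norm_nonneg _

lemma norm_pow_mulVec_le {d : ℕ} (B : Matrix (Fin d) (Fin d) ℝ) (w : Fin d → ℝ) (h : ℕ) :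
    ‖(WithLp.toLp 2 ((B ^ h) *ᵥ w) : EuclideanSpace ℝ (Fin d))‖ ≤
      opNorm 2 B ^ h * ‖(WithLp.toLp 2 w : EuclideanSpace ℝ (Fin d))‖ := by
  induction h with
  | zero => simp
  | succ h ih =>
    rw [pow_succ', ← Matrix.mulVec_mulVec, pow_succ', mul_assoc]
    exact (norm_mulVec_le_opNorm_two _ _).trans
      (mul_le_mul_of_nonneg_left ih (opNorm_nonneg _ _))

lemma norm_toLp_eq_sqrt {d : ℕ} (u : Fin d → ℝ) :
    ‖(WithLp.toLp 2 u : EuclideanSpace ℝ (Fin d))‖ = √(u ⬝ᵥ u) := by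
  rw [EuclideanSpace.norm_eq]
  simp [dotProduct, sq]

lemma abs_dotProduct_le_norm {d : ℕ} (u w : Fin d → ℝ) :
    |u ⬝ᵥ w| ≤ ‖(WithLp.toLp 2 u : EuclideanSpace ℝ (Fin d))‖ *
      ‖(WithLp.toLp 2 w : EuclideanSpace ℝ (Fin d))‖ := by
  have h := abs_real_inner_le_norm (WithLp.toLp 2 w : EuclideanSpace ℝ (Fin d))
    (WithLp.toLp 2 u)
  rw [EuclideanSpace.inner_toLp_toLp] at h
  simpa [mul_comm] using h

/-- With `S = Sig0` and `B = A` the left side is a lag-`h` autocovariance of u·X_t. Cauchy–Schwarz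
makes it decay geometrically once the spectral norm of `A` is below 1. -/
lemma abs_dotProduct_mulVec_pow_le {d : ℕ} (S B : Matrix (Fin d) (Fin d) ℝ) (u : Fin d → ℝ)
    (h : ℕ) : |u ⬝ᵥ S *ᵥ ((B ^ h) *ᵥ u)| ≤ opNorm 2 S * opNorm 2 B ^ h * (u ⬝ᵥ u) := by
  have hu : 0 ≤ u ⬝ᵥ u := by
    simpa using dotProduct_star_self_nonneg u
  refine (abs_dotProduct_le_norm _ _).trans ?_
  have h1 := (norm_mulVec_le_opNorm_two S ((B ^ h) *ᵥ u)).trans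
    (mul_le_mul_of_nonneg_left (norm_pow_mulVec_le B u h) (opNorm_nonneg _ _))
  refine (mul_le_mul_of_nonneg_left h1 (norm_nonneg _)).trans_eq ?_
  rw [norm_toLp_eq_sqrt]
  have := Real.mul_self_sqrt hu
  linear_combination (opNorm 2 S * opNorm 2 B ^ h) * this

lemma abs_apply_le_opNorm_two {d : ℕ} (S : Matrix (Fin d) (Fin d) ℝ) (i j : Fin d) :
    |S i j| ≤ opNorm 2 S := by
  have h := (abs_dotProduct_le_norm (Pi.single i 1) (S *ᵥ Pi.single j 1)).trans
    (mul_le_mul_of_nonneg_left (norm_mulVec_le_opNorm_two S (Pi.single j 1)) (norm_nonneg _))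
  simpa [norm_toLp_eq_sqrt] using h

end VARInference
-- Gaussianity and covariances of linear functionals of the process.
namespace VARInference

lemma covariance_congr_right {Ω : Type*} [MeasurableSpace Ω] {μ : Measure Ω} {X Y Z : Ω → ℝ}
    (h : Y =ᵐ[μ] Z) : cov[X, Y; μ] = cov[X, Z; μ] := by
  have h1 := integral_congr_ae h
  unfold covariance
  refine integral_congr_ae ?_
  filter_upwards [h] with ω hω
  rw [hω, h1]

variable {d : ℕ}

/-- The linear functional `x ↦ u ⬝ᵥ x` on Euclidean space. -/
noncomputable def dotCLM (u : Fin d → ℝ) : EuclideanSpace ℝ (Fin d) →L[ℝ] ℝ :=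
  innerSL ℝ (WithLp.toLp 2 u : EuclideanSpace ℝ (Fin d))

lemma dotCLM_apply (u : Fin d → ℝ) (x : EuclideanSpace ℝ (Fin d)) :
    dotCLM u x = u ⬝ᵥ x.ofLp := by
  simp [dotCLM, EuclideanSpace.inner_eq_star_dotProduct, dotProduct_comm]

namespace IsStationaryVAR

variable {Ω : Type*} [MeasurableSpace Ω] {μ : Measure Ω}
  {A Sig0 Psi : Matrix (Fin d) (Fin d) ℝ} {X W : ℤ → Ω → EuclideanSpace ℝ (Fin d)}

lemma measurable_dot_X (h : IsStationaryVAR μ A Sig0 Psi X W) (u : Fin d → ℝ) (t : ℤ) :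
    Measurable fun ω => u ⬝ᵥ (X t ω).ofLp := by
  have := h.measurable_X t
  unfold dotProduct
  fun_prop

lemma measurable_dot_W (h : IsStationaryVAR μ A Sig0 Psi X W) (u : Fin d → ℝ) (t : ℤ) :
    Measurable fun ω => u ⬝ᵥ (W t ω).ofLp := by
  have := h.measurable_W t
  unfold dotProduct
  fun_prop

lemma recursion_dot (h : IsStationaryVAR μ A Sig0 Psi X W) (u : Fin d → ℝ) (t : ℤ) :
    ∀ᵐ ω ∂μ, u ⬝ᵥ (X t ω).ofLp = (A *ᵥ u) ⬝ᵥ (X (t - 1) ω).ofLp + u ⬝ᵥ (W t ω).ofLp := by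
  filter_upwards [h.recursion t] with ω hω
  have : (X t ω).ofLp = Aᵀ *ᵥ (X (t - 1) ω).ofLp + (W t ω).ofLp := funext hω
  rw [this, dotProduct_add, Matrix.dotProduct_mulVec, Matrix.vecMul_transpose]

lemma hasGaussianLaw_X (h : IsStationaryVAR μ A Sig0 Psi X W) (t : ℤ) :
    HasGaussianLaw (X t) μ := ⟨by rw [h.law_X t]; infer_instance⟩

lemma hasGaussianLaw_W (h : IsStationaryVAR μ A Sig0 Psi X W) (t : ℤ) :
    HasGaussianLaw (W t) μ := ⟨by rw [h.law_W t]; infer_instance⟩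

lemma hasGaussianLaw_dot_X (h : IsStationaryVAR μ A Sig0 Psi X W) (u : Fin d → ℝ) (t : ℤ) :
    HasGaussianLaw (fun ω => u ⬝ᵥ (X t ω).ofLp) μ := by
  simpa [dotCLM_apply] using (h.hasGaussianLaw_X t).map_fun (dotCLM u)

lemma hasGaussianLaw_dot_W (h : IsStationaryVAR μ A Sig0 Psi X W) (u : Fin d → ℝ) (t : ℤ) :
    HasGaussianLaw (fun ω => u ⬝ᵥ (W t ω).ofLp) μ := by
  simpa [dotCLM_apply] using (h.hasGaussianLaw_W t).map_fun (dotCLM u)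

/-- Joint normality is not part of the model's definition. It follows by induction: the next
observation is a linear image of the path so far and an innovation independent of it. -/
lemma hasGaussianLaw_path [IsProbabilityMeasure μ] (h : IsStationaryVAR μ A Sig0 Psi X W)
    (t₀ : ℤ) (n : ℕ) :
    HasGaussianLaw (fun ω (r : Fin (n + 1)) => X (t₀ + (r : ℕ)) ω) μ := by
  induction n with
  | zero =>
    let L : EuclideanSpace ℝ (Fin d) →L[ℝ] (Fin 1 → EuclideanSpace ℝ (Fin d)) :=
      ContinuousLinearMap.pi fun _ => ContinuousLinearMap.id ℝ _
    refine ((h.hasGaussianLaw_X t₀).map_fun L).congr (ae_of_all _ fun ω => ?_)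
    funext r
    fin_cases r
    simp [L]
  | succ n ih =>
    have hind : IndepFun (fun ω (r : Fin (n + 1)) => X (t₀ + (r : ℕ)) ω)
        (W (t₀ + (n + 1 : ℕ))) μ := by
      refine IndepFun.symm ?_
      refine (h.indep_history (t₀ + (n + 1 : ℕ))).comp (φ := id)
        (ψ := fun f (r : Fin (n + 1)) =>
          f ⟨t₀ + (r : ℕ), by simp only [Set.mem_Iio]; have := r.2; omega⟩)
        measurable_id (measurable_pi_lambda _ fun r => measurable_pi_apply _)
    have hg := IndepFun.hasGaussianLaw ih (h.hasGaussianLaw_W _) hind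
    let L : (Fin (n + 1) → EuclideanSpace ℝ (Fin d)) × EuclideanSpace ℝ (Fin d) →L[ℝ]
        (Fin (n + 2) → EuclideanSpace ℝ (Fin d)) :=
      ContinuousLinearMap.pi fun r => Fin.lastCases
        ((Matrix.toEuclideanCLM (𝕜 := ℝ) Aᵀ).comp
          ((ContinuousLinearMap.proj (Fin.last n)).comp (ContinuousLinearMap.fst ℝ _ _)) +
          ContinuousLinearMap.snd ℝ _ _)
        (fun i => (ContinuousLinearMap.proj i).comp (ContinuousLinearMap.fst ℝ _ _)) r
    refine (hg.map_fun L).congr ?_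
    filter_upwards [h.recursion (t₀ + (n + 1 : ℕ))] with ω hω
    funext r
    refine Fin.lastCases ?_ (fun i => ?_) r
    · ext j
      have e : t₀ + ((n + 1 : ℕ) : ℤ) - 1 = t₀ + n := by push_cast; ring
      have := hω j
      rw [e] at this
      simp [L]
      simpa using this.symm
    · simp [L]

lemma integral_dot_X (h : IsStationaryVAR μ A Sig0 Psi X W) (u : Fin d → ℝ) (t : ℤ) :
    ∫ ω, u ⬝ᵥ (X t ω).ofLp ∂μ = 0 := by
  have h1 := integral_map (μ := μ) (h.measurable_X t).aemeasurable
    (f := fun x => dotCLM u x) (by fun_prop)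
  simp only [dotCLM_apply] at h1
  rw [← h1, h.law_X t]
  have h2 := (dotCLM u).integral_comp_comm
    (IsGaussian.integrable_id (μ := multivariateGaussian 0 Sig0))
  simp only [id_eq, integral_id_multivariateGaussian, map_zero, dotCLM_apply] at h2
  exact h2

lemma integral_dot_W (h : IsStationaryVAR μ A Sig0 Psi X W) (u : Fin d → ℝ) (t : ℤ) :
    ∫ ω, u ⬝ᵥ (W t ω).ofLp ∂μ = 0 := by
  have h1 := integral_map (μ := μ) (h.measurable_W t).aemeasurable
    (f := fun x => dotCLM u x) (by fun_prop)
  simp only [dotCLM_apply] at h1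
  rw [← h1, h.law_W t]
  have h2 := (dotCLM u).integral_comp_comm
    (IsGaussian.integrable_id (μ := multivariateGaussian 0 Psi))
  simp only [id_eq, integral_id_multivariateGaussian, map_zero, dotCLM_apply] at h2
  exact h2

lemma _root_.VARInference.covariance_dot_of_law {Z : Ω → EuclideanSpace ℝ (Fin d)}
    (hZ : Measurable Z) {S : Matrix (Fin d) (Fin d) ℝ} (hS : S.PosSemidef)
    (hlaw : μ.map Z = multivariateGaussian 0 S) (u w : Fin d → ℝ) :
    cov[fun ω => u ⬝ᵥ (Z ω).ofLp, fun ω => w ⬝ᵥ (Z ω).ofLp; μ] = u ⬝ᵥ S *ᵥ w := by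
  have h1 := covariance_map_fun (μ := μ) (Z := Z) (X := fun x => dotCLM u x)
    (Y := fun x => dotCLM w x) (by fun_prop) (by fun_prop) hZ.aemeasurable
  simp only [dotCLM_apply] at h1
  rw [← h1, hlaw]
  have h2 := covarianceBilin_multivariateGaussian (μ := 0) hS (WithLp.toLp 2 u) (WithLp.toLp 2 w)
  rw [covarianceBilin_apply_eq_cov IsGaussian.memLp_two_id] at h2
  simpa [EuclideanSpace.inner_eq_star_dotProduct, dotProduct_comm] using h2

lemma cov_dot_X_self (h : IsStationaryVAR μ A Sig0 Psi X W) (u w : Fin d → ℝ) (t : ℤ) :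
    cov[fun ω => u ⬝ᵥ (X t ω).ofLp, fun ω => w ⬝ᵥ (X t ω).ofLp; μ] = u ⬝ᵥ Sig0 *ᵥ w :=
  covariance_dot_of_law (h.measurable_X t) h.posSemidef_Sig0 (h.law_X t) u w

lemma cov_dot_W_self (h : IsStationaryVAR μ A Sig0 Psi X W) (u w : Fin d → ℝ) (t : ℤ) :
    cov[fun ω => u ⬝ᵥ (W t ω).ofLp, fun ω => w ⬝ᵥ (W t ω).ofLp; μ] = u ⬝ᵥ Psi *ᵥ w :=
  covariance_dot_of_law (h.measurable_W t) h.posSemidef_Psi (h.law_W t) u w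

lemma map_dot_W (h : IsStationaryVAR μ A Sig0 Psi X W) (u : Fin d → ℝ) (t : ℤ) :
    μ.map (fun ω => u ⬝ᵥ (W t ω).ofLp) = gaussianReal 0 (u ⬝ᵥ Psi *ᵥ u).toNNReal := by
  rw [(h.hasGaussianLaw_dot_W u t).map_eq_gaussianReal, h.integral_dot_W,
    ← covariance_self (h.measurable_dot_W u t).aemeasurable, h.cov_dot_W_self]

lemma indepFun_X_W (h : IsStationaryVAR μ A Sig0 Psi X W)
    (u w : Fin d → ℝ) {s t : ℤ} (hst : s < t) :
    IndepFun (fun ω => u ⬝ᵥ (X s ω).ofLp) (fun ω => w ⬝ᵥ (W t ω).ofLp) μ := by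
  refine ((h.indep_history t).comp (φ := fun x => dotCLM w x)
    (ψ := fun f => dotCLM u (f ⟨s, hst⟩)) (by fun_prop) (by fun_prop)).symm.congr ?_ ?_ <;>
  exact ae_of_all _ fun ω => by simp [dotCLM_apply]

lemma cov_dot_X [IsProbabilityMeasure μ] (h : IsStationaryVAR μ A Sig0 Psi X W)
    (u w : Fin d → ℝ) (t : ℤ) (n : ℕ) :
    cov[fun ω => u ⬝ᵥ (X t ω).ofLp, fun ω => w ⬝ᵥ (X (t + n) ω).ofLp; μ] =
      u ⬝ᵥ Sig0 *ᵥ ((A ^ n) *ᵥ w) := by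
  induction n generalizing w with
  | zero => simpa using h.cov_dot_X_self u w t
  | succ n ih =>
    have e : t + ((n + 1 : ℕ) : ℤ) - 1 = t + n := by push_cast; ring
    have h1 := h.recursion_dot w (t + (n + 1 : ℕ))
    rw [e] at h1
    rw [covariance_congr_right h1]
    have h2 := covariance_add_right (h.hasGaussianLaw_dot_X u t).memLp_two
      (h.hasGaussianLaw_dot_X (A *ᵥ w) (t + n)).memLp_two
      (h.hasGaussianLaw_dot_W w (t + (n + 1 : ℕ))).memLp_two
    rw [(h.indepFun_X_W u w (by push_cast; omega)).covariance_eq_zero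
      (h.hasGaussianLaw_dot_X u t).memLp_two
      (h.hasGaussianLaw_dot_W w (t + (n + 1 : ℕ))).memLp_two, ih] at h2
    rw [pow_succ, ← Matrix.mulVec_mulVec]
    exact h2.trans (add_zero _)

/-- The discrete Lyapunov equation as a quadratic form: compare variances on both sides of the
recursion, whose two terms are independent. -/
lemma sig0_eq [IsProbabilityMeasure μ] (h : IsStationaryVAR μ A Sig0 Psi X W) (u : Fin d → ℝ) :
    u ⬝ᵥ Sig0 *ᵥ u = (A *ᵥ u) ⬝ᵥ Sig0 *ᵥ (A *ᵥ u) + u ⬝ᵥ Psi *ᵥ u := by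
  have h1 := h.recursion_dot u 1
  have hX := (h.hasGaussianLaw_dot_X (A *ᵥ u) (1 - 1)).memLp_two
  have hW := (h.hasGaussianLaw_dot_W u 1).memLp_two
  rw [← h.cov_dot_X_self u u 1, covariance_self (h.measurable_dot_X u 1).aemeasurable,
    variance_congr h1, (h.indepFun_X_W (A *ᵥ u) u (by norm_num)).variance_fun_add hX hW,
    ← covariance_self (h.measurable_dot_X _ _).aemeasurable,
    ← covariance_self (h.measurable_dot_W _ _).aemeasurable, h.cov_dot_X_self, h.cov_dot_W_self]

end IsStationaryVAR
end VARInference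
-- Exponential moments of Gaussian quadratic forms.
namespace VARInference

/-- The left side is the exponential moment of a centred squared Gaussian. The first-order terms of
the logarithm cancel, leaving a quadratic remainder. -/
lemma exp_neg_mul_inv_sqrt_le {x : ℝ} (hx : |x| ≤ 1 / 4) :
    Real.exp (-x) * (√(1 - 2 * x))⁻¹ ≤ Real.exp (4 * x ^ 2) := by
  obtain ⟨h1, h2⟩ := abs_le.1 hx
  have hz : |2 * x| ≤ 1 / 2 := by rw [abs_mul]; norm_num; linarith
  have hlog := Real.abs_log_sub_add_sum_range_le (x := 2 * x) (by linarith) 1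
  simp only [Finset.range_one, Finset.sum_singleton, Nat.cast_zero, zero_add, pow_one, div_one,
    Nat.reduceAdd, sq_abs] at hlog
  have h3 : (2 * x) ^ 2 / (1 - |2 * x|) ≤ 8 * x ^ 2 := by
    rw [div_le_iff₀ (by linarith)]
    nlinarith [sq_nonneg x]
  have h4 := (abs_le.1 hlog).1
  have hpos : 0 < 1 - 2 * x := by linarith
  rw [← Real.exp_log (Real.sqrt_pos.2 hpos), ← Real.exp_neg, ← Real.exp_add, Real.exp_le_exp,
    Real.log_sqrt hpos.le]
  linarith

lemma gaussianReal_exp_sq {v : NNReal} {l : ℝ} (hl : |l * v| ≤ 1 / 4) :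
    Integrable (fun x : ℝ => Real.exp (l * (x ^ 2 - v))) (gaussianReal 0 v) ∧
      ∫ x, Real.exp (l * (x ^ 2 - v)) ∂(gaussianReal 0 v) ≤ Real.exp (4 * (l * v) ^ 2) := by
  by_cases hv : v = 0
  · subst hv
    simp [integrable_dirac]
  have hv0 : (0 : ℝ) < v := by positivity
  obtain ⟨h1, h2⟩ := abs_le.1 hl
  set b : ℝ := (2 * (v : ℝ))⁻¹ - l with hb
  have hb0 : 0 < b := by
    have : b = (1 - 2 * (l * v)) / (2 * v) := by rw [hb]; field_simp
    rw [this]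
    exact div_pos (by linarith) (by positivity)
  have key : ∀ x : ℝ, gaussianPDFReal 0 v x * Real.exp (l * (x ^ 2 - v)) =
      (√(2 * Real.pi * v))⁻¹ * Real.exp (-(l * v)) * Real.exp (-b * x ^ 2) := by
    intro x
    rw [gaussianPDFReal, mul_assoc, mul_assoc (√(2 * Real.pi * v))⁻¹, ← Real.exp_add,
      ← Real.exp_add]
    congr 2
    rw [hb]
    field_simp
    ring
  constructor
  · rw [gaussianReal_of_var_ne_zero _ hv, gaussianPDF_def]
    rw [integrable_withDensity_iff_integrable_smul' (by fun_prop) (by simp)]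
    simp_rw [ENNReal.toReal_ofReal (gaussianPDFReal_nonneg _ _ _), smul_eq_mul, key]
    exact (integrable_exp_neg_mul_sq hb0).const_mul _
  · rw [integral_gaussianReal_eq_integral_smul hv]
    simp_rw [smul_eq_mul, key]
    rw [integral_const_mul, integral_gaussian]
    refine le_trans (le_of_eq ?_) (exp_neg_mul_inv_sqrt_le hl)
    have : Real.pi / b = (2 * Real.pi * v) * (1 - 2 * (l * v))⁻¹ := by
      have : (1 - 2 * (l * v)) = 2 * v * b := by rw [hb]; field_simp
      rw [this]; field_simp
    rw [this, Real.sqrt_mul (x := 2 * Real.pi * v) (by positivity), Real.sqrt_inv]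
    have : √(2 * Real.pi * v) ≠ 0 := by positivity
    field_simp

variable {Ω : Type*} [MeasurableSpace Ω] {μ : Measure Ω}

/-- Gershgorin's argument: read the eigenvalue equation at a coordinate where the eigenvector is
largest in modulus. -/
lemma eigenvalues_le_of_row_sum {n : ℕ} {G : Matrix (Fin n) (Fin n) ℝ} (hG : G.IsHermitian)
    {κ : ℝ} (hκ : ∀ i, ∑ j, |G i j| ≤ κ) (k : Fin n) : hG.eigenvalues k ≤ κ := by
  set b := hG.eigenvectorBasis k with hb
  have hev := hG.mulVec_eigenvectorBasis k
  have : Nonempty (Fin n) := ⟨k⟩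
  obtain ⟨i, hi⟩ := Finite.exists_max fun j => |b j|
  have hpos : 0 < |b i| := by
    by_contra hcon
    have h0 : b = 0 := by
      ext j
      have := hi j
      have h3 := abs_nonneg (b j)
      simpa using abs_eq_zero.1 (le_antisymm (by linarith) h3)
    have := hG.eigenvectorBasis.orthonormal.1 k
    rw [← hb, h0] at this
    simp at this
  have h1 := congrFun hev i
  simp only [Matrix.mulVec, dotProduct, Pi.smul_apply, smul_eq_mul] at h1
  have h2 : hG.eigenvalues k * |b i| ≤ κ * |b i| := by
    calc hG.eigenvalues k * |b i| ≤ |hG.eigenvalues k * b i| := by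
          rw [abs_mul]
          exact mul_le_mul_of_nonneg_right (le_abs_self _) (abs_nonneg _)
      _ = |∑ j, G i j * b j| := by rw [← h1]
      _ ≤ ∑ j, |G i j| * |b i| := (Finset.abs_sum_le_sum_abs _ _).trans
          (Finset.sum_le_sum fun j _ => by
            rw [abs_mul]
            exact mul_le_mul_of_nonneg_left (hi j) (abs_nonneg _))
      _ ≤ κ * |b i| := by
          rw [← Finset.sum_mul]
          exact mul_le_mul_of_nonneg_right (hκ i) (abs_nonneg _)
  exact le_of_mul_le_mul_right h2 hpos

/-- Exponential moments of a centred sum of squares of jointly Gaussian variables. -/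
theorem exp_sum_sq_gaussian [IsProbabilityMeasure μ] {n : ℕ} {Y : Fin n → Ω → ℝ}
    (hm : ∀ i, Measurable (Y i))
    (hY : HasGaussianLaw (fun ω i => Y i ω) μ) (h0 : ∀ i, ∫ ω, Y i ω ∂μ = 0) {κ l : ℝ}
    (hκ : ∀ i, ∑ j, |cov[Y i, Y j; μ]| ≤ κ) (hl : |l| * κ ≤ 1 / 4) :
    Integrable (fun ω => Real.exp (l * ∑ i, (Y i ω ^ 2 - cov[Y i, Y i; μ]))) μ ∧
      ∫ ω, Real.exp (l * ∑ i, (Y i ω ^ 2 - cov[Y i, Y i; μ])) ∂μ ≤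
        Real.exp (4 * l ^ 2 * n * κ ^ 2) := by
  let G : Matrix (Fin n) (Fin n) ℝ := Matrix.of fun i j => cov[Y i, Y j; μ]
  have hG : G.IsHermitian := by
    ext i j
    simp [G, covariance_comm]
  -- Coordinates in an eigenbasis of the covariance matrix are uncorrelated and jointly Gaussian,
  -- hence independent, so the moment factorises.
  let b := hG.eigenvectorBasis
  let Z : Fin n → Ω → ℝ := fun k ω => (b k).ofLp ⬝ᵥ fun i => Y i ω
  have hYL : ∀ i, MemLp (Y i) 2 μ := fun i => (hY.eval i).memLp_two
  have hZm : ∀ k, Measurable (Z k) := fun k => by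
    simp only [Z, dotProduct]; fun_prop
  have hZG : HasGaussianLaw (fun ω => (Z · ω)) μ := by
    let L : (Fin n → ℝ) →L[ℝ] (Fin n → ℝ) :=
      (Matrix.mulVecLin (Matrix.of fun k i => (b k).ofLp i)).toContinuousLinearMap
    exact hY.map_fun L
  have hcov : ∀ k m, cov[Z k, Z m; μ] = hG.eigenvalues m * ((b k).ofLp ⬝ᵥ (b m).ofLp) := by
    intro k m
    have h1 : cov[Z k, Z m; μ] = (b k).ofLp ⬝ᵥ G *ᵥ (b m).ofLp := by
      simp only [Z, dotProduct]
      rw [covariance_fun_sum_fun_sum (fun i => (hYL i).const_mul _)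
        (fun i => (hYL i).const_mul _)]
      simp only [covariance_const_mul_left, covariance_const_mul_right, G, Matrix.mulVec,
        dotProduct, Matrix.of_apply, Finset.mul_sum]
      refine Finset.sum_congr rfl fun i _ => Finset.sum_congr rfl fun j _ => by ring
    rw [h1, hG.mulVec_eigenvectorBasis, dotProduct_smul, smul_eq_mul]
  have hdot : ∀ k m, (b k).ofLp ⬝ᵥ (b m).ofLp = if k = m then 1 else 0 := by
    intro k m
    rw [← (orthonormal_iff_ite.1 b.orthonormal) k m, EuclideanSpace.inner_eq_star_dotProduct,
      dotProduct_comm]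
    simp
  have hind : iIndepFun Z μ := hZG.iIndepFun_of_covariance_eq_zero fun k m hkm => by
    rw [hcov, hdot, if_neg hkm, mul_zero]
  have hvar : ∀ k, cov[Z k, Z k; μ] = hG.eigenvalues k := fun k => by rw [hcov, hdot]; simp
  have hnn : ∀ k, 0 ≤ hG.eigenvalues k := fun k => by
    rw [← hvar, covariance_self (hZm k).aemeasurable]; exact variance_nonneg _ _
  have hlaw : ∀ k, μ.map (Z k) = gaussianReal 0 (hG.eigenvalues k).toNNReal := by
    intro k
    rw [(hZG.eval k).map_eq_gaussianReal, ← covariance_self (hZm k).aemeasurable, hvar]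
    congr 1
    simp only [Z, dotProduct]
    rw [integral_finsetSum _ fun i _ => ((hYL i).integrable one_le_two).const_mul _]
    simp [integral_const_mul, h0]
  have hle := eigenvalues_le_of_row_sum hG hκ
  let V : Fin n → Ω → ℝ := fun k ω => Z k ω ^ 2 - hG.eigenvalues k
  -- The rotation preserves the sum of squares (Parseval) and the centring (trace equals sum of
  -- eigenvalues).
  have hsum : ∀ ω, ∑ i, (Y i ω ^ 2 - cov[Y i, Y i; μ]) = (∑ k, V k) ω := by
    intro ω
    have h1 := b.sum_sq_norm_inner_right (WithLp.toLp 2 fun i => Y i ω)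
    rw [EuclideanSpace.norm_sq_eq] at h1
    have h2 := hG.trace_eq_sum_eigenvalues
    simp only [Matrix.trace, Matrix.diag_apply, G, Matrix.of_apply] at h2
    simp only [Finset.sum_apply, V, Finset.sum_sub_distrib]
    rw [h2]
    congr 1
    simp only [Real.norm_eq_abs, sq_abs] at h1
    rw [← h1]
    refine Finset.sum_congr rfl fun k _ => ?_
    rw [EuclideanSpace.inner_eq_star_dotProduct, dotProduct_comm]
    simp [Z]
  have hVind : iIndepFun V μ :=
    hind.comp (fun k x => x ^ 2 - hG.eigenvalues k) fun k => by fun_prop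
  have hVm : ∀ k, Measurable (V k) := fun k => by have := hZm k; simp only [V]; fun_prop
  have h1d : ∀ k, Integrable (fun ω => Real.exp (l * V k ω)) μ ∧
      mgf (V k) μ l ≤ Real.exp (4 * l ^ 2 * κ ^ 2) := by
    intro k
    have hlk : |l| * hG.eigenvalues k ≤ 1 / 4 :=
      (mul_le_mul_of_nonneg_left (hle k) (abs_nonneg _)).trans hl
    have h2 := gaussianReal_exp_sq (v := (hG.eigenvalues k).toNNReal) (l := l) (by
      rw [Real.coe_toNNReal _ (hnn k), abs_mul, abs_of_nonneg (hnn k)]; exact hlk)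
    rw [Real.coe_toNNReal _ (hnn k), ← hlaw k] at h2
    refine ⟨h2.1.comp_measurable (hZm k), ?_⟩
    rw [mgf, show ∫ ω, Real.exp (l * V k ω) ∂μ = _ from
      (integral_map (hZm k).aemeasurable h2.1.1).symm]
    refine h2.2.trans (Real.exp_le_exp.2 ?_)
    have := pow_le_pow_left₀ (hnn k) (hle k) 2
    nlinarith [sq_nonneg l]
  simp_rw [hsum]
  refine ⟨hVind.integrable_exp_mul_sum hVm fun k _ => (h1d k).1, ?_⟩
  change mgf (∑ k, V k) μ l ≤ _
  rw [hVind.mgf_sum hVm]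
  refine (Finset.prod_le_prod (fun k _ => mgf_nonneg) fun k _ => (h1d k).2).trans_eq ?_
  rw [Finset.prod_const, ← Real.exp_nat_mul]
  simp
  ring

end VARInference
-- Summable covariance decay and integration over one Gaussian innovation.
namespace VARInference

/-- With truncated subtraction the exponent is |i - j|, so the two sides of the diagonal each
contribute at most a full geometric series. -/
lemma sum_pow_dist_le {r : ℝ} (hr0 : 0 ≤ r) (hr1 : r < 1) (n : ℕ) (i : Fin n) :
    ∑ j : Fin n, r ^ ((i : ℕ) - j + (j - i)) ≤ 2 / (1 - r) := by
  have hgeo : ∀ s : Finset ℕ, ∑ k ∈ s, r ^ k ≤ 1 / (1 - r) := fun s => by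
    have := (hasSum_geometric_of_lt_one hr0 hr1)
    rw [one_div]
    exact sum_le_hasSum s (fun _ _ => by positivity) this
  have hsplit : ∀ j : Fin n, r ^ ((i : ℕ) - j + (j - i)) ≤
      (if (j : ℕ) ≤ i then r ^ ((i : ℕ) - j) else 0) +
        (if (i : ℕ) ≤ j then r ^ ((j : ℕ) - i) else 0) := by
    intro j
    have h1 := pow_nonneg hr0 ((i : ℕ) - j)
    have h2 := pow_nonneg hr0 ((j : ℕ) - i)
    rcases lt_trichotomy (j : ℕ) i with h | h | h
    · rw [if_pos h.le, if_neg (by omega), add_zero, show (i : ℕ) - j + (j - i) = i - j by omega]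
    · simp [h]
    · rw [if_neg (by omega), if_pos h.le, zero_add, show (i : ℕ) - j + (j - i) = j - i by omega]
  refine (Finset.sum_le_sum fun j _ => hsplit j).trans ?_
  rw [Finset.sum_add_distrib, ← Finset.sum_filter, ← Finset.sum_filter]
  have ha : ∑ j ∈ Finset.univ.filter (fun j : Fin n => (j : ℕ) ≤ i), r ^ ((i : ℕ) - j) ≤ 1 / (1 - r) := by
    rw [← Finset.sum_image (f := fun k => r ^ k) (g := fun j : Fin n => (i : ℕ) - j)]
    · exact hgeo _
    · intro a ha b hb hab
      simp only [Finset.coe_filter, Finset.mem_univ, true_and, Set.mem_ofPred_eq] at ha hb hab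
      exact Fin.ext (by omega)
  have hb : ∑ j ∈ Finset.univ.filter (fun j : Fin n => (i : ℕ) ≤ j), r ^ ((j : ℕ) - i) ≤ 1 / (1 - r) := by
    rw [← Finset.sum_image (f := fun k => r ^ k) (g := fun j : Fin n => (j : ℕ) - i)]
    · exact hgeo _
    · intro a ha b hb hab
      simp only [Finset.coe_filter, Finset.mem_univ, true_and, Set.mem_ofPred_eq] at ha hb hab
      exact Fin.ext (by omega)
  calc _ ≤ 1 / (1 - r) + 1 / (1 - r) := add_le_add ha hb
    _ = 2 / (1 - r) := by ring

variable {d : ℕ} {Ω : Type*} [MeasurableSpace Ω] {μ : Measure Ω}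
  {A Sig0 Psi : Matrix (Fin d) (Fin d) ℝ} {X W : ℤ → Ω → EuclideanSpace ℝ (Fin d)}

/-- Exponential moments of the centred sum of squares of a linear functional of the process. -/
theorem IsStationaryVAR.exp_sum_sq [IsProbabilityMeasure μ]
    (h : IsStationaryVAR μ A Sig0 Psi X W) {M ε q l : ℝ} (hε : 0 < ε) (hε1 : ε < 1)
    (hS : opNorm 2 Sig0 ≤ M) (hA : opNorm 2 A ≤ 1 - ε) (u : Fin d → ℝ) (hu : u ⬝ᵥ u ≤ q)
    (hl : |l| * (2 * M * q / ε) ≤ 1 / 4) (t₀ : ℤ) (n : ℕ) :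
    Integrable (fun ω => Real.exp (l * ∑ r ∈ Finset.range n,
        ((u ⬝ᵥ (X (t₀ + r) ω).ofLp) ^ 2 - u ⬝ᵥ Sig0 *ᵥ u))) μ ∧
      ∫ ω, Real.exp (l * ∑ r ∈ Finset.range n,
        ((u ⬝ᵥ (X (t₀ + r) ω).ofLp) ^ 2 - u ⬝ᵥ Sig0 *ᵥ u)) ∂μ ≤
        Real.exp (4 * l ^ 2 * n * (2 * M * q / ε) ^ 2) := by
  rcases n with _ | n
  · simp
  have hM : 0 ≤ M := (opNorm_nonneg 2 Sig0).trans hS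
  have huu : 0 ≤ u ⬝ᵥ u := by simpa using dotProduct_star_self_nonneg u
  let Y : Fin (n + 1) → Ω → ℝ := fun r ω => u ⬝ᵥ (X (t₀ + (r : ℕ)) ω).ofLp
  have hcov : ∀ i j : Fin (n + 1), |cov[Y i, Y j; μ]| ≤
      M * q * (1 - ε) ^ ((i : ℕ) - j + (j - i)) := by
    have key : ∀ (t : ℤ) (k : ℕ), |cov[fun ω => u ⬝ᵥ (X t ω).ofLp,
        fun ω => u ⬝ᵥ (X (t + k) ω).ofLp; μ]| ≤ M * q * (1 - ε) ^ k := by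
      intro t k
      rw [h.cov_dot_X u u t k]
      refine (abs_dotProduct_mulVec_pow_le Sig0 A u k).trans ?_
      have h1 := pow_le_pow_left₀ (opNorm_nonneg 2 A) hA k
      have h2 : 0 ≤ opNorm 2 A ^ k := pow_nonneg (opNorm_nonneg 2 A) k
      calc opNorm 2 Sig0 * opNorm 2 A ^ k * (u ⬝ᵥ u) ≤ M * (1 - ε) ^ k * q := by
            have := opNorm_nonneg 2 Sig0
            gcongr
        _ = _ := by ring
    intro i j
    rcases le_total (i : ℕ) j with hij | hij
    · have := key (t₀ + (i : ℕ)) (j - i)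
      rw [show t₀ + ((i : ℕ) : ℤ) + ((j - i : ℕ) : ℤ) = t₀ + (j : ℕ) by omega] at this
      rwa [show (i : ℕ) - j + (j - i) = j - i by omega]
    · have := key (t₀ + (j : ℕ)) (i - j)
      rw [show t₀ + ((j : ℕ) : ℤ) + ((i - j : ℕ) : ℤ) = t₀ + (i : ℕ) by omega] at this
      rw [covariance_comm, show (i : ℕ) - j + (j - i) = i - j by omega]
      exact this
  have hY : HasGaussianLaw (fun ω i => Y i ω) μ := by
    let L : (Fin (n + 1) → EuclideanSpace ℝ (Fin d)) →L[ℝ] (Fin (n + 1) → ℝ) :=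
      ContinuousLinearMap.pi fun i => (dotCLM u).comp (ContinuousLinearMap.proj i)
    simpa [L, dotCLM_apply] using! (h.hasGaussianLaw_path t₀ n).map_fun L
  have := exp_sum_sq_gaussian (Y := Y) (l := l) (κ := 2 * M * q / ε)
    (fun i => h.measurable_dot_X u _) hY (fun i => h.integral_dot_X u _) (fun i => by
      refine (Finset.sum_le_sum fun j _ => hcov i j).trans ?_
      rw [← Finset.mul_sum]
      have h1 := sum_pow_dist_le (r := 1 - ε) (by linarith) (by linarith) (n + 1) i
      rw [sub_sub_cancel] at h1
      refine (mul_le_mul_of_nonneg_left h1 (mul_nonneg hM (huu.trans hu))).trans_eq (by ring)) hl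
  simpa only [Y, h.cov_dot_X_self, Finset.sum_range] using! this

/-- By Fubini one may integrate over `w` with `Z` frozen; the normalised exponential then has mean
1. Working with `lintegral` avoids any integrability condition on `F`. -/
lemma lintegral_mul_exp_gaussian [IsProbabilityMeasure μ] {S : Type*} [MeasurableSpace S]
    {Z : Ω → S} {w : Ω → ℝ} (hZ : Measurable Z) (hw : Measurable w) (hind : IndepFun Z w μ)
    {v : NNReal} (hlaw : μ.map w = gaussianReal 0 v) {F : S → ENNReal} (hF : Measurable F)
    {c : S → ℝ} (hc : Measurable c) :
    ∫⁻ ω, F (Z ω) * ENNReal.ofReal (Real.exp (c (Z ω) * w ω - c (Z ω) ^ 2 * v / 2)) ∂μ =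
      ∫⁻ ω, F (Z ω) ∂μ := by
  have hprod := (indepFun_iff_map_prod_eq_prod_map_map hZ.aemeasurable hw.aemeasurable).1 hind
  have : IsProbabilityMeasure (μ.map Z) := Measure.isProbabilityMeasure_map hZ.aemeasurable
  rw [← lintegral_map (f := fun p : S × ℝ =>
    F p.1 * ENNReal.ofReal (Real.exp (c p.1 * p.2 - c p.1 ^ 2 * v / 2)))
    (g := fun ω => (Z ω, w ω)) (by fun_prop) (by fun_prop), hprod, hlaw,
    lintegral_prod _ (by fun_prop), ← lintegral_map hF hZ]
  refine lintegral_congr fun z => ?_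
  simp only
  rw [lintegral_const_mul _ (by fun_prop)]
  have hmgf := mgf_fun_id_gaussianReal (μ := 0) (v := v)
  have h1 : ∫⁻ x, ENNReal.ofReal (Real.exp (c z * x - c z ^ 2 * v / 2)) ∂gaussianReal 0 v = 1 := by
    rw [← ofReal_integral_eq_lintegral_ofReal]
    · simp_rw [sub_eq_add_neg, Real.exp_add]
      rw [integral_mul_const]
      have := congrFun hmgf (c z)
      rw [mgf] at this
      rw [this, ← Real.exp_add]
      ring_nf
      simp
    · simp_rw [sub_eq_add_neg, Real.exp_add]
      exact (integrable_exp_mul_gaussianReal (c z)).mul_const _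
    · exact ae_of_all _ fun x => (Real.exp_pos _).le
  rw [h1, mul_one]

/-- The imaginary counterpart. The compensator now has modulus exp(c²v/2), which can be large, so
integrability has to be supplied. -/
lemma integral_mul_cexp_gaussian [IsProbabilityMeasure μ] {S : Type*} [MeasurableSpace S]
    {Z : Ω → S} {w : Ω → ℝ} (hZ : Measurable Z) (hw : Measurable w) (hind : IndepFun Z w μ)
    {v : NNReal} (hlaw : μ.map w = gaussianReal 0 v) {F : S → ℂ} (hF : Measurable F)
    {c : S → ℝ} (hc : Measurable c)
    (hint : Integrable (fun ω => ‖F (Z ω)‖ * Real.exp (c (Z ω) ^ 2 * v / 2)) μ) :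
    ∫ ω, F (Z ω) * Complex.exp (c (Z ω) * w ω * Complex.I + c (Z ω) ^ 2 * v / 2) ∂μ =
      ∫ ω, F (Z ω) ∂μ := by
  have hprod := (indepFun_iff_map_prod_eq_prod_map_map hZ.aemeasurable hw.aemeasurable).1 hind
  have : IsProbabilityMeasure (μ.map Z) := Measure.isProbabilityMeasure_map hZ.aemeasurable
  let H : S × ℝ → ℂ := fun p =>
    F p.1 * Complex.exp (c p.1 * p.2 * Complex.I + c p.1 ^ 2 * v / 2)
  have hHm : Measurable H := by fun_prop
  have hnorm : ∀ p, ‖H p‖ = ‖F p.1‖ * Real.exp (c p.1 ^ 2 * v / 2) := by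
    intro p
    simp only [H, norm_mul, Complex.norm_exp]
    congr 2
    have : (c p.1 * p.2 * Complex.I + c p.1 ^ 2 * v / 2 : ℂ) =
        ((c p.1 ^ 2 * v / 2 : ℝ) : ℂ) + ((c p.1 * p.2 : ℝ) : ℂ) * Complex.I := by
      push_cast; ring
    rw [this, Complex.add_re, Complex.re_ofReal_mul, Complex.ofReal_re]
    simp
  have hHint : Integrable H ((μ.map Z).prod (gaussianReal 0 v)) := by
    have h1 : Integrable (fun z => ‖F z‖ * Real.exp (c z ^ 2 * v / 2)) (μ.map Z) :=
      (integrable_map_measure (by fun_prop) hZ.aemeasurable).2 hint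
    exact (h1.comp_fst (gaussianReal 0 v)).mono' hHm.aestronglyMeasurable
      (ae_of_all _ fun p => (hnorm p).le)
  have e1 : ∫ ω, H (Z ω, w ω) ∂μ = ∫ p, H p ∂((μ.map Z).prod (gaussianReal 0 v)) := by
    rw [← hlaw, ← hprod, integral_map (by fun_prop) hHm.aestronglyMeasurable]
  refine e1.trans ?_
  rw [integral_prod _ hHint, ← integral_map (f := F) hZ.aemeasurable hF.aestronglyMeasurable]
  refine integral_congr_ae (ae_of_all _ fun z => ?_)
  simp only [H]
  rw [integral_const_mul]
  have hcf := charFun_gaussianReal (μ := 0) (v := v) (c z)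
  rw [charFun_apply_real] at hcf
  simp_rw [Complex.exp_add]
  rw [integral_mul_const, hcf, ← Complex.exp_add]
  ring_nf
  simp

end VARInference
-- Exponential martingales built from the innovations.
namespace VARInference

variable {d : ℕ}

/-- The innovation `e ⬝ (x_{t+1} - Aᵀ x_t)` in direction `e`. -/
def innov (A : Matrix (Fin d) (Fin d) ℝ) (e : Fin d → ℝ) (x : ℤ → EuclideanSpace ℝ (Fin d))
    (t : ℤ) : ℝ :=
  e ⬝ᵥ (x (t + 1)).ofLp - (A *ᵥ e) ⬝ᵥ (x t).ofLp

/-- A path indexed by `r < t`, extended by zero. -/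
def extendPath {t : ℤ} (z : Set.Iio t → EuclideanSpace ℝ (Fin d)) (r : ℤ) :
    EuclideanSpace ℝ (Fin d) :=
  if hr : r < t then z ⟨r, hr⟩ else 0

lemma measurable_extendPath {t : ℤ} :
    Measurable (extendPath (d := d) (t := t)) := by
  refine measurable_pi_lambda _ fun r => ?_
  unfold extendPath
  split_ifs with hr
  · exact measurable_pi_apply _
  · exact measurable_const

lemma extendPath_apply {t : ℤ} (x : ℤ → EuclideanSpace ℝ (Fin d)) {r : ℤ} (hr : r < t) :
    extendPath (fun r : Set.Iio t => x r) r = x r := dif_pos hr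

lemma measurable_eval_dot (u : Fin d → ℝ) (t : ℤ) :
    Measurable fun x : ℤ → EuclideanSpace ℝ (Fin d) => u ⬝ᵥ (x t).ofLp := by
  unfold dotProduct
  fun_prop

lemma measurable_innov (A : Matrix (Fin d) (Fin d) ℝ) (e : Fin d → ℝ) (t : ℤ) :
    Measurable fun x => innov A e x t := by
  unfold innov
  have := measurable_eval_dot e (t + 1)
  have := measurable_eval_dot (A *ᵥ e) t
  fun_prop

variable {Ω : Type*} [MeasurableSpace Ω] {μ : Measure Ω}
  {A Sig0 Psi : Matrix (Fin d) (Fin d) ℝ} {X W : ℤ → Ω → EuclideanSpace ℝ (Fin d)}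

namespace IsStationaryVAR

lemma innov_ae_eq (h : IsStationaryVAR μ A Sig0 Psi X W) (e : Fin d → ℝ) (t : ℤ) :
    ∀ᵐ ω ∂μ, innov A e (fun r => X r ω) t = e ⬝ᵥ (W (t + 1) ω).ofLp := by
  filter_upwards [h.recursion_dot e (t + 1)] with ω hω
  rw [add_sub_cancel_right] at hω
  rw [innov, hω, add_sub_cancel_left]

lemma measurable_history (h : IsStationaryVAR μ A Sig0 Psi X W) (t : ℤ) :
    Measurable fun ω (r : Set.Iio t) => X r ω :=
  measurable_pi_lambda _ fun r => h.measurable_X r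

lemma indepFun_history_dot_W (h : IsStationaryVAR μ A Sig0 Psi X W) (e : Fin d → ℝ) (t : ℤ) :
    IndepFun (fun ω (r : Set.Iio t) => X r ω) (fun ω => e ⬝ᵥ (W t ω).ofLp) μ := by
  have h1 := ((h.indep_history t).comp (φ := fun x => dotCLM e x) (ψ := id) (by fun_prop)
    measurable_id).symm
  simpa [Function.comp_def, dotCLM_apply] using h1

/-- Induction removes the latest factor: given the history it is a normalised Gaussian exponential
with mean 1. -/
theorem lintegral_exp_martingale [IsProbabilityMeasure μ] (h : IsStationaryVAR μ A Sig0 Psi X W)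
    (u e : Fin d → ℝ) (l : ℝ) (n : ℕ) :
    ∫⁻ ω, ENNReal.ofReal (Real.exp (∑ t ∈ Finset.Icc 1 n,
      (l * (u ⬝ᵥ (X t ω).ofLp) * innov A e (fun r => X r ω) t -
        l ^ 2 * (u ⬝ᵥ (X t ω).ofLp) ^ 2 * (e ⬝ᵥ Psi *ᵥ e) / 2))) ∂μ = 1 := by
  induction n with
  | zero => simp
  | succ n ih =>
    have hv : 0 ≤ e ⬝ᵥ Psi *ᵥ e := by simpa using h.posSemidef_Psi.dotProduct_mulVec_nonneg e
    set v := (e ⬝ᵥ Psi *ᵥ e).toNNReal with hvdef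
    have hvc : (v : ℝ) = e ⬝ᵥ Psi *ᵥ e := Real.coe_toNNReal _ hv
    let G : (ℤ → EuclideanSpace ℝ (Fin d)) → ENNReal := fun x =>
      ENNReal.ofReal (Real.exp (∑ t ∈ Finset.Icc 1 n,
        (l * (u ⬝ᵥ (x t).ofLp) * innov A e x t -
          l ^ 2 * (u ⬝ᵥ (x t).ofLp) ^ 2 * (e ⬝ᵥ Psi *ᵥ e) / 2)))
    have hGm : Measurable G := by
      refine ENNReal.measurable_ofReal.comp (Real.measurable_exp.comp
        (Finset.measurable_fun_sum _ fun t _ => ?_))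
      have := measurable_eval_dot u t
      have := measurable_innov A e t
      fun_prop
    -- The first `n` factors read the path up to time n+1 only, so they are functions of the history
    -- before n+2. The factor at t = n+1 adds exactly the innovation at time n+2.
    have hG : ∀ x : ℤ → EuclideanSpace ℝ (Fin d),
        G (extendPath fun r : Set.Iio ((n : ℤ) + 2) => x r) = G x := by
      intro x
      simp only [G]
      congr 2
      refine Finset.sum_congr rfl fun t ht => ?_
      have := (Finset.mem_Icc.1 ht).2
      rw [innov, innov, extendPath_apply x (by omega), extendPath_apply x (by omega)]
    have hstep := lintegral_mul_exp_gaussian (μ := μ) (h.measurable_history ((n : ℤ) + 2))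
      (h.measurable_dot_W e ((n : ℤ) + 2)) (h.indepFun_history_dot_W e ((n : ℤ) + 2))
      (h.map_dot_W e ((n : ℤ) + 2)) (F := fun z => G (extendPath z))
      (hGm.comp measurable_extendPath)
      (c := fun z => l * (u ⬝ᵥ (extendPath z (n + 1)).ofLp))
      (((measurable_eval_dot u (n + 1)).comp measurable_extendPath).const_mul l)
    have hG' : ∀ ω, G (extendPath fun r : Set.Iio ((n : ℤ) + 2) => X r ω) = G fun r => X r ω :=
      fun ω => hG fun r => X r ω
    have hx : ∀ ω, extendPath (fun r : Set.Iio ((n : ℤ) + 2) => X r ω) (n + 1) = X (n + 1) ω :=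
      fun ω => extendPath_apply (fun r => X r ω) (by omega)
    simp only [hG', hx, ← hvdef, hvc] at hstep
    refine Eq.trans ?_ (hstep.trans ih)
    refine lintegral_congr_ae ?_
    filter_upwards [h.innov_ae_eq e (n + 1)] with ω hω
    simp only [G]
    rw [← ENNReal.ofReal_mul (Real.exp_pos _).le, ← Real.exp_add,
      ← Finset.insert_Icc_right_eq_Icc_add_one (by omega), Finset.sum_insert (by simp), add_comm]
    push_cast
    rw [hω, show (n : ℤ) + 1 + 1 = n + 2 by ring]
    congr 2
    ring

theorem integral_cexp_martingale [IsProbabilityMeasure μ] (h : IsStationaryVAR μ A Sig0 Psi X W)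
    (u e : Fin d → ℝ) (l : ℝ) (n : ℕ)
    (hint : Integrable (fun ω => Real.exp (∑ t ∈ Finset.Icc 1 n,
      l ^ 2 * (u ⬝ᵥ (X t ω).ofLp) ^ 2 * (e ⬝ᵥ Psi *ᵥ e) / 2)) μ) :
    ∫ ω, Complex.exp (∑ t ∈ Finset.Icc 1 n,
      (((l * (u ⬝ᵥ (X t ω).ofLp) * innov A e (fun r => X r ω) t : ℝ) : ℂ) * Complex.I +
        ((l ^ 2 * (u ⬝ᵥ (X t ω).ofLp) ^ 2 * (e ⬝ᵥ Psi *ᵥ e) / 2 : ℝ) : ℂ))) ∂μ = 1 := by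
  induction n with
  | zero => simp
  | succ n ih =>
    have hv : 0 ≤ e ⬝ᵥ Psi *ᵥ e := by simpa using h.posSemidef_Psi.dotProduct_mulVec_nonneg e
    set v := (e ⬝ᵥ Psi *ᵥ e).toNNReal with hvdef
    have hvc : (v : ℝ) = e ⬝ᵥ Psi *ᵥ e := Real.coe_toNNReal _ hv
    have hsplit : ∀ {E : Type} [AddCommMonoid E] (f : ℕ → E),
        ∑ t ∈ Finset.Icc 1 (n + 1), f t = ∑ t ∈ Finset.Icc 1 n, f t + f (n + 1) := by
      intro E _ f
      rw [← Finset.insert_Icc_right_eq_Icc_add_one (by omega), Finset.sum_insert (by simp),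
        add_comm]
    have hmeas : ∀ t : ℤ, Measurable fun ω => u ⬝ᵥ (X t ω).ofLp := h.measurable_dot_X u
    -- The compensators are nonnegative, so integrability for n+1 terms dominates that for n.
    have hint' : Integrable (fun ω => Real.exp (∑ t ∈ Finset.Icc 1 n,
        l ^ 2 * (u ⬝ᵥ (X t ω).ofLp) ^ 2 * (e ⬝ᵥ Psi *ᵥ e) / 2)) μ := by
      refine hint.mono' ?_ (ae_of_all _ fun ω => ?_)
      · exact (Real.measurable_exp.comp (Finset.measurable_fun_sum _ fun t _ => by
          have := hmeas t; fun_prop)).aestronglyMeasurable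
      · rw [Real.norm_eq_abs, Real.abs_exp, Real.exp_le_exp, hsplit]
        have : 0 ≤ l ^ 2 * (u ⬝ᵥ (X ((n + 1 : ℕ) : ℤ) ω).ofLp) ^ 2 * (e ⬝ᵥ Psi *ᵥ e) / 2 := by
          positivity
        linarith
    let G : (ℤ → EuclideanSpace ℝ (Fin d)) → ℂ := fun x =>
      Complex.exp (∑ t ∈ Finset.Icc 1 n,
        (((l * (u ⬝ᵥ (x t).ofLp) * innov A e x t : ℝ) : ℂ) * Complex.I +
          ((l ^ 2 * (u ⬝ᵥ (x t).ofLp) ^ 2 * (e ⬝ᵥ Psi *ᵥ e) / 2 : ℝ) : ℂ)))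
    have hGm : Measurable G := by
      refine Complex.measurable_exp.comp (Finset.measurable_fun_sum _ fun t _ => ?_)
      have := measurable_eval_dot u t
      have := measurable_innov A e t
      fun_prop
    have hGn : ∀ x, ‖G x‖ = Real.exp (∑ t ∈ Finset.Icc 1 n,
        l ^ 2 * (u ⬝ᵥ (x t).ofLp) ^ 2 * (e ⬝ᵥ Psi *ᵥ e) / 2) := by
      intro x
      simp only [G, Complex.norm_exp, Complex.re_sum, Complex.add_re, Complex.re_ofReal_mul,
        Complex.ofReal_re, Complex.I_re, mul_zero, zero_add]
    have hG : ∀ x : ℤ → EuclideanSpace ℝ (Fin d),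
        G (extendPath fun r : Set.Iio ((n : ℤ) + 2) => x r) = G x := by
      intro x
      simp only [G]
      congr 1
      refine Finset.sum_congr rfl fun t ht => ?_
      have := (Finset.mem_Icc.1 ht).2
      rw [innov, innov, extendPath_apply x (by omega), extendPath_apply x (by omega)]
    have hG' : ∀ ω, G (extendPath fun r : Set.Iio ((n : ℤ) + 2) => X r ω) = G fun r => X r ω :=
      fun ω => hG fun r => X r ω
    have hx : ∀ ω, extendPath (fun r : Set.Iio ((n : ℤ) + 2) => X r ω) (n + 1) = X (n + 1) ω :=
      fun ω => extendPath_apply (fun r => X r ω) (by omega)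
    have hstep := integral_mul_cexp_gaussian (μ := μ) (h.measurable_history ((n : ℤ) + 2))
      (h.measurable_dot_W e ((n : ℤ) + 2)) (h.indepFun_history_dot_W e ((n : ℤ) + 2))
      (h.map_dot_W e ((n : ℤ) + 2)) (F := fun z => G (extendPath z))
      (hGm.comp measurable_extendPath)
      (c := fun z => l * (u ⬝ᵥ (extendPath z (n + 1)).ofLp))
      (((measurable_eval_dot u (n + 1)).comp measurable_extendPath).const_mul l) (by
        simp only [hG', hx, ← hvdef, hvc, hGn]
        refine hint.congr (ae_of_all _ fun ω => ?_)
        simp only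
        rw [hsplit, Real.exp_add]
        push_cast
        congr 2
        ring)
    simp only [hG', hx, ← hvdef, hvc] at hstep
    refine Eq.trans ?_ (hstep.trans (ih hint'))
    refine integral_congr_ae ?_
    filter_upwards [h.innov_ae_eq e (n + 1)] with ω hω
    simp only [G]
    rw [← Complex.exp_add, hsplit]
    push_cast
    rw [hω]
    rw [show (n : ℤ) + 1 + 1 = n + 2 by ring]
    congr 1
    ring

end IsStationaryVAR
end VARInference
-- Concentration: almost every path is good.
namespace VARInference

/-- The rate `√(log d / T)`. -/
noncomputable def rate (d T : ℕ) : ℝ := √(Real.log d / T)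

/-- The score noise `∑_{t<T} x_{t,i} w_{t+1,m}` of a path. -/
noncomputable def scoreNoise {d : ℕ} (T : ℕ) (A : Matrix (Fin d) (Fin d) ℝ) (m : Fin d)
    (x : ℤ → EuclideanSpace ℝ (Fin d)) (i : Fin d) : ℝ :=
  ∑ t ∈ Finset.Icc 1 (T - 1), x t i * innov A (Pi.single m 1) x t

/-- The path behaves like a typical one, up to the constant `a`. -/
structure GoodPath {d : ℕ} (T : ℕ) (A Sig0 : Matrix (Fin d) (Fin d) ℝ) (m : Fin d) (a : ℝ)
    (x : ℤ → EuclideanSpace ℝ (Fin d)) : Prop where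
  cov : ∀ i j, |S0 T x i j - Sig0 i j| ≤ a * rate d T
  noise : ∀ i, |scoreNoise T A m x i| ≤ a * T * rate d T
  last : ∀ i, x T i ^ 2 ≤ a * Real.log d

lemma sum_Icc_eq_sum_range (T : ℕ) (f : ℤ → ℝ) :
    ∑ t ∈ Finset.Icc 1 T, f (t : ℤ) = ∑ r ∈ Finset.range T, f (1 + (r : ℤ)) := by
  induction T with
  | zero => simp
  | succ n ih =>
    rw [← Finset.insert_Icc_right_eq_Icc_add_one (by omega), Finset.sum_insert (by simp), ih,
      Finset.sum_range_succ, add_comm]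
    push_cast
    rw [add_comm 1 (n : ℤ)]

variable {d : ℕ} {Ω : Type*} [MeasurableSpace Ω] {μ : Measure Ω}
  {A Sig0 Psi : Matrix (Fin d) (Fin d) ℝ} {X W : ℤ → Ω → EuclideanSpace ℝ (Fin d)}

namespace IsStationaryVAR

/-- Chernoff's bound at `l` and `-l`, one for each tail. -/
theorem tail_sum_sq [IsProbabilityMeasure μ]
    (h : IsStationaryVAR μ A Sig0 Psi X W) {M ε q l : ℝ} (hε : 0 < ε) (hε1 : ε < 1)
    (hS : opNorm 2 Sig0 ≤ M) (hA : opNorm 2 A ≤ 1 - ε) (u : Fin d → ℝ) (hu : u ⬝ᵥ u ≤ q)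
    (hl0 : 0 ≤ l) (hl : l * (2 * M * q / ε) ≤ 1 / 4) (t₀ : ℤ) (n : ℕ) (y : ℝ) :
    μ.real {ω | y ≤ |∑ r ∈ Finset.range n,
        ((u ⬝ᵥ (X (t₀ + r) ω).ofLp) ^ 2 - u ⬝ᵥ Sig0 *ᵥ u)|} ≤
      2 * Real.exp (-l * y + 4 * l ^ 2 * n * (2 * M * q / ε) ^ 2) := by
  set Z : Ω → ℝ := fun ω => ∑ r ∈ Finset.range n,
        ((u ⬝ᵥ (X (t₀ + r) ω).ofLp) ^ 2 - u ⬝ᵥ Sig0 *ᵥ u) with hZ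
  have h1 := h.exp_sum_sq (l := l) hε hε1 hS hA u hu (by rwa [abs_of_nonneg hl0]) t₀ n
  have h2 := h.exp_sum_sq (l := -l) hε hε1 hS hA u hu (by rwa [abs_neg, abs_of_nonneg hl0]) t₀ n
  have m1 := measure_ge_le_exp_mul_mgf (X := Z) y hl0 h1.1
  have m2 := measure_le_le_exp_mul_mgf (X := Z) (-y) (neg_nonpos.2 hl0) h2.1
  have hsub : {ω | y ≤ |Z ω|} ⊆ {ω | y ≤ Z ω} ∪ {ω | Z ω ≤ -y} := by
    intro ω (hω : y ≤ |Z ω|)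
    rcases le_abs.1 hω with h | h
    · exact Or.inl h
    · exact Or.inr (by simp only [Set.mem_ofPred_eq]; linarith)
  refine (measureReal_mono hsub).trans ((measureReal_union_le _ _).trans ?_)
  rw [Real.exp_add, two_mul]
  refine add_le_add (m1.trans ?_) (m2.trans ?_)
  · exact mul_le_mul_of_nonneg_left h1.2 (Real.exp_pos _).le
  · rw [neg_neg, mul_neg]
    have := h2.2
    rw [neg_sq] at this
    rw [neg_mul]
    exact mul_le_mul_of_nonneg_left this (Real.exp_pos _).le

/-- Markov's inequality for the exponential martingale of mean 1. The quadratic compensator stays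
inside the event and is bounded later, on good paths. -/
theorem tail_martingale [IsProbabilityMeasure μ] (h : IsStationaryVAR μ A Sig0 Psi X W)
    (u e : Fin d → ℝ) (l y : ℝ) (n : ℕ) :
    μ.real {ω | y ≤ ∑ t ∈ Finset.Icc 1 n,
      (l * (u ⬝ᵥ (X t ω).ofLp) * innov A e (fun r => X r ω) t -
        l ^ 2 * (u ⬝ᵥ (X t ω).ofLp) ^ 2 * (e ⬝ᵥ Psi *ᵥ e) / 2)} ≤ Real.exp (-y) := by
  set Z : Ω → ℝ := fun ω => ∑ t ∈ Finset.Icc 1 n,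
      (l * (u ⬝ᵥ (X t ω).ofLp) * innov A e (fun r => X r ω) t -
        l ^ 2 * (u ⬝ᵥ (X t ω).ofLp) ^ 2 * (e ⬝ᵥ Psi *ᵥ e) / 2) with hZ
  have h1 := h.lintegral_exp_martingale u e l n
  have hZm : Measurable Z := by
    refine Finset.measurable_fun_sum _ fun t _ => ?_
    have := h.measurable_dot_X u t
    have h3 := (measurable_innov A e t).comp
      (measurable_pi_lambda (fun ω r => X r ω) h.measurable_X)
    simp only [Function.comp_def] at h3
    fun_prop
  have h2 := mul_meas_ge_le_lintegral (μ := μ)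
    (f := fun ω => ENNReal.ofReal (Real.exp (Z ω))) (by fun_prop) (ENNReal.ofReal (Real.exp y))
  rw [h1] at h2
  have h3 : {ω | ENNReal.ofReal (Real.exp y) ≤ ENNReal.ofReal (Real.exp (Z ω))} =
      {ω | y ≤ Z ω} := by
    ext ω
    simp only [Set.mem_ofPred_eq]
    rw [ENNReal.ofReal_le_ofReal_iff (Real.exp_pos _).le, Real.exp_le_exp]
  rw [h3] at h2
  rw [measureReal_def, Real.exp_neg]
  have h4 := ENNReal.toReal_mono ENNReal.one_ne_top h2
  rw [ENNReal.toReal_mul, ENNReal.toReal_ofReal (Real.exp_pos _).le, ENNReal.toReal_one] at h4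
  rwa [← one_div, le_div_iff₀' (Real.exp_pos _)]

/-- A union bound with Chernoff parameter ρ; since Tρ² = log d every exponent is a multiple of log
d. The conditions on `a` pay for the d² covariance entries, the d noise coordinates and the d
coordinates of the last observation, leaving d⁻ᵍ in each case. -/
theorem measureReal_not_goodPath_le [IsProbabilityMeasure μ]
    (h : IsStationaryVAR μ A Sig0 Psi X W) {M ε a g : ℝ} (hε : 0 < ε) (hε1 : ε < 1)
    (hM : 0 < M) (hS : opNorm 2 Sig0 ≤ M) (hA : opNorm 2 A ≤ 1 - ε) (hd2 : 2 ≤ d)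
    (m : Fin d) {T : ℕ} (hT : 1 ≤ T) (hρ : rate d T * (2 * M * 4 / ε) ≤ 1 / 4) (haρ : a * rate d T ≤ M)
    (ha1 : g + 2 + 4 * (2 * M * 4 / ε) ^ 2 ≤ 2 * a) (ha2 : g + 1 + M ^ 2 ≤ a)
    (ha3 : g + 1 ≤ a / (4 * (2 * M * 4 / ε))) :
    μ.real {ω | ¬ GoodPath T A Sig0 m a (fun t => X t ω)} ≤
      10 * Real.exp (-g * Real.log d) := by
  set κ : ℝ := 2 * M * 4 / ε with hκ
  have hκ0 : 0 < κ := by positivity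
  have hκM : 8 * M ≤ κ := by
    rw [hκ, le_div_iff₀ hε]; nlinarith
  have hd : 0 < d := Fin.pos m
  have hd' : (0 : ℝ) < d := by exact_mod_cast hd
  set L := Real.log d with hLdef
  have hL : 0 ≤ L := Real.log_natCast_nonneg d
  have hdL : (d : ℝ) = Real.exp L := (Real.exp_log hd').symm
  set ρ := rate d T with hρdef
  have hρ0 : 0 ≤ ρ := Real.sqrt_nonneg _
  have hT' : (0 : ℝ) < T := by exact_mod_cast hT
  have hTρ : T * ρ ^ 2 = L := by
    rw [hρdef, rate, Real.sq_sqrt (by positivity)]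
    rw [hLdef]
    field_simp
  have hLpos : 0 < L := Real.log_pos (by exact_mod_cast hd2)
  have hρpos : 0 < ρ := Real.sqrt_pos.2 (by positivity)
  have hsymm : ∀ i j, Sig0 i j = Sig0 j i := fun i j => by
    have := h.posSemidef_Sig0.isHermitian.apply j i
    simpa using this
  -- the three families of exceptional events
  let up : Fin d → Fin d → Fin d → ℝ := fun i j => Pi.single i 1 + Pi.single j 1
  let um : Fin d → Fin d → Fin d → ℝ := fun i j => Pi.single i 1 - Pi.single j 1
  let Q : (Fin d → ℝ) → Ω → ℝ := fun u ω => ∑ r ∈ Finset.range T,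
        ((u ⬝ᵥ (X (1 + (r : ℤ)) ω).ofLp) ^ 2 - u ⬝ᵥ Sig0 *ᵥ u)
  let B1 : Fin d → Fin d → Set Ω := fun i j =>
    {ω | 2 * a * T * ρ ≤ |Q (up i j) ω|} ∪ {ω | 2 * a * T * ρ ≤ |Q (um i j) ω|}
  let R : ℝ → Fin d → Ω → ℝ := fun l i ω => ∑ t ∈ Finset.Icc 1 (T - 1),
      (l * ((Pi.single i 1 : Fin d → ℝ) ⬝ᵥ (X t ω).ofLp) *
          innov A (Pi.single m 1) (fun r => X r ω) t -
        l ^ 2 * ((Pi.single i 1 : Fin d → ℝ) ⬝ᵥ (X t ω).ofLp) ^ 2 *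
          ((Pi.single m 1 : Fin d → ℝ) ⬝ᵥ Psi *ᵥ (Pi.single m 1)) / 2)
  let B2 : Fin d → Set Ω := fun i =>
    {ω | (a - M ^ 2) * L ≤ R ρ i ω} ∪ {ω | (a - M ^ 2) * L ≤ R (-ρ) i ω}
  let B3 : Fin d → Set Ω := fun i => {ω | a * L - M ≤ |∑ r ∈ Finset.range 1,
        (((Pi.single i 1 : Fin d → ℝ) ⬝ᵥ (X ((T : ℤ) + r) ω).ofLp) ^ 2 -
          (Pi.single i 1 : Fin d → ℝ) ⬝ᵥ Sig0 *ᵥ (Pi.single i 1))|}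
  have hup : ∀ i j, up i j ⬝ᵥ up i j ≤ 4 := by
    intro i j
    simp only [up, dotProduct_add, add_dotProduct, single_dotProduct, Pi.single_apply]
    split_ifs <;> norm_num
  have hum : ∀ i j, um i j ⬝ᵥ um i j ≤ 4 := by
    intro i j
    simp only [um, dotProduct_sub, sub_dotProduct, single_dotProduct, Pi.single_apply]
    split_ifs <;> norm_num
  have hPsiM : Psi m m ≤ M := by
    have h1 := h.sig0_eq (Pi.single m 1)
    have h2 := h.posSemidef_Sig0.dotProduct_mulVec_nonneg (A *ᵥ Pi.single m 1)
    have h3 := (le_abs_self _).trans ((abs_apply_le_opNorm_two Sig0 m m).trans hS)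
    simp only [star_trivial] at h2
    simp at h1 h2
    linarith
  have hPsi0 : 0 ≤ Psi m m := h.posSemidef_Psi.diag_nonneg
  have hSM : ∀ i, Sig0 i i ≤ M := fun i =>
    (le_abs_self _).trans ((abs_apply_le_opNorm_two Sig0 i i).trans hS)
  have hS0 : ∀ i, 0 ≤ Sig0 i i := fun i => h.posSemidef_Sig0.diag_nonneg
  have hp1 : ∀ i j, μ.real (B1 i j) ≤ 4 * Real.exp (-(2 * a - 4 * κ ^ 2) * L) := by
    intro i j
    have t1 := h.tail_sum_sq hε hε1 hS hA (up i j) (hup i j) hρ0 hρ 1 T (2 * a * T * ρ)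
    have t2 := h.tail_sum_sq hε hε1 hS hA (um i j) (hum i j) hρ0 hρ 1 T (2 * a * T * ρ)
    have e : -ρ * (2 * a * T * ρ) + 4 * ρ ^ 2 * T * κ ^ 2 = -(2 * a - 4 * κ ^ 2) * L := by
      rw [← hTρ]; ring
    rw [← hκ, e] at t1 t2
    refine (measureReal_union_le _ _).trans ?_
    linarith
  have hp2 : ∀ i, μ.real (B2 i) ≤ 2 * Real.exp (-((a - M ^ 2) * L)) := by
    intro i
    have t1 := h.tail_martingale (Pi.single i 1) (Pi.single m 1) ρ ((a - M ^ 2) * L) (T - 1)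
    have t2 := h.tail_martingale (Pi.single i 1) (Pi.single m 1) (-ρ) ((a - M ^ 2) * L) (T - 1)
    refine (measureReal_union_le _ _).trans ?_
    linarith
  have hp3 : ∀ i, μ.real (B3 i) ≤ 4 * Real.exp (-(a / (4 * κ)) * L) := by
    intro i
    -- A single observation does not concentrate, so the parameter is the largest admissible
    -- constant instead of ρ.
    have t1 := h.tail_sum_sq (q := 4) (l := 1 / (4 * κ)) hε hε1 hS hA (Pi.single i 1)
      (by simp) (by positivity) (by rw [← hκ]; field_simp; exact le_refl _) T 1 (a * L - M)
    refine t1.trans ?_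
    rw [← hκ]
    have e : -(1 / (4 * κ)) * (a * L - M) + 4 * (1 / (4 * κ)) ^ 2 * (1 : ℕ) * κ ^ 2 =
        -(a / (4 * κ)) * L + (M / (4 * κ) + 1 / 4) := by
      push_cast
      field_simp
      ring
    have e2 : M / (4 * κ) ≤ 1 / 32 := by
      rw [div_le_iff₀ (by positivity)]; linarith
    rw [e, Real.exp_add]
    have e3 : Real.exp (M / (4 * κ) + 1 / 4) ≤ 2 := by
      have : Real.exp (M / (4 * κ) + 1 / 4) ≤ Real.exp (1 / 2) := Real.exp_le_exp.2 (by linarith)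
      refine this.trans ?_
      have h4 := Real.exp_one_lt_d9
      have h5 : Real.exp (1 / 2) * Real.exp (1 / 2) = Real.exp 1 := by
        rw [← Real.exp_add]; norm_num
      nlinarith [Real.exp_pos (1 / 2)]
    nlinarith [Real.exp_pos (-(a / (4 * κ)) * L)]
  have hsub : {ω | ¬ GoodPath T A Sig0 m a (fun t => X t ω)} ⊆
      ((⋃ i, ⋃ j, B1 i j) ∪ ⋃ i, B2 i) ∪ ⋃ i, B3 i := by
    intro ω hω
    by_contra hcon
    simp only [Set.mem_union, Set.mem_iUnion, not_or, not_exists] at hcon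
    obtain ⟨⟨c1, c2⟩, c3⟩ := hcon
    have g1 : ∀ i j, |S0 T (fun t => X t ω) i j - Sig0 i j| ≤ a * ρ := by
      intro i j
      have := c1 i j
      simp only [B1, Set.mem_union, Set.mem_ofPred_eq, not_or, not_le] at this
      obtain ⟨b1, b2⟩ := this
      have e : 4 * T * (S0 T (fun t => X t ω) i j - Sig0 i j) =
          Q (up i j) ω - Q (um i j) ω := by
        simp only [Q, S0]
        rw [sum_Icc_eq_sum_range T fun t => X t ω i * X t ω j, mul_sub, ← mul_assoc,
          mul_assoc 4, mul_inv_cancel₀ hT'.ne', mul_one, ← Finset.sum_sub_distrib,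
          Finset.mul_sum]
        rw [show 4 * (T : ℝ) * Sig0 i j = ∑ r ∈ Finset.range T, 4 * Sig0 i j by
          simp; ring, ← Finset.sum_sub_distrib]
        refine Finset.sum_congr rfl fun r _ => ?_
        simp only [up, um, add_dotProduct, sub_dotProduct, Matrix.mulVec_add, Matrix.mulVec_sub,
          dotProduct_add, dotProduct_sub]
        simp
        rw [hsymm j i]
        ring
      have : |4 * T * (S0 T (fun t => X t ω) i j - Sig0 i j)| ≤ 4 * T * (a * ρ) := by
        rw [e]
        refine (abs_sub _ _).trans ?_
        linarith
      rw [abs_mul, abs_of_pos (by positivity : (0 : ℝ) < 4 * T)] at this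
      exact le_of_mul_le_mul_left this (by positivity)
    -- The compensator of the noise martingale is controlled by the diagonal covariance bounds just
    -- obtained, so no further event is needed.
    have hsq : ∀ i, ∑ t ∈ Finset.Icc 1 (T - 1), (X t ω i) ^ 2 ≤ 2 * M * T := by
      intro i
      have h1 : ∑ t ∈ Finset.Icc 1 (T - 1), (X t ω i) ^ 2 ≤
          ∑ t ∈ Finset.Icc 1 T, (X t ω i) ^ 2 :=
        Finset.sum_le_sum_of_subset_of_nonneg
          (Finset.Icc_subset_Icc_right (Nat.sub_le _ _)) fun _ _ _ => sq_nonneg _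
      have h2 := (abs_le.1 (g1 i i)).2
      have h3 : ∑ t ∈ Finset.Icc 1 T, (X t ω i) ^ 2 = T * S0 T (fun t => X t ω) i i := by
        simp only [S0]
        rw [← mul_assoc, mul_inv_cancel₀ hT'.ne', one_mul]
        simp [sq]
      have := hSM i
      have h5 := mul_le_mul_of_nonneg_left (show S0 T (fun t => X t ω) i i ≤ 2 * M by linarith) hT'.le
      linarith
    refine hω ⟨g1, fun i => ?_, fun i => ?_⟩
    · have := c2 i
      simp only [B2, Set.mem_union, Set.mem_ofPred_eq, not_or, not_le] at this
      obtain ⟨b1, b2⟩ := this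
      have hR : ∀ l, R l i ω = l * scoreNoise T A m (fun t => X t ω) i -
          l ^ 2 * (Psi m m / 2) * ∑ t ∈ Finset.Icc 1 (T - 1), (X t ω i) ^ 2 := by
        intro l
        simp only [R, scoreNoise, Finset.mul_sum]
        rw [← Finset.sum_sub_distrib]
        refine Finset.sum_congr rfl fun t _ => ?_
        simp
        ring
      rw [hR] at b1 b2
      have h4 : ρ ^ 2 * (Psi m m / 2) * ∑ t ∈ Finset.Icc 1 (T - 1), (X t ω i) ^ 2 ≤ M ^ 2 * L := by
        calc _ ≤ ρ ^ 2 * (M / 2) * (2 * M * T) := by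
              gcongr
              exact hsq i
          _ = M ^ 2 * L := by rw [← hTρ]; ring
      have hsplit : ρ * (a * T * ρ) = a * L := by rw [← hTρ]; ring
      rw [neg_sq] at b2
      rw [abs_le]
      constructor
      · exact le_of_mul_le_mul_left (by linarith) hρpos
      · exact le_of_mul_le_mul_left (by linarith) hρpos
    · have := c3 i
      simp only [B3, Set.mem_ofPred_eq, not_le] at this
      have h1 := (le_abs_self _).trans_lt this
      simp at h1
      have := hSM i
      linarith
  have hunion : μ.real (((⋃ i, ⋃ j, B1 i j) ∪ ⋃ i, B2 i) ∪ ⋃ i, B3 i) ≤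
      d * (d * (4 * Real.exp (-(2 * a - 4 * κ ^ 2) * L))) +
        d * (2 * Real.exp (-((a - M ^ 2) * L))) + d * (4 * Real.exp (-(a / (4 * κ)) * L)) := by
    refine (measureReal_union_le _ _).trans (add_le_add ((measureReal_union_le _ _).trans
      (add_le_add ?_ ?_)) ?_)
    · refine (measureReal_iUnion_fintype_le _).trans ?_
      refine (Finset.sum_le_card_nsmul _ _ _ fun i _ =>
        (measureReal_iUnion_fintype_le _).trans
        (Finset.sum_le_card_nsmul _ _ _ fun j _ => hp1 i j)).trans_eq ?_
      simp
    · refine (measureReal_iUnion_fintype_le _).trans ?_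
      refine (Finset.sum_le_card_nsmul _ _ _ fun i _ => hp2 i).trans_eq ?_
      simp
    · refine (measureReal_iUnion_fintype_le _).trans ?_
      refine (Finset.sum_le_card_nsmul _ _ _ fun i _ => hp3 i).trans_eq ?_
      simp
  refine (measureReal_mono hsub).trans (hunion.trans ?_)
  rw [hdL]
  have k1 : Real.exp L * (Real.exp L * (4 * Real.exp (-(2 * a - 4 * κ ^ 2) * L))) ≤
      4 * Real.exp (-g * L) := by
    have : Real.exp L * (Real.exp L * (4 * Real.exp (-(2 * a - 4 * κ ^ 2) * L))) =
      4 * Real.exp (L + (L + -(2 * a - 4 * κ ^ 2) * L)) := by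
      rw [Real.exp_add, Real.exp_add]; ring
    rw [this]
    gcongr
    have := mul_le_mul_of_nonneg_right ha1 hL
    linarith
  have k2 : Real.exp L * (2 * Real.exp (-((a - M ^ 2) * L))) ≤ 2 * Real.exp (-g * L) := by
    have : Real.exp L * (2 * Real.exp (-((a - M ^ 2) * L))) =
        2 * Real.exp (L + -((a - M ^ 2) * L)) := by
      rw [Real.exp_add]; ring
    rw [this]
    gcongr
    have := mul_le_mul_of_nonneg_right ha2 hL
    linarith
  have k3 : Real.exp L * (4 * Real.exp (-(a / (4 * κ)) * L)) ≤ 4 * Real.exp (-g * L) := by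
    have : Real.exp L * (4 * Real.exp (-(a / (4 * κ)) * L)) =
        4 * Real.exp (L + -(a / (4 * κ)) * L) := by
      rw [Real.exp_add]; ring
    rw [this]
    gcongr
    have := mul_le_mul_of_nonneg_right ha3 hL
    linarith
  linarith

end IsStationaryVAR
end VARInference
-- ℓ¹ geometry of the two linear programs.
namespace VARInference

variable {d : ℕ}

lemma l1_nonneg (x : Fin d → ℝ) : 0 ≤ l1 x := Finset.sum_nonneg fun _ _ => abs_nonneg _

lemma l1_add_le (x y : Fin d → ℝ) : l1 (x + y) ≤ l1 x + l1 y := by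
  unfold l1
  rw [← Finset.sum_add_distrib]
  exact Finset.sum_le_sum fun i _ => abs_add_le _ _

lemma l1_sub_le (x y : Fin d → ℝ) : l1 (x - y) ≤ l1 x + l1 y := by
  unfold l1
  rw [← Finset.sum_add_distrib]
  exact Finset.sum_le_sum fun i _ => abs_sub _ _

lemma abs_dotProduct_le_l1_mul {x y : Fin d → ℝ} {c : ℝ} (hy : ∀ i, |y i| ≤ c) :
    |x ⬝ᵥ y| ≤ l1 x * c := by
  unfold l1 dotProduct
  rw [Finset.sum_mul]
  refine (Finset.abs_sum_le_sum_abs _ _).trans (Finset.sum_le_sum fun i _ => ?_)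
  rw [abs_mul]
  exact mul_le_mul_of_nonneg_left (hy i) (abs_nonneg _)

lemma abs_mulVec_le {B : Matrix (Fin d) (Fin d) ℝ} {c : ℝ} (hB : ∀ i j, |B i j| ≤ c)
    (x : Fin d → ℝ) (i : Fin d) : |(B *ᵥ x) i| ≤ c * l1 x := by
  rw [Matrix.mulVec, dotProduct_comm, mul_comm]
  exact abs_dotProduct_le_l1_mul (hB i)

lemma abs_bilin_le {B : Matrix (Fin d) (Fin d) ℝ} {c : ℝ} (hB : ∀ i j, |B i j| ≤ c)
    (x y : Fin d → ℝ) : |x ⬝ᵥ B *ᵥ y| ≤ l1 x * (c * l1 y) :=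
  abs_dotProduct_le_l1_mul (abs_mulVec_le hB y)

lemma l1_le_card_mul {x : Fin d → ℝ} {c : ℝ} (hx : ∀ i, |x i| ≤ c) : l1 x ≤ d * c := by
  refine (Finset.sum_le_card_nsmul _ _ c fun i _ => hx i).trans_eq ?_
  simp

/-- The cone condition for a point whose `ℓ¹` norm does not exceed that of a sparse vector. -/
lemma l1_sub_le_of_l1_le {x y : Fin d → ℝ} {s : ℕ} {c : ℝ} (hs : l0 y ≤ s) (h : l1 x ≤ l1 y)
    (hc : 0 ≤ c) (hxy : ∀ i, |(x - y) i| ≤ c) : l1 (x - y) ≤ 2 * s * c := by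
  -- Off the support of `y` this is an equality; on it, |y i| - |x i| ≤ c costs 2c. Summing, the
  -- minimality of `x` discards the first two terms.
  have h1 : ∀ i, |(x - y) i| ≤ |x i| - |y i| + if y i ≠ 0 then 2 * c else 0 := by
    intro i
    have := hxy i
    simp only [Pi.sub_apply] at this ⊢
    split_ifs with hi
    · have := abs_sub_abs_le_abs_sub (y i) (x i)
      rw [abs_sub_comm] at this
      linarith
    · rw [not_not] at hi
      simp [hi]
  calc l1 (x - y) ≤ ∑ i, (|x i| - |y i| + if y i ≠ 0 then 2 * c else 0) :=
        Finset.sum_le_sum fun i _ => h1 i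
    _ = l1 x - l1 y + l0 y * (2 * c) := by
        rw [Finset.sum_add_distrib, Finset.sum_sub_distrib, ← Finset.sum_filter]
        simp [l1, l0]
    _ ≤ s * (2 * c) := by
        have : (l0 y : ℝ) ≤ s := by exact_mod_cast hs
        nlinarith
    _ = 2 * s * c := by ring

variable {S Sig : Matrix (Fin d) (Fin d) ℝ} {M δ : ℝ}

lemma abs_le_of_abs_mulVec_le (hdet : IsUnit Sig.det) (hrow : ∀ i, l1 (Sig⁻¹ i) ≤ M)
    {x : Fin d → ℝ} {c : ℝ} (h : ∀ i, |(Sig *ᵥ x) i| ≤ c) (i : Fin d) : |x i| ≤ M * c := by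
  have hx : x = Sig⁻¹ *ᵥ (Sig *ᵥ x) := by
    rw [Matrix.mulVec_mulVec, Matrix.nonsing_inv_mul _ hdet, Matrix.one_mulVec]
  have hc : 0 ≤ c := (abs_nonneg _).trans (h i)
  calc |x i| = |Sig⁻¹ i ⬝ᵥ (Sig *ᵥ x)| := congrArg abs (congrFun hx i)
    _ ≤ l1 (Sig⁻¹ i) * c := abs_dotProduct_le_l1_mul h
    _ ≤ M * c := mul_le_mul_of_nonneg_right (hrow i) hc

lemma abs_le_of_abs_perturbed_mulVec_le (hdet : IsUnit Sig.det)
    (hrow : ∀ i, l1 (Sig⁻¹ i) ≤ M) (hδ : ∀ i j, |S i j - Sig i j| ≤ δ)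
    {x : Fin d → ℝ} {c : ℝ} (h : ∀ i, |(S *ᵥ x) i| ≤ c) (i : Fin d) :
    |x i| ≤ M * (c + δ * l1 x) := by
  refine abs_le_of_abs_mulVec_le hdet hrow (fun j => ?_) i
  have h1 : Sig *ᵥ x = S *ᵥ x - (S - Sig) *ᵥ x := by rw [Matrix.sub_mulVec]; abel
  rw [h1, Pi.sub_apply]
  exact (abs_sub _ _).trans (add_le_add (h j) (abs_mulVec_le (B := S - Sig) hδ x j))

lemma abs_mulVec_sub_le {b x y : Fin d → ℝ} {c c' : ℝ} (hx : ∀ i, |(S *ᵥ x - b) i| ≤ c)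
    (hy : ∀ i, |(S *ᵥ y - b) i| ≤ c') (i : Fin d) : |(S *ᵥ (x - y)) i| ≤ c + c' := by
  have : S *ᵥ (x - y) = (S *ᵥ x - b) - (S *ᵥ y - b) := by rw [Matrix.mulVec_sub]; abel
  rw [this, Pi.sub_apply]
  exact (abs_sub _ _).trans (add_le_add (hx i) (hy i))

/-- Minimality gives ‖x - y‖₁ ≤ 2M at once, which makes the perturbation of `Sig` harmless and
yields a sup-norm bound through the inverse. The cone condition turns it into an ℓ¹ bound at the
price of 2s; no restricted eigenvalue condition enters. -/
lemma dantzig_sparse (hdet : IsUnit Sig.det) (hrow : ∀ i, l1 (Sig⁻¹ i) ≤ M)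
    (hM : 0 ≤ M) (hδ0 : 0 ≤ δ) (hδ : ∀ i j, |S i j - Sig i j| ≤ δ) {b x y : Fin d → ℝ} {c : ℝ}
    {s : ℕ} (hc : 0 ≤ c)
    (hx : IsL1Argmin {z | ∀ i, |(S *ᵥ z - b) i| ≤ c} x) (hy : ∀ i, |(S *ᵥ y - b) i| ≤ c)
    (hys : l0 y ≤ s) (hyM : l1 y ≤ M) :
    l1 (x - y) ≤ 2 * s * (M * (2 * c + 2 * M * δ)) := by
  have hxy : l1 x ≤ l1 y := hx.2 y hy
  refine l1_sub_le_of_l1_le hys hxy (by positivity) fun i => ?_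
  refine (abs_le_of_abs_perturbed_mulVec_le hdet hrow hδ (abs_mulVec_sub_le hx.1 hy) i).trans ?_
  have h1 : l1 (x - y) ≤ 2 * M := (l1_sub_le x y).trans (by linarith)
  have h2 := mul_le_mul_of_nonneg_left h1 hδ0
  exact mul_le_mul_of_nonneg_left (by linarith) hM

/-- A kernel vector `x` of `S` satisfies ‖x‖₁ ≤ Mδd ‖x‖₁ ≤ ‖x‖₁ / 2, so it vanishes; injective
square matrices are onto. -/
lemma exists_mulVec_eq_of_close (hdet : IsUnit Sig.det) (hrow : ∀ i, l1 (Sig⁻¹ i) ≤ M)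
    (hδ : ∀ i j, |S i j - Sig i j| ≤ δ) (hsmall : M * δ * d ≤ 1 / 2) (b : Fin d → ℝ) :
    ∃ x, S *ᵥ x = b := by
  have hinj : Function.Injective S.mulVecLin := by
    rw [← LinearMap.ker_eq_bot, LinearMap.ker_eq_bot']
    intro x hx
    have hx0 : S *ᵥ x = 0 := hx
    have h1 := abs_le_of_abs_perturbed_mulVec_le (x := x) (c := 0) hdet hrow hδ
      (fun i => by simp [hx0])
    have h2 := l1_le_card_mul h1
    have h3 := l1_nonneg x
    have h4 : l1 x = 0 := by
      have : d * (M * (0 + δ * l1 x)) = M * δ * d * l1 x := by ring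
      nlinarith
    funext i
    have := h1 i
    rw [h4] at this
    simpa using this
  have hsurj := LinearMap.injective_iff_surjective.1 hinj
  exact hsurj b

/-- Neither sparsity nor minimality is used, and the two tolerances may differ. This serves when the
truth violates the constraint of the program. -/
lemma dantzig_low_dim (hdet : IsUnit Sig.det) (hrow : ∀ i, l1 (Sig⁻¹ i) ≤ M)
    (hδ : ∀ i j, |S i j - Sig i j| ≤ δ)
    (hsmall : M * δ * d ≤ 1 / 2) {b x y : Fin d → ℝ} {c c' : ℝ}
    (hx : ∀ i, |(S *ᵥ x - b) i| ≤ c) (hy : ∀ i, |(S *ᵥ y - b) i| ≤ c') :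
    l1 (x - y) ≤ 2 * d * (M * (c + c')) := by
  have h1 := l1_le_card_mul
    (abs_le_of_abs_perturbed_mulVec_le hdet hrow hδ (abs_mulVec_sub_le hx hy))
  have h3 := l1_nonneg (x - y)
  have : d * (M * (c + c' + δ * l1 (x - y))) =
    d * (M * (c + c')) + M * δ * d * l1 (x - y) := by ring
  nlinarith

/-- Stability of quadratic forms. -/
lemma abs_quad_sub_quad_le (hδ : ∀ i j, |S i j - Sig i j| ≤ δ) (hSig : ∀ i j, |Sig i j| ≤ M)
    (x y : Fin d → ℝ) :
    |x ⬝ᵥ S *ᵥ x - y ⬝ᵥ Sig *ᵥ y| ≤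
      l1 x * (δ * l1 x) + (l1 (x - y) * (M * l1 x) + l1 y * (M * l1 (x - y))) := by
  have : x ⬝ᵥ S *ᵥ x - y ⬝ᵥ Sig *ᵥ y = x ⬝ᵥ (S - Sig) *ᵥ x +
      ((x - y) ⬝ᵥ Sig *ᵥ x + y ⬝ᵥ Sig *ᵥ (x - y)) := by
    simp only [Matrix.sub_mulVec, Matrix.mulVec_sub, dotProduct_sub, sub_dotProduct]
    ring
  rw [this]
  refine (abs_add_le _ _).trans (add_le_add (abs_bilin_le hδ x x) ((abs_add_le _ _).trans
    (add_le_add (abs_bilin_le hSig _ _) (abs_bilin_le hSig _ _))))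

end VARInference
-- Deterministic expansion of the estimating equation.
namespace VARInference

variable {d : ℕ} {T : ℕ} {x : ℤ → EuclideanSpace ℝ (Fin d)}

lemma S0_comm (T : ℕ) (x : ℤ → EuclideanSpace ℝ (Fin d)) (i j : Fin d) :
    S0 T x i j = S0 T x j i := by
  simp only [S0, mul_comm]

lemma vecMul_S0 (T : ℕ) (x : ℤ → EuclideanSpace ℝ (Fin d)) (v : Fin d → ℝ) :
    v ᵥ* S0 T x = S0 T x *ᵥ v := by
  have : (S0 T x)ᵀ = S0 T x := by
    ext i j
    exact S0_comm T x j i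
  conv_lhs => rw [← this]
  exact Matrix.vecMul_transpose _ _

lemma feasibleV_eq (T : ℕ) (x : ℤ → EuclideanSpace ℝ (Fin d)) (k : Fin d) (c : ℝ) :
    feasibleV T x k c =
    {v | ∀ i, |(S0 T x *ᵥ v - (Pi.single k 1 : Fin d → ℝ)) i| ≤ c} := by
  simp only [feasibleV, vecMul_S0, Pi.sub_apply]

lemma innov_single (A : Matrix (Fin d) (Fin d) ℝ) (m : Fin d)
    (x : ℤ → EuclideanSpace ℝ (Fin d)) (t : ℤ) :
    innov A (Pi.single m 1) x t = x (t + 1) m - A.col m ⬝ᵥ (x t).ofLp := by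
  simp [innov]

/-- `S0` averages T terms and `S1` only T - 1. The mismatch leaves the last observation and one copy
of `S0` times the column, both divided by T - 1. -/
lemma estEq_col (hT : 2 ≤ T) (A : Matrix (Fin d) (Fin d) ℝ) (m i : Fin d) :
    estEq T x m (A.col m) i =
      (x T i * (A.col m ⬝ᵥ (x T).ofLp) - (S0 T x *ᵥ A.col m) i - scoreNoise T A m x i) /
        ((T : ℝ) - 1) := by
  obtain ⟨n, rfl⟩ : ∃ n, T = n + 1 := ⟨T - 1, by omega⟩
  have hn : (0 : ℝ) < n := by exact_mod_cast (by omega : 0 < n)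
  have hsplit : ∀ f : ℕ → ℝ, ∑ t ∈ Finset.Icc 1 (n + 1), f t =
      ∑ t ∈ Finset.Icc 1 n, f t + f (n + 1) := by
    intro f
    rw [← Finset.insert_Icc_right_eq_Icc_add_one (by omega), Finset.sum_insert (by simp), add_comm]
  have h0 : (S0 (n + 1) x *ᵥ A.col m) i = ((n : ℝ) + 1)⁻¹ *
      ∑ t ∈ Finset.Icc 1 (n + 1), x (t : ℕ) i * (A.col m ⬝ᵥ (x (t : ℕ)).ofLp) := by
    simp only [Matrix.mulVec, dotProduct, S0, Finset.mul_sum, Finset.sum_mul]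
    rw [Finset.sum_comm]
    push_cast
    refine Finset.sum_congr rfl fun t _ => Finset.sum_congr rfl fun j _ => by ring
  have h1 : ∑ t ∈ Finset.Icc 1 (n + 1), x (t : ℕ) i * (A.col m ⬝ᵥ (x (t : ℕ)).ofLp) =
      ((n : ℝ) + 1) * (S0 (n + 1) x *ᵥ A.col m) i := by
    rw [h0]; field_simp
  rw [hsplit] at h1
  simp only [estEq, Pi.sub_apply, S1, scoreNoise, innov_single, Nat.add_sub_cancel, mul_sub,
    Finset.sum_sub_distrib]
  push_cast at h1 ⊢
  rw [add_sub_cancel_right, eq_div_iff hn.ne', sub_mul, mul_comm ((n : ℝ)⁻¹), mul_assoc,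
    inv_mul_cancel₀ hn.ne', mul_one]
  linarith

lemma projEq_update (T : ℕ) (x : ℤ → EuclideanSpace ℝ (Fin d)) (k m : Fin d)
    (β v : Fin d → ℝ) (θ θ₀ : ℝ) :
    projEq T x k m β v θ = projEq T x k m β v θ₀ + (θ - θ₀) * (S0 T x *ᵥ v) k := by
  have h : Function.update β k θ = Function.update β k θ₀ + Pi.single k (θ - θ₀) := by
    funext i
    by_cases hi : i = k
    · subst hi; simp
    · simp [hi]
  have h2 : v ⬝ᵥ S0 T x *ᵥ Pi.single k (θ - θ₀) = (θ - θ₀) * (S0 T x *ᵥ v) k := by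
    rw [Matrix.dotProduct_mulVec, vecMul_S0, dotProduct_single, mul_comm]
  rw [projEq, projEq, estEq, estEq, h, Matrix.mulVec_add, add_sub_right_comm, dotProduct_add, h2]

/-- Bounds on the population quantities. -/
structure PopulationBounds (M : ℝ) (A Sig0 : Matrix (Fin d) (Fin d) ℝ) (k m : Fin d)
    (s : ℕ) : Prop where
  M_nonneg : 0 ≤ M
  det : IsUnit Sig0.det
  row : ∀ i, l1 (Sig0⁻¹ i) ≤ M
  entry : ∀ i j, |Sig0 i j| ≤ M
  l1_col : l1 (A.col m) ≤ M
  l0_col : l0 (A.col m) ≤ s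
  l0_row : l0 (Sig0⁻¹ k) ≤ s
  one_le : 1 ≤ s
  mulVec_row : Sig0 *ᵥ Sig0⁻¹ k = Pi.single k 1

/-- The estimation errors of both programs are at most `r`. -/
structure EstimationBounds (T : ℕ) (x : ℤ → EuclideanSpace ℝ (Fin d))
    (A Sig0 : Matrix (Fin d) (Fin d) ℝ) (k m : Fin d) (lam r : ℝ) (β v : Fin d → ℝ) :
    Prop where
  feasible_beta : (feasibleBeta T x m lam).Nonempty
  feasible_v : (feasibleV T x k lam).Nonempty
  beta : l1 (β - A.col m) ≤ r
  v : l1 (v - Sig0⁻¹ k) ≤ r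

/-- The lower-order remainder of the estimating equation at the truth. -/
noncomputable def boundary (d T : ℕ) (M a : ℝ) : ℝ :=
  (a * M * Real.log d + 2 * M ^ 2) / ((T : ℝ) - 1)

variable {A Sig0 : Matrix (Fin d) (Fin d) ℝ} {k m : Fin d} {M a lam r : ℝ} {s : ℕ}
  {β v : Fin d → ℝ}

lemma GoodPath.abs_S0_mulVec_le (hg : GoodPath T A Sig0 m a x)
    (hp : PopulationBounds M A Sig0 k m s) (haρ : a * rate d T ≤ M) (y : Fin d → ℝ) (i : Fin d) :
    |(S0 T x *ᵥ y) i| ≤ 2 * M * l1 y := by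
  refine abs_mulVec_le (fun i j => ?_) y i
  have h1 := hg.cov i j
  have h2 := hp.entry i j
  rw [abs_le] at *
  constructor <;> linarith

lemma GoodPath.abs_boundary_le (hT : 2 ≤ T) (hg : GoodPath T A Sig0 m a x)
    (hp : PopulationBounds M A Sig0 k m s) (haρ : a * rate d T ≤ M) (ha : 0 ≤ a) (i : Fin d) :
    |(x T i * (A.col m ⬝ᵥ (x T).ofLp) - (S0 T x *ᵥ A.col m) i) / ((T : ℝ) - 1)| ≤
      boundary d T M a := by
  have hT' : (0 : ℝ) < (T : ℝ) - 1 := by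
    have : (2 : ℝ) ≤ T := by exact_mod_cast hT
    linarith
  have hM := hp.M_nonneg
  have hL : 0 ≤ Real.log d := Real.log_natCast_nonneg d
  have haL : 0 ≤ a * Real.log d := by positivity
  have h1 : ∀ i, |x T i| ≤ √(a * Real.log d) := fun i => Real.abs_le_sqrt (hg.last i)
  have h2 := abs_dotProduct_le_l1_mul (x := A.col m) h1
  have h3 := (hg.abs_S0_mulVec_le hp haρ (A.col m) i)
  rw [boundary, abs_div, abs_of_pos hT']
  refine div_le_div_of_nonneg_right ?_ hT'.le
  refine (abs_sub _ _).trans (add_le_add ?_ ?_)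
  · rw [abs_mul]
    calc |x T i| * |A.col m ⬝ᵥ (x T).ofLp| ≤
        √(a * Real.log d) * (M * √(a * Real.log d)) := by
          refine mul_le_mul (h1 i) (h2.trans ?_) (abs_nonneg _) (Real.sqrt_nonneg _)
          exact mul_le_mul_of_nonneg_right hp.l1_col (Real.sqrt_nonneg _)
      _ = a * M * Real.log d := by
          have := Real.mul_self_sqrt haL
          linear_combination M * this
  · refine h3.trans ?_
    have := mul_le_mul_of_nonneg_left hp.l1_col (by positivity : 0 ≤ 2 * M)
    linarith

lemma GoodPath.abs_estEq_le (hT : 2 ≤ T) (hg : GoodPath T A Sig0 m a x)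
    (hp : PopulationBounds M A Sig0 k m s) (haρ : a * rate d T ≤ M) (ha : 0 ≤ a)
    (hb : boundary d T M a ≤ rate d T) (i : Fin d) :
    |estEq T x m (A.col m) i| ≤ (2 * a + 1) * rate d T := by
  have hT2 : (2 : ℝ) ≤ T := by exact_mod_cast hT
  have hT' : (0 : ℝ) < (T : ℝ) - 1 := by linarith
  have hρ0 : 0 ≤ rate d T := Real.sqrt_nonneg _
  rw [estEq_col hT, sub_div]
  refine (abs_sub _ _).trans ?_
  have h1 := (hg.abs_boundary_le hT hp haρ ha i).trans hb
  have h2 : |scoreNoise T A m x i / ((T : ℝ) - 1)| ≤ 2 * a * rate d T := by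
    rw [abs_div, abs_of_pos hT', div_le_iff₀ hT']
    refine (hg.noise i).trans ?_
    have : 0 ≤ a * rate d T := by positivity
    nlinarith
  linarith

lemma GoodPath.abs_row_sub_le (hg : GoodPath T A Sig0 m a x)
    (hp : PopulationBounds M A Sig0 k m s) (ha : 0 ≤ a) (i : Fin d) :
    |(S0 T x *ᵥ Sig0⁻¹ k - (Pi.single k 1 : Fin d → ℝ)) i| ≤ a * M * rate d T := by
  have hρ0 : 0 ≤ rate d T := Real.sqrt_nonneg _
  rw [← hp.mulVec_row, ← Matrix.sub_mulVec]
  refine (abs_mulVec_le (B := S0 T x - Sig0) hg.cov _ i).trans ?_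
  have := mul_le_mul_of_nonneg_left (hp.row k) (by positivity : 0 ≤ a * rate d T)
  linarith

/-- The lower bound on `K` is what makes both true vectors feasible: 2a + 1 for the column of `A`,
aM for the row of `Sig0⁻¹`. -/
theorem GoodPath.estimationBounds_sparse (hT : 2 ≤ T) (hg : GoodPath T A Sig0 m a x)
    (hp : PopulationBounds M A Sig0 k m s) (haρ : a * rate d T ≤ M) (ha : 0 ≤ a)
    (hb : boundary d T M a ≤ rate d T) {K θ : ℝ} (hK : 2 * a + 1 + a * M ≤ K)
    (hz : IsZEstimate T x k m (K * rate d T) (K * rate d T) β v θ) :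
    EstimationBounds T x A Sig0 k m (K * rate d T)
      (4 * M * (K + M * a) * (s * rate d T)) β v := by
  have hρ0 : 0 ≤ rate d T := Real.sqrt_nonneg _
  have hM := hp.M_nonneg
  have haM : 0 ≤ a * M := by positivity
  have hK0 : 0 ≤ K := by linarith
  have f1 : ∀ i, |(S0 T x *ᵥ A.col m - fun i => S1 T x i m) i| ≤ K * rate d T := fun i =>
    (hg.abs_estEq_le hT hp haρ ha hb i).trans (mul_le_mul_of_nonneg_right (by linarith) hρ0)
  have f2 : ∀ i, |(S0 T x *ᵥ Sig0⁻¹ k - (Pi.single k 1 : Fin d → ℝ)) i| ≤ K * rate d T := fun i =>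
    (hg.abs_row_sub_le hp ha i).trans (mul_le_mul_of_nonneg_right (by linarith) hρ0)
  have n1 : (feasibleBeta T x m (K * rate d T)).Nonempty := ⟨_, f1⟩
  have n2 : (feasibleV T x k (K * rate d T)).Nonempty := ⟨Sig0⁻¹ k, by rw [feasibleV_eq]; exact f2⟩
  have a2 := hz.argmin_v n2
  rw [feasibleV_eq] at a2
  refine ⟨n1, n2, ?_, ?_⟩
  · refine (dantzig_sparse hp.det hp.row hM (by positivity) hg.cov (by positivity)
      (hz.argmin_beta n1) f1 hp.l0_col hp.l1_col).trans_eq (by ring)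
  · refine (dantzig_sparse hp.det hp.row hM (by positivity) hg.cov (by positivity)
      a2 f2 hp.l0_row (hp.row k)).trans_eq (by ring)

/-- No relation between `K` and `a` is required: feasibility comes from solving the equations
exactly. The bound is padded with the factor s ≥ 1 so that both regimes give an error of the form
constant times sρ. -/
theorem GoodPath.estimationBounds_low_dim (hT : 2 ≤ T) (hg : GoodPath T A Sig0 m a x)
    (hp : PopulationBounds M A Sig0 k m s) (haρ : a * rate d T ≤ M) (ha : 0 ≤ a)
    (hb : boundary d T M a ≤ rate d T) {K θ : ℝ} (hK : 0 ≤ K) {D : ℕ} (hD : d ≤ D)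
    (hsmall : M * (a * rate d T) * d ≤ 1 / 2)
    (hz : IsZEstimate T x k m (K * rate d T) (K * rate d T) β v θ) :
    EstimationBounds T x A Sig0 k m (K * rate d T)
      (2 * D * M * (K + 2 * a + 1 + a * M) * (s * rate d T)) β v := by
  have hρ0 : 0 ≤ rate d T := Real.sqrt_nonneg _
  have hM := hp.M_nonneg
  have haM : 0 ≤ a * M := by positivity
  have hs : (1 : ℝ) ≤ s := by exact_mod_cast hp.one_le
  have hD' : (d : ℝ) ≤ D := by exact_mod_cast hD
  have f1 : ∀ i, |(S0 T x *ᵥ A.col m - fun i => S1 T x i m) i| ≤ (2 * a + 1) * rate d T :=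
    hg.abs_estEq_le hT hp haρ ha hb
  have f2 := hg.abs_row_sub_le hp ha
  have n1 : (feasibleBeta T x m (K * rate d T)).Nonempty := by
    obtain ⟨z, hz⟩ := exists_mulVec_eq_of_close hp.det hp.row hg.cov hsmall fun i => S1 T x i m
    refine ⟨z, fun i => ?_⟩
    rw [estEq, hz]
    simpa using by positivity
  have n2 : (feasibleV T x k (K * rate d T)).Nonempty := by
    obtain ⟨z, hz⟩ := exists_mulVec_eq_of_close hp.det hp.row hg.cov hsmall (Pi.single k 1)
    rw [feasibleV_eq]
    refine ⟨z, fun i => ?_⟩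
    rw [hz]
    simpa using by positivity
  have a2 := hz.argmin_v n2
  rw [feasibleV_eq] at a2
  have hfin : ∀ c, 0 ≤ c → c ≤ 2 * a + 1 + a * M →
      2 * (d : ℝ) * (M * (K * rate d T + c * rate d T)) ≤
        2 * D * M * (K + 2 * a + 1 + a * M) * (s * rate d T) := by
    intro c hc0 hc
    calc 2 * (d : ℝ) * (M * (K * rate d T + c * rate d T))
        = 2 * d * M * (K + c) * (1 * rate d T) := by ring
      _ ≤ 2 * D * M * (K + (2 * a + 1 + a * M)) * (s * rate d T) := by gcongr
      _ = _ := by ring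
  refine ⟨n1, n2, ?_, ?_⟩
  · exact (dantzig_low_dim hp.det hp.row hg.cov hsmall (hz.argmin_beta n1).1 f1).trans
      (hfin _ (by positivity) (by linarith))
  · exact (dantzig_low_dim hp.det hp.row hg.cov hsmall a2.1 f2).trans
      (hfin _ (by positivity) (by linarith))

/-- First-order expansion of the projected estimating equation. -/
theorem EstimationBounds.expansion (hT : 2 ≤ T) (hg : GoodPath T A Sig0 m a x)
    (hp : PopulationBounds M A Sig0 k m s) (haρ : a * rate d T ≤ M) (ha : 0 ≤ a)
    (hb : boundary d T M a ≤ rate d T) {K θ : ℝ} (hK0 : 0 ≤ K)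
    (hz : IsZEstimate T x k m (K * rate d T) (K * rate d T) β v θ)
    (he : EstimationBounds T x A Sig0 k m (K * rate d T) r β v) :
    |(S0 T x *ᵥ v) k - 1| ≤ K * rate d T ∧
      ((S0 T x *ᵥ v) k ≠ 0 →
        (∃! τ, projEq T x k m β v τ = 0) ∧
        |(S0 T x *ᵥ v) k * (θ - A k m) -
          Sig0⁻¹ k ⬝ᵥ scoreNoise T A m x / ((T : ℝ) - 1)| ≤
          (K + 2 * a + 1) * (rate d T * r) + M * boundary d T M a) := by
  have hρ0 : 0 ≤ rate d T := Real.sqrt_nonneg _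
  have a1 := hz.argmin_beta he.feasible_beta
  have a2 := hz.argmin_v he.feasible_v
  rw [feasibleV_eq] at a2
  have hslope : |(S0 T x *ᵥ v) k - 1| ≤ K * rate d T := by simpa using a2.1 k
  refine ⟨hslope, fun hne => ?_⟩
  have hlin := projEq_update T x k m β v
  set sl := (S0 T x *ᵥ v) k with hsl
  have huniq : ∃! τ, projEq T x k m β v τ = 0 := by
    refine ⟨A k m - projEq T x k m β v (A k m) / sl, ?_, fun τ hτ => ?_⟩
    · simp only
      rw [hlin _ (A k m)]
      field_simp
      ring
    · simp only at hτ
      rw [hlin _ (A k m)] at hτ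
      field_simp
      linarith
  refine ⟨huniq, ?_⟩
  have hroot : projEq T x k m β v θ = 0 := hz.root huniq.exists
  rw [hlin _ (A k m)] at hroot
  -- With the `k`-th entry set to its true value, the error vanishes at `k`. One may therefore
  -- subtract `Pi.single k 1` from `S0 v` for free, which pairs the error with the small residual of
  -- the second program.
  set y := Function.update β k (A k m) - A.col m with hy
  have hyk : y k = 0 := by simp [hy]
  have hyl : l1 y ≤ r := by
    refine le_trans (Finset.sum_le_sum fun i _ => ?_) he.beta
    by_cases hi : i = k
    · subst hi; rw [hyk]; simp
    · simp [hy, hi]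
  have hdec : projEq T x k m β v (A k m) = Sig0⁻¹ k ⬝ᵥ estEq T x m (A.col m) +
      (v - Sig0⁻¹ k) ⬝ᵥ estEq T x m (A.col m) + y ⬝ᵥ (S0 T x *ᵥ v - (Pi.single k 1 : Fin d → ℝ)) := by
    have h1 : y ⬝ᵥ (S0 T x *ᵥ v - (Pi.single k 1 : Fin d → ℝ)) = v ⬝ᵥ S0 T x *ᵥ y := by
      rw [dotProduct_sub, dotProduct_single, hyk, zero_mul, sub_zero, Matrix.dotProduct_mulVec,
        vecMul_S0, dotProduct_comm]
    rw [h1, hy, projEq]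
    simp only [estEq, Matrix.mulVec_sub, dotProduct_sub, sub_dotProduct]
    ring
  have b1 := abs_dotProduct_le_l1_mul (x := v - Sig0⁻¹ k) (hg.abs_estEq_le hT hp haρ ha hb)
  have b2 := abs_dotProduct_le_l1_mul (x := y) (y := S0 T x *ᵥ v - (Pi.single k 1 : Fin d → ℝ)) a2.1
  have b3 := abs_dotProduct_le_l1_mul (x := Sig0⁻¹ k) (hg.abs_boundary_le hT hp haρ ha)
  have hbd : 0 ≤ boundary d T M a := (abs_nonneg _).trans (hg.abs_boundary_le hT hp haρ ha k)
  have hest : estEq T x m (A.col m) = (fun i =>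
      (x T i * (A.col m ⬝ᵥ (x T).ofLp) - (S0 T x *ᵥ A.col m) i) / ((T : ℝ) - 1)) -
      ((T : ℝ) - 1)⁻¹ • scoreNoise T A m x := by
    funext i
    rw [estEq_col hT, Pi.sub_apply, Pi.smul_apply, smul_eq_mul, sub_div, inv_mul_eq_div]
  have hmain : sl * (θ - A k m) - Sig0⁻¹ k ⬝ᵥ scoreNoise T A m x / ((T : ℝ) - 1) =
      -(Sig0⁻¹ k ⬝ᵥ (fun i =>
        (x T i * (A.col m ⬝ᵥ (x T).ofLp) - (S0 T x *ᵥ A.col m) i) / ((T : ℝ) - 1))) -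
      ((v - Sig0⁻¹ k) ⬝ᵥ estEq T x m (A.col m)) - y ⬝ᵥ (S0 T x *ᵥ v - (Pi.single k 1 : Fin d → ℝ)) := by
    have h2 : Sig0⁻¹ k ⬝ᵥ estEq T x m (A.col m) = Sig0⁻¹ k ⬝ᵥ (fun i =>
        (x T i * (A.col m ⬝ᵥ (x T).ofLp) - (S0 T x *ᵥ A.col m) i) / ((T : ℝ) - 1)) -
        Sig0⁻¹ k ⬝ᵥ scoreNoise T A m x / ((T : ℝ) - 1) := by
      rw [hest, dotProduct_sub, dotProduct_smul, smul_eq_mul, inv_mul_eq_div]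
    rw [hdec, h2] at hroot
    linarith
  rw [hmain]
  have b1' : |(v - Sig0⁻¹ k) ⬝ᵥ estEq T x m (A.col m)| ≤ (2 * a + 1) * (rate d T * r) := by
    refine b1.trans ?_
    have := mul_le_mul_of_nonneg_right he.v (by positivity : 0 ≤ (2 * a + 1) * rate d T)
    linarith
  have b2' : |y ⬝ᵥ (S0 T x *ᵥ v - (Pi.single k 1 : Fin d → ℝ))| ≤ K * (rate d T * r) := by
    refine b2.trans ?_
    have := mul_le_mul_of_nonneg_right hyl (by positivity : 0 ≤ K * rate d T)
    linarith
  have b3' := b3.trans (mul_le_mul_of_nonneg_right (hp.row k) hbd)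
  rw [abs_le] at *
  constructor <;> linarith

end VARInference
-- Studentisation on good paths.
namespace VARInference

/-- A quantitative form of Slutsky's argument for a studentized statistic. -/
lemma exists_slutsky_tolerance {B η Δ₀ : ℝ} (hB : 0 ≤ B) (hη : 0 < η) (hΔ₀ : 0 < Δ₀) :
    ∃ τ > 0, ∀ q sl w Δ e N : ℝ, Δ₀ ≤ Δ → |q - 1| ≤ τ → |sl - 1| ≤ τ → |w - Δ| ≤ τ →
      |e| ≤ τ → |N| ≤ B →
      0 < w ∧ sl ≠ 0 ∧ |(N * q * √Δ + e) / (sl * √w) - N| ≤ η := by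
  -- In the application the arguments stand for T/(T-1), the slope, and the ratio of estimated to
  -- true variance, all close to 1.
  have hcont : ContinuousAt (fun p : ℝ × ℝ × ℝ => p.1 / (p.2.1 * √p.2.2)) (1, 1, 1) := by
    refine ContinuousAt.div continuousAt_fst (by fun_prop) (by simp)
  set η' := min 1 (η / (2 * (B + 1))) with hη'
  have hη'0 : 0 < η' := lt_min one_pos (by positivity)
  obtain ⟨δ, hδ, hf⟩ := Metric.continuousAt_iff.1 hcont η' hη'0
  have hf' : ∀ q sl w : ℝ, |q - 1| < δ → |sl - 1| < δ → |w - 1| < δ →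
      |q / (sl * √w) - 1| < η' := by
    intro q sl w h1 h2 h3
    have := hf (x := (q, sl, w)) (by
      simp only [Prod.dist_eq, Real.dist_eq]
      exact max_lt h1 (max_lt h2 h3))
    simpa [Real.dist_eq] using this
  have hsΔ₀ : 0 < √Δ₀ := Real.sqrt_pos.2 hΔ₀
  -- The δ-terms put `q`, `sl` and `w / Δ` in the continuity ball, Δ₀/2 and 1/2 keep `w` and `sl`
  -- positive, and η√Δ₀/4 handles the remainder `e`.
  refine ⟨min (min (δ / 2) (Δ₀ * δ / 2)) (min (min (Δ₀ / 2) (1 / 2)) (η * √Δ₀ / 4)),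
    by positivity, ?_⟩
  intro q sl w Δ e N hΔ hq hsl hw he hN
  simp only [le_min_iff] at hq hsl hw he
  have hΔpos : 0 < Δ := hΔ₀.trans_le hΔ
  have hwpos : 0 < w := by
    have := (abs_le.1 hw.2.1.1).1
    linarith
  have hslpos : 0 < sl := by
    have := (abs_le.1 hsl.2.1.2).1
    linarith
  refine ⟨hwpos, hslpos.ne', ?_⟩
  set z := w / Δ with hz
  have hz1 : |z - 1| < δ := by
    have : z - 1 = (w - Δ) / Δ := by rw [hz]; field_simp
    rw [this, abs_div, abs_of_pos hΔpos, div_lt_iff₀ hΔpos]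
    have h1 := hw.1.2
    have h2 := mul_le_mul_of_nonneg_right hΔ hδ.le
    have h3 : 0 < Δ * δ := by positivity
    linarith
  have f1 := hf' q sl z (by linarith [hq.1.1]) (by linarith [hsl.1.1]) hz1
  have f2 := hf' 1 sl z (by simpa using hδ) (by linarith [hsl.1.1]) hz1
  have hsΔ : √Δ₀ ≤ √Δ := Real.sqrt_le_sqrt hΔ
  have hsΔpos : 0 < √Δ := Real.sqrt_pos.2 hΔpos
  have hzpos : 0 < z := div_pos hwpos hΔpos
  have hsz : 0 < √z := Real.sqrt_pos.2 hzpos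
  have hsw : √w = √Δ * √z := by
    rw [← Real.sqrt_mul hΔpos.le, hz, mul_div_cancel₀ _ hΔpos.ne']
  have key : (N * q * √Δ + e) / (sl * √w) - N =
      N * (q / (sl * √z) - 1) + (e / √Δ) * (1 / (sl * √z)) := by
    rw [hsw]
    field_simp
    ring
  rw [key]
  refine (abs_add_le _ _).trans ?_
  have g1 : |N * (q / (sl * √z) - 1)| ≤ η / 2 := by
    rw [abs_mul]
    calc |N| * |q / (sl * √z) - 1| ≤ (B + 1) * (η / (2 * (B + 1))) := by
          refine mul_le_mul (by linarith) (f1.le.trans (min_le_right _ _)) (abs_nonneg _)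
            (by linarith)
      _ = η / 2 := by field_simp
  have g2 : |(e / √Δ) * (1 / (sl * √z))| ≤ η / 2 := by
    rw [abs_mul]
    have h1 : |1 / (sl * √z)| ≤ 2 := by
      have h2 := abs_le.1 (f2.le.trans (min_le_left _ _))
      rw [abs_le]
      constructor <;> linarith
    have h3 : |e / √Δ| ≤ η / 4 := by
      rw [abs_div, abs_of_pos hsΔpos, div_le_iff₀ hsΔpos]
      have h4 := mul_le_mul_of_nonneg_left hsΔ hη.le
      linarith [he.2.2]
    calc |e / √Δ| * |1 / (sl * √z)| ≤ η / 4 * 2 :=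
          mul_le_mul h3 h1 (abs_nonneg _) (by positivity)
      _ = η / 2 := by ring
  linarith

variable {d : ℕ} {T : ℕ} {x : ℤ → EuclideanSpace ℝ (Fin d)}
  {A Sig0 Psi : Matrix (Fin d) (Fin d) ℝ} {k m : Fin d} {M a lam r τ : ℝ} {s : ℕ}
  {β v : Fin d → ℝ}

/-- The asymptotic variance. -/
noncomputable def asympVar (Sig0 Psi : Matrix (Fin d) (Fin d) ℝ) (k m : Fin d) : ℝ :=
  Psi m m * (Sig0⁻¹ k ⬝ᵥ Sig0 *ᵥ Sig0⁻¹ k)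

/-- Bounds on the population variances. -/
structure VarianceBounds (M C : ℝ) (A Sig0 Psi : Matrix (Fin d) (Fin d) ℝ) (k m : Fin d) :
    Prop where
  decomp : Sig0 m m = A.col m ⬝ᵥ Sig0 *ᵥ A.col m + Psi m m
  C_pos : 0 < C
  M_pos : 0 < M
  lower : C ≤ Psi m m
  upper : Psi m m ≤ M
  row_lower : M⁻¹ ≤ Sig0⁻¹ k ⬝ᵥ Sig0 *ᵥ Sig0⁻¹ k

/-- Both factors are stable quadratic forms. The first is compared with `Psi m m` through the
Lyapunov identity `decomp`. -/
theorem GoodPath.abs_DeltaHat_sub_le {C : ℝ} (hg : GoodPath T A Sig0 m a x)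
    (hp : PopulationBounds M A Sig0 k m s) (hv : VarianceBounds M C A Sig0 Psi k m) (ha : 0 ≤ a)
    (he : EstimationBounds T x A Sig0 k m lam r β v) (hτ : τ ≤ 1) (hρ : rate d T ≤ τ)
    (hr : r ≤ τ) :
    |DeltaHat T x m β v - asympVar Sig0 Psi k m| ≤
      (a + ((M + 1) ^ 2 * a + M * (2 * M + 1))) * (M ^ 3 + M +
        (a + ((M + 1) ^ 2 * a + M * (2 * M + 1)))) * τ := by
  have hρ0 : 0 ≤ rate d T := Real.sqrt_nonneg _
  have hM := hp.M_nonneg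
  have hτ0 : 0 ≤ τ := hρ0.trans hρ
  set G : ℝ := (M + 1) ^ 2 * a + M * (2 * M + 1) with hG
  have hG0 : 0 ≤ G := by positivity
  have haρ : a * rate d T ≤ a * τ := mul_le_mul_of_nonneg_left hρ ha
  have quad : ∀ y y₀ : Fin d → ℝ, l1 (y - y₀) ≤ r → l1 y₀ ≤ M →
      |y ⬝ᵥ S0 T x *ᵥ y - y₀ ⬝ᵥ Sig0 *ᵥ y₀| ≤ G * τ := by
    intro y y₀ h1 h2
    refine (abs_quad_sub_quad_le hg.cov hp.entry y y₀).trans ?_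
    have h3 : l1 y ≤ M + 1 := by
      have := l1_add_le (y - y₀) y₀
      rw [sub_add_cancel] at this
      linarith
    have h0 := l1_nonneg y
    have h0' := l1_nonneg y₀
    have h0'' := l1_nonneg (y - y₀)
    have h4 : l1 (y - y₀) ≤ τ := h1.trans hr
    calc _ ≤ (M + 1) * (a * τ * (M + 1)) + (τ * (M * (M + 1)) + M * (M * τ)) := by gcongr
      _ = G * τ := by rw [hG]; ring
  have qβ := quad β (A.col m) he.beta hp.l1_col
  have qv := quad v (Sig0⁻¹ k) he.v (hp.row k)
  have hV : |Sig0⁻¹ k ⬝ᵥ Sig0 *ᵥ Sig0⁻¹ k| ≤ M ^ 3 := by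
    refine (abs_bilin_le hp.entry _ _).trans ?_
    have h1 := hp.row k
    have h2 := l1_nonneg (Sig0⁻¹ k)
    calc l1 (Sig0⁻¹ k) * (M * l1 (Sig0⁻¹ k)) ≤ M * (M * M) := by gcongr
      _ = M ^ 3 := by ring
  set P' := S0 T x m m - β ⬝ᵥ (S0 T x *ᵥ β) with hP'
  set V' := v ⬝ᵥ (S0 T x *ᵥ v) with hV'
  set V := Sig0⁻¹ k ⬝ᵥ Sig0 *ᵥ Sig0⁻¹ k with hVdef
  have hP : |P' - Psi m m| ≤ (a + G) * τ := by
    have h1 := hg.cov m m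
    have h2 := hv.decomp
    have h3 : P' - Psi m m = (S0 T x m m - Sig0 m m) -
      (β ⬝ᵥ S0 T x *ᵥ β - A.col m ⬝ᵥ Sig0 *ᵥ A.col m) := by rw [hP', h2]; ring
    rw [h3]
    refine (abs_sub _ _).trans ?_
    linarith
  have hV'' : |V'| ≤ M ^ 3 + G := by
    have h1 : V' = V + (V' - V) := by ring
    rw [h1]
    refine (abs_add_le _ _).trans (add_le_add hV (qv.trans ?_))
    nlinarith
  have hPsi : |Psi m m| ≤ M := by
    rw [abs_of_nonneg (hv.C_pos.le.trans hv.lower)]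
    exact hv.upper
  have hdec : DeltaHat T x m β v - asympVar Sig0 Psi k m =
      (P' - Psi m m) * V' + Psi m m * (V' - V) := by
    rw [DeltaHat, asympVar]; ring
  rw [hdec]
  refine (abs_add_le _ _).trans ?_
  rw [abs_mul, abs_mul]
  calc |P' - Psi m m| * |V'| + |Psi m m| * |V' - V| ≤
      (a + G) * τ * (M ^ 3 + G) + M * (G * τ) := by gcongr
    _ ≤ (a + G) * τ * (M ^ 3 + (a + G)) + M * ((a + G) * τ) := by
      have : 0 ≤ (a + G) * τ := by positivity
      gcongr <;> linarith
    _ = _ := by ring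

/-- One tolerance serves all dimensions, sample sizes and paths, so that later only finitely many
scalar sequences must become small. -/
theorem exists_deterministic_tolerance {M C a K B η : ℝ} (hM : 0 < M) (hC : 0 < C) (ha : 0 ≤ a)
    (hK : 0 ≤ K) (hB : 0 ≤ B) (hη : 0 < η) :
    ∃ τ > 0, ∀ (d T : ℕ) (x : ℤ → EuclideanSpace ℝ (Fin d))
      (A Sig0 Psi : Matrix (Fin d) (Fin d) ℝ) (k m : Fin d) (s : ℕ) (r : ℝ)
      (β v : Fin d → ℝ) (θ : ℝ),
      2 ≤ T → GoodPath T A Sig0 m a x → PopulationBounds M A Sig0 k m s →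
      VarianceBounds M C A Sig0 Psi k m →
      IsZEstimate T x k m (K * rate d T) (K * rate d T) β v θ →
      EstimationBounds T x A Sig0 k m (K * rate d T) r β v →
      a * rate d T ≤ M → boundary d T M a ≤ rate d T → rate d T ≤ τ → r ≤ τ →
      √T * (rate d T * r) ≤ τ → √T * boundary d T M a ≤ τ → ((T : ℝ) - 1)⁻¹ ≤ τ →
      |Sig0⁻¹ k ⬝ᵥ scoreNoise T A m x / √(T * asympVar Sig0 Psi k m)| ≤ B →
      WellPosed T x k m (K * rate d T) (K * rate d T) β v ∧
      |UHat T x m β v θ (A k m) -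
        Sig0⁻¹ k ⬝ᵥ scoreNoise T A m x / √(T * asympVar Sig0 Psi k m)| ≤ η := by
  obtain ⟨τ₀, hτ₀, hsl⟩ := exists_slutsky_tolerance hB hη (div_pos hC hM)
  set H : ℝ := (a + ((M + 1) ^ 2 * a + M * (2 * M + 1))) * (M ^ 3 + M +
        (a + ((M + 1) ^ 2 * a + M * (2 * M + 1)))) with hH
  have hH0 : 0 ≤ H := by positivity
  set H' : ℝ := 1 + H + K + (K + 2 * a + 1 + M) with hH'
  have hH'0 : 0 < H' := by positivity
  refine ⟨min 1 (τ₀ / H'), by positivity, ?_⟩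
  intro d T x A Sig0 Psi k m s r β v θ hT hg hp hv hz he haρ hb hρ hr h1 h2 h3 hN
  set τ := min 1 (τ₀ / H') with hτ
  have hτ1 : τ ≤ 1 := min_le_left _ _
  have hτH : H' * τ ≤ τ₀ := by
    have : τ ≤ τ₀ / H' := min_le_right _ _
    rwa [le_div_iff₀' hH'0] at this
  have hτ0 : 0 ≤ τ := (Real.sqrt_nonneg _).trans hρ
  have hHτ : ∀ c, c ≤ H' → c * τ ≤ τ₀ := fun c hc =>
    (mul_le_mul_of_nonneg_right hc hτ0).trans hτH
  have hT2 : (2 : ℝ) ≤ T := by exact_mod_cast hT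
  have hT1 : (0 : ℝ) < (T : ℝ) - 1 := by linarith
  have hT0 : (0 : ℝ) < T := by linarith
  have hΔ₀ : C / M ≤ asympVar Sig0 Psi k m := by
    rw [asympVar, div_eq_mul_inv]
    exact mul_le_mul hv.lower hv.row_lower (by positivity) (hC.le.trans hv.lower)
  have hΔ := hg.abs_DeltaHat_sub_le hp hv ha he hτ1 hρ hr
  rw [← hH] at hΔ
  obtain ⟨hslope, hexp⟩ := EstimationBounds.expansion hT hg hp haρ ha hb hK hz he
  have hq : |(T : ℝ) / (T - 1) - 1| ≤ τ₀ := by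
    have : (T : ℝ) / (T - 1) - 1 = ((T : ℝ) - 1)⁻¹ := by field_simp; ring
    rw [this, abs_of_pos (by positivity)]
    have := hHτ 1 (by rw [hH']; linarith)
    linarith
  have hslτ : |(S0 T x *ᵥ v) k - 1| ≤ τ₀ :=
    hslope.trans ((mul_le_mul_of_nonneg_left hρ hK).trans (hHτ K (by rw [hH']; linarith)))
  have hΔτ := hΔ.trans (hHτ H (by rw [hH']; linarith))
  set Δ := asympVar Sig0 Psi k m with hΔdef
  have hΔpos : 0 < Δ := (div_pos hC hM).trans_le hΔ₀
  set n := Sig0⁻¹ k ⬝ᵥ scoreNoise T A m x with hn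
  -- A first use with zero remainder and zero score extracts positivity of Δ̂ and a nonzero slope,
  -- which the expansion needs before its remainder can be estimated.
  obtain ⟨hpos, hne, -⟩ := hsl _ _ _ Δ 0 0 hΔ₀ hq hslτ hΔτ (by simpa using hτ₀.le) (by simpa using hB)
  obtain ⟨huniq, hE⟩ := hexp hne
  refine ⟨⟨he.feasible_beta, he.feasible_v, huniq, hpos⟩, ?_⟩
  set sl := (S0 T x *ᵥ v) k with hsldef
  set E := sl * (θ - A k m) - n / ((T : ℝ) - 1) with hEdef
  have hEτ : |√T * E| ≤ τ₀ := by
    rw [abs_mul, abs_of_nonneg (Real.sqrt_nonneg _)]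
    have g1 := mul_le_mul_of_nonneg_left hE (Real.sqrt_nonneg T)
    have g2 := mul_le_mul_of_nonneg_left h1 (by positivity : 0 ≤ K + 2 * a + 1)
    have g3 := mul_le_mul_of_nonneg_left h2 hM.le
    have g4 := hHτ (K + 2 * a + 1 + M) (by rw [hH']; linarith)
    linarith
  have hfin := (hsl _ _ _ Δ (√T * E) (n / √(T * Δ)) hΔ₀ hq hslτ hΔτ hEτ hN).2.2
  convert! hfin using 3
  rw [UHat, hEdef, Real.sqrt_mul hT0.le]
  have e1 : √(T : ℝ) ≠ 0 := (Real.sqrt_pos.2 hT0).ne'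
  have e2 : √Δ ≠ 0 := (Real.sqrt_pos.2 hΔpos).ne'
  have e3 : √(DeltaHat T x m β v) ≠ 0 := (Real.sqrt_pos.2 hpos).ne'
  have e4 : (T : ℝ) = √T * √T := (Real.mul_self_sqrt hT0.le).symm
  have e5 : n / (√T * √Δ) * (T / (T - 1)) * √Δ = √T * (n / (T - 1)) := by
    calc n / (√T * √Δ) * (T / (T - 1)) * √Δ = n / √T * T / (T - 1) := by field_simp
      _ = n / √T * (√T * √T) / (T - 1) := by rw [← e4]
      _ = √T * (n / (T - 1)) := by field_simp
  rw [e5]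
  field_simp
  ring

end VARInference
-- Central limit theorem for the score.
namespace VARInference

lemma integral_abs_le_sqrt {Ω : Type*} [MeasurableSpace Ω] {μ : Measure Ω}
    [IsProbabilityMeasure μ] {f : Ω → ℝ} (hf : MemLp f 2 μ) :
    ∫ ω, |f ω| ∂μ ≤ √(∫ ω, f ω ^ 2 ∂μ) := by
  have h1 := variance_nonneg (fun ω => |f ω|) μ
  have hf' : MemLp (fun ω => |f ω|) 2 μ := hf.abs
  rw [variance_eq_sub hf'] at h1
  refine Real.le_sqrt_of_sq_le ?_
  simp only [Pi.pow_apply, sq_abs] at h1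
  linarith

lemma dotProduct_self_le_l1_sq {d : ℕ} (u : Fin d → ℝ) : u ⬝ᵥ u ≤ l1 u ^ 2 := by
  rw [sq]
  exact (le_abs_self _).trans (abs_dotProduct_le_l1_mul fun i =>
    Finset.single_le_sum (f := fun i => |u i|) (fun i _ => abs_nonneg _) (Finset.mem_univ i))

variable {d : ℕ} {Ω : Type*} [MeasurableSpace Ω] {μ : Measure Ω}
  {A Sig0 Psi : Matrix (Fin d) (Fin d) ℝ} {X W : ℤ → Ω → EuclideanSpace ℝ (Fin d)}

lemma dotProduct_scoreNoise (T : ℕ) (A : Matrix (Fin d) (Fin d) ℝ) (m : Fin d)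
    (x : ℤ → EuclideanSpace ℝ (Fin d)) (u : Fin d → ℝ) :
    u ⬝ᵥ scoreNoise T A m x =
      ∑ t ∈ Finset.Icc 1 (T - 1), (u ⬝ᵥ (x t).ofLp) * innov A (Pi.single m 1) x t := by
  simp only [dotProduct, scoreNoise, Finset.mul_sum, Finset.sum_mul]
  rw [Finset.sum_comm]
  refine Finset.sum_congr rfl fun t _ => Finset.sum_congr rfl fun j _ => by ring

lemma measurable_dotProduct_scoreNoise (hX : ∀ t, Measurable (X t)) (T : ℕ)
    (A : Matrix (Fin d) (Fin d) ℝ) (m : Fin d) (u : Fin d → ℝ) :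
    Measurable fun ω => u ⬝ᵥ scoreNoise T A m (fun t => X t ω) := by
  simp only [dotProduct_scoreNoise]
  refine Finset.measurable_fun_sum _ fun t _ => ?_
  have hp : Measurable fun ω r => X r ω := measurable_pi_lambda _ hX
  have h1 := (measurable_eval_dot u t).comp hp
  have h2 := (measurable_innov A (Pi.single m 1) t).comp hp
  exact h1.mul h2

/-- Quantitative central limit theorem for the score, in terms of characteristic functions. -/
theorem IsStationaryVAR.norm_charFun_score_sub_le [IsProbabilityMeasure μ]
    (h : IsStationaryVAR μ A Sig0 Psi X W) {M ε q : ℝ} (hε : 0 < ε) (hε1 : ε < 1)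
    (hS : opNorm 2 Sig0 ≤ M) (hA : opNorm 2 A ≤ 1 - ε) (u : Fin d → ℝ) (hu : u ⬝ᵥ u ≤ q)
    (m : Fin d) {T : ℕ} (hT : 1 ≤ T) (hγ : 0 < u ⬝ᵥ Sig0 *ᵥ u) (hψ : 0 < Psi m m) (y : ℝ)
    (hy : 2 * (y ^ 2 / (2 * T * (u ⬝ᵥ Sig0 *ᵥ u))) * (2 * M * q / ε) ≤ 1 / 4) :
    ‖charFun (μ.map fun ω => u ⬝ᵥ scoreNoise T A m (fun t => X t ω) /
        √(T * (Psi m m * (u ⬝ᵥ Sig0 *ᵥ u)))) y -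
      Complex.exp ((-(y ^ 2 / 2 * (((T : ℝ) - 1) / T)) : ℝ) : ℂ)‖ ≤
    √(Real.exp (16 * (y ^ 2 / (2 * T * (u ⬝ᵥ Sig0 *ᵥ u))) ^ 2 * T * (2 * M * q / ε) ^ 2) - 1) := by
  -- Only n = T - 1 innovations are observed while the normalisation uses T; hence the factor
  -- (T-1)/T in the limiting exponent.
  obtain ⟨n, rfl⟩ : ∃ n, T = n + 1 := ⟨T - 1, by omega⟩
  set γ := u ⬝ᵥ Sig0 *ᵥ u with hγdef
  set ψ := Psi m m with hψdef
  set l := y ^ 2 / (2 * ((n + 1 : ℕ) : ℝ) * γ) with hl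
  set κ := 2 * M * q / ε with hκ
  have hTpos : (0 : ℝ) < ((n + 1 : ℕ) : ℝ) := by positivity
  have hl0 : 0 ≤ l := by positivity
  have hM : 0 ≤ M := (opNorm_nonneg 2 Sig0).trans hS
  have hq : 0 ≤ q := le_trans (by simpa using dotProduct_star_self_nonneg u) hu
  have hκ0 : 0 ≤ κ := by positivity
  let Z : Ω → ℝ := fun ω => ∑ r ∈ Finset.range n, ((u ⬝ᵥ (X (1 + (r : ℤ)) ω).ofLp) ^ 2 - γ)
  have e1 := h.exp_sum_sq (l := l) hε hε1 hS hA u hu (by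
    rw [abs_of_nonneg hl0, ← hκ]
    have : 0 ≤ l * κ := by positivity
    linarith) 1 n
  -- The doubled parameter controls the second moment of exp(l Z).
  have e2 := h.exp_sum_sq (l := 2 * l) hε hε1 hS hA u hu (by
    rwa [abs_of_nonneg (by positivity), ← hκ]) 1 n
  have hZ1 : Integrable (fun ω => Real.exp (l * Z ω)) μ := e1.1
  have hZ2 : Integrable (fun ω => Real.exp (2 * l * Z ω)) μ := e2.1
  have hZm : Measurable Z := by
    refine Finset.measurable_fun_sum _ fun r _ => ?_
    have := h.measurable_dot_X u (1 + (r : ℤ))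
    fun_prop
  set Nn : Ω → ℝ := fun ω => u ⬝ᵥ scoreNoise (n + 1) A m (fun t => X t ω) /
        √(((n + 1 : ℕ) : ℝ) * (ψ * γ)) with hNn
  have hNm : Measurable Nn :=
    (measurable_dotProduct_scoreNoise h.measurable_X (n + 1) A m u).div_const _
  have hψe : (Pi.single m 1 : Fin d → ℝ) ⬝ᵥ Psi *ᵥ (Pi.single m 1) = ψ := by simp [hψdef]
  have hsq : (y / √(((n + 1 : ℕ) : ℝ) * (ψ * γ))) ^ 2 * ψ / 2 = l := by
    rw [div_pow, Real.sq_sqrt (by positivity), hl]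
    field_simp
  have hQ : ∀ ω, ∑ t ∈ Finset.Icc 1 n, (y / √(((n + 1 : ℕ) : ℝ) * (ψ * γ))) ^ 2 *
      (u ⬝ᵥ (X t ω).ofLp) ^ 2 * ψ / 2 = l * Z ω + l * γ * n := by
    intro ω
    have h1 := sum_Icc_eq_sum_range n fun t => (u ⬝ᵥ (X t ω).ofLp) ^ 2
    have h2 : Z ω = ∑ t ∈ Finset.Icc 1 n, (u ⬝ᵥ (X (t : ℤ) ω).ofLp) ^ 2 - n * γ := by
      rw [h1]; simp [Z, Finset.sum_sub_distrib]
    rw [h2, mul_sub, Finset.mul_sum, sub_add_eq_add_sub, eq_sub_iff_add_eq]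
    rw [show l * (n * γ) = l * γ * n by ring, add_left_inj]
    refine Finset.sum_congr rfl fun t _ => ?_
    rw [← hsq]; ring
  have hmart := h.integral_cexp_martingale u (Pi.single m 1)
    (y / √(((n + 1 : ℕ) : ℝ) * (ψ * γ))) n (by
      simp only [hψe, hQ, Real.exp_add]
      exact hZ1.mul_const _)
  have hexpo : ∀ ω, ∑ t ∈ Finset.Icc 1 n,
      (((y / √(((n + 1 : ℕ) : ℝ) * (ψ * γ)) * (u ⬝ᵥ (X t ω).ofLp) *
        innov A (Pi.single m 1) (fun r => X r ω) t : ℝ) : ℂ) * Complex.I +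
        (((y / √(((n + 1 : ℕ) : ℝ) * (ψ * γ))) ^ 2 * (u ⬝ᵥ (X t ω).ofLp) ^ 2 * ψ / 2 : ℝ) : ℂ)) =
      ((y : ℂ) * (Nn ω : ℂ) * Complex.I + ((l * Z ω : ℝ) : ℂ)) + ((l * γ * n : ℝ) : ℂ) := by
    intro ω
    rw [Finset.sum_add_distrib, ← Finset.sum_mul, ← Complex.ofReal_sum, ← Complex.ofReal_sum,
      hQ ω]
    have : ∑ t ∈ Finset.Icc 1 n, y / √(((n + 1 : ℕ) : ℝ) * (ψ * γ)) * (u ⬝ᵥ (X t ω).ofLp) *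
        innov A (Pi.single m 1) (fun r => X r ω) t = y * Nn ω := by
      simp only [hNn, dotProduct_scoreNoise, Nat.add_sub_cancel]
      rw [Finset.sum_div, Finset.mul_sum]
      refine Finset.sum_congr rfl fun t _ => by ring
    rw [this]
    push_cast
    ring
  simp only [hψe, hexpo] at hmart
  -- Splitting the compensator into its mean and l Z, the deterministic part moves to the right and
  -- becomes the Gaussian exponential.
  have hmart2 : ∫ ω, Complex.exp ((y : ℂ) * (Nn ω : ℂ) * Complex.I) *
      ((Real.exp (l * Z ω) : ℝ) : ℂ) ∂μ = Complex.exp ((-(l * γ * n) : ℝ) : ℂ) := by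
    simp_rw [Complex.exp_add] at hmart
    rw [integral_mul_const] at hmart
    rw [Complex.ofReal_neg, Complex.exp_neg]
    simp_rw [Complex.ofReal_exp]
    exact eq_inv_of_mul_eq_one_left hmart
  have hlγ : l * γ * n = y ^ 2 / 2 * ((((n + 1 : ℕ) : ℝ) - 1) / ((n + 1 : ℕ) : ℝ)) := by
    rw [hl]
    push_cast
    field_simp
    ring
  have hnorm1 : ∀ ω, ‖Complex.exp ((y : ℂ) * (Nn ω : ℂ) * Complex.I)‖ = 1 := fun ω => by
    rw [← Complex.ofReal_mul]; exact Complex.norm_exp_ofReal_mul_I _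
  have hm1 : Measurable fun ω => Complex.exp ((y : ℂ) * (Nn ω : ℂ) * Complex.I) := by fun_prop
  have hi1 : Integrable (fun ω => Complex.exp ((y : ℂ) * (Nn ω : ℂ) * Complex.I)) μ :=
    (integrable_const (1 : ℝ)).mono' hm1.aestronglyMeasurable
      (ae_of_all _ fun ω => (hnorm1 ω).le)
  have hi2 : Integrable (fun ω => Complex.exp ((y : ℂ) * (Nn ω : ℂ) * Complex.I) *
      ((Real.exp (l * Z ω) : ℝ) : ℂ)) μ := by
    refine hZ1.mono' (by fun_prop) (ae_of_all _ fun ω => ?_)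
    rw [norm_mul, hnorm1, one_mul, Complex.norm_real, Real.norm_eq_abs, Real.abs_exp]
  have hcf : charFun (μ.map Nn) y = ∫ ω, Complex.exp ((y : ℂ) * (Nn ω : ℂ) * Complex.I) ∂μ := by
    rw [charFun_apply_real, integral_map hNm.aemeasurable (by fun_prop)]
  rw [hcf, ← hlγ, ← hmart2, ← integral_sub hi1 hi2]
  have hsq2 : ∀ ω, (1 - Real.exp (l * Z ω)) ^ 2 =
      1 - 2 * Real.exp (l * Z ω) + Real.exp (2 * l * Z ω) := by
    intro ω
    have : Real.exp (2 * l * Z ω) = Real.exp (l * Z ω) ^ 2 := by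
      rw [← Real.exp_nat_mul]; push_cast; ring_nf
    rw [this]; ring
  have hisq : Integrable (fun ω => (1 - Real.exp (l * Z ω)) ^ 2) μ := by
    simp only [hsq2]
    exact ((integrable_const _).sub (hZ1.const_mul 2)).add hZ2
  have hmem : MemLp (fun ω => 1 - Real.exp (l * Z ω)) 2 μ :=
    (memLp_two_iff_integrable_sq (by fun_prop)).2 hisq
  have hsqint : ∀ r : ℤ, Integrable (fun ω => (u ⬝ᵥ (X r ω).ofLp) ^ 2) μ := fun r =>
    (h.hasGaussianLaw_dot_X u r).memLp_two.integrable_sq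
  have hZint : Integrable Z μ :=
    integrable_finsetSum _ fun r _ => (hsqint _).sub (integrable_const _)
  have hZ0 : ∫ ω, Z ω ∂μ = 0 := by
    have hi : ∀ r : ℕ, Integrable (fun ω => (u ⬝ᵥ (X (1 + (r : ℤ)) ω).ofLp) ^ 2 - γ) μ :=
      fun r => (hsqint _).sub (integrable_const _)
    simp only [Z]
    rw [integral_finsetSum _ fun r _ => hi r]
    refine Finset.sum_eq_zero fun r _ => ?_
    rw [integral_sub (hsqint _) (integrable_const _)]
    have h1 := h.cov_dot_X_self u u (1 + (r : ℤ))
    rw [covariance_eq_sub (h.hasGaussianLaw_dot_X u _).memLp_two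
      (h.hasGaussianLaw_dot_X u _).memLp_two, h.integral_dot_X] at h1
    simp only [Pi.mul_apply] at h1
    simp only [sq, integral_const, probReal_univ, smul_eq_mul, one_mul]
    linarith
  -- Jensen for the centred Z; it gives E(1 - exp(l Z))² ≤ E exp(2 l Z) - 1.
  have hge : 1 ≤ ∫ ω, Real.exp (l * Z ω) ∂μ := by
    have h1 : ∫ ω, (l * Z ω + 1) ∂μ ≤ ∫ ω, Real.exp (l * Z ω) ∂μ :=
      integral_mono ((hZint.const_mul l).add (integrable_const _)) hZ1
        fun ω => Real.add_one_le_exp _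
    rw [integral_add (hZint.const_mul l) (integrable_const _), integral_const_mul, hZ0] at h1
    simpa using h1
  calc ‖∫ ω, (Complex.exp ((y : ℂ) * (Nn ω : ℂ) * Complex.I) -
          Complex.exp ((y : ℂ) * (Nn ω : ℂ) * Complex.I) * ((Real.exp (l * Z ω) : ℝ) : ℂ)) ∂μ‖
      ≤ ∫ ω, |1 - Real.exp (l * Z ω)| ∂μ := by
        refine (norm_integral_le_integral_norm _).trans_eq ?_
        refine integral_congr_ae (ae_of_all _ fun ω => ?_)
        simp only
        rw [← mul_one_sub, norm_mul, hnorm1, one_mul, ← Complex.ofReal_one, ← Complex.ofReal_sub,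
          Complex.norm_real, Real.norm_eq_abs]
    _ ≤ √(∫ ω, (1 - Real.exp (l * Z ω)) ^ 2 ∂μ) := integral_abs_le_sqrt hmem
    _ ≤ _ := by
        refine Real.sqrt_le_sqrt ?_
        simp only [hsq2]
        have hi : Integrable (fun ω => 1 - 2 * Real.exp (l * Z ω)) μ :=
          (integrable_const _).sub (hZ1.const_mul 2)
        rw [integral_add hi hZ2,
          integral_sub (integrable_const _) (hZ1.const_mul 2), integral_const_mul]
        have h3 : ∫ ω, Real.exp (2 * l * Z ω) ∂μ ≤
            Real.exp (16 * l ^ 2 * ((n + 1 : ℕ) : ℝ) * κ ^ 2) := by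
          refine e2.2.trans (Real.exp_le_exp.2 ?_)
          rw [← hκ]
          have : (n : ℝ) ≤ ((n + 1 : ℕ) : ℝ) := by push_cast; linarith
          calc 4 * (2 * l) ^ 2 * (n : ℝ) * κ ^ 2 = 16 * l ^ 2 * n * κ ^ 2 := by ring
            _ ≤ _ := by gcongr
        simp only [integral_const, probReal_univ, smul_eq_mul, mul_one]
        linarith

end VARInference
-- Convergence of distribution functions; bounds on the population parameters.
namespace VARInference

/-- Pointwise convergence of characteristic functions to the standard normal one gives pointwise
convergence of the distribution functions. -/
lemma tendsto_measureReal_le_of_charFun {Ω : ℕ → Type*} [∀ T, MeasurableSpace (Ω T)]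
    {μ : ∀ T, Measure (Ω T)} [∀ T, IsProbabilityMeasure (μ T)] {N : ∀ T, Ω T → ℝ}
    (hN : ∀ T, Measurable (N T))
    (h : ∀ y : ℝ, Tendsto (fun T => charFun ((μ T).map (N T)) y) atTop
      (𝓝 (Complex.exp ((-(y ^ 2 / 2) : ℝ) : ℂ)))) (t : ℝ) :
    Tendsto (fun T => (μ T).real {ω | N T ω ≤ t}) atTop (𝓝 (cdf (gaussianReal 0 1) t)) := by
  let P : ℕ → ProbabilityMeasure ℝ := fun T =>
    ⟨(μ T).map (N T), Measure.isProbabilityMeasure_map (hN T).aemeasurable⟩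
  let G : ProbabilityMeasure ℝ := ⟨gaussianReal 0 1, inferInstance⟩
  have hP : Tendsto P atTop (𝓝 G) := by
    refine ProbabilityMeasure.tendsto_of_tendsto_charFun fun y => ?_
    have e : charFun (G : Measure ℝ) y = Complex.exp ((-(y ^ 2 / 2) : ℝ) : ℂ) := by
      simp only [G, ProbabilityMeasure.coe_mk, charFun_gaussianReal]
      congr 1
      push_cast
      simp
    rw [e]
    exact h y
  have hnull : (G : Measure ℝ) (frontier (Set.Iic t)) = 0 := by
    have := nullSingletonClass_gaussianReal (μ := 0) (v := 1) one_ne_zero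
    rw [frontier_Iic]
    exact measure_singleton (μ := gaussianReal 0 1) t
  have h1 := ProbabilityMeasure.tendsto_measure_of_null_frontier_of_tendsto' hP hnull
  have h2 := (ENNReal.tendsto_toReal (measure_ne_top _ _)).comp h1
  rw [cdf_eq_real]
  refine h2.congr fun T => ?_
  simp only [Function.comp_apply, P, ProbabilityMeasure.coe_mk]
  rw [Measure.map_apply (hN T) measurableSet_Iic]
  rfl

/-- Slutsky's theorem for distribution functions, without measurability assumptions on `U`. -/
lemma tendsto_measureReal_le_of_close {Ω : ℕ → Type*} [∀ T, MeasurableSpace (Ω T)]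
    {μ : ∀ T, Measure (Ω T)} [∀ T, IsProbabilityMeasure (μ T)] {N U : ∀ T, Ω T → ℝ} {Φ : ℝ → ℝ}
    (hΦ : Continuous Φ)
    (hN : ∀ t, Tendsto (fun T => (μ T).real {ω | N T ω ≤ t}) atTop (𝓝 (Φ t)))
    (hU : ∀ η > 0, ∀ᶠ T in atTop, (μ T).real {ω | ¬ |U T ω - N T ω| ≤ η} ≤ η) (t : ℝ) :
    Tendsto (fun T => |(μ T).real {ω | U T ω ≤ t} - Φ t|) atTop (𝓝 0) := by
  rw [Metric.tendsto_atTop']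
  intro η hη
  obtain ⟨δ, hδ, hc⟩ := Metric.continuousAt_iff.1 (hΦ.continuousAt (x := t)) (η / 4)
    (by positivity)
  set ξ := min (δ / 2) (η / 4) with hξ
  have hξ0 : 0 < ξ := by positivity
  have hup := hc (x := t + ξ) (by
    rw [Real.dist_eq, add_sub_cancel_left, abs_of_pos hξ0]
    linarith [min_le_left (δ / 2) (η / 4)])
  have hdown := hc (x := t - ξ) (by
    rw [Real.dist_eq, sub_sub_cancel_left, abs_neg, abs_of_pos hξ0]
    linarith [min_le_left (δ / 2) (η / 4)])
  rw [Real.dist_eq] at hup hdown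
  have e1 := Metric.tendsto_nhds.1 (hN (t + ξ)) (η / 4) (by positivity)
  have e2 := Metric.tendsto_nhds.1 (hN (t - ξ)) (η / 4) (by positivity)
  obtain ⟨T₀, hT₀⟩ := eventually_atTop.1 (e1.and (e2.and (hU ξ hξ0)))
  refine ⟨T₀, fun T hT => ?_⟩
  obtain ⟨f1, f2, f3⟩ := hT₀ T hT.le
  rw [Real.dist_eq] at f1 f2
  rw [Real.dist_eq, sub_zero, abs_abs]
  have s1 : {ω | U T ω ≤ t} ⊆ {ω | N T ω ≤ t + ξ} ∪ {ω | ¬ |U T ω - N T ω| ≤ ξ} := by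
    intro ω (hω : U T ω ≤ t)
    by_cases hd : |U T ω - N T ω| ≤ ξ
    · left
      have := (abs_le.1 hd).1
      simp only [Set.mem_ofPred_eq]
      linarith
    · exact Or.inr hd
  have s2 : {ω | N T ω ≤ t - ξ} ⊆ {ω | U T ω ≤ t} ∪ {ω | ¬ |U T ω - N T ω| ≤ ξ} := by
    intro ω (hω : N T ω ≤ t - ξ)
    by_cases hd : |U T ω - N T ω| ≤ ξ
    · left
      have := (abs_le.1 hd).2
      simp only [Set.mem_ofPred_eq]
      linarith
    · exact Or.inr hd
  have m1 := (measureReal_mono (μ := μ T) s1).trans (measureReal_union_le _ _)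
  have m2 := (measureReal_mono (μ := μ T) s2).trans (measureReal_union_le _ _)
  have hξη : ξ ≤ η / 4 := min_le_right _ _
  rw [abs_lt] at *
  constructor <;> linarith

lemma continuous_cdf_gaussianReal : Continuous (cdf (gaussianReal 0 1)) := by
  have := nullSingletonClass_gaussianReal (μ := 0) (v := 1) one_ne_zero
  rw [continuous_iff_continuousAt]
  intro t
  have h1 := (cdf (gaussianReal 0 1)).measure_singleton t
  rw [measure_cdf, measure_singleton] at h1
  have h2 := ENNReal.ofReal_eq_zero.1 h1.symm
  have h3 := (monotone_cdf (gaussianReal 0 1)).leftLim_le (le_refl t)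
  rw [(monotone_cdf (gaussianReal 0 1)).continuousAt_iff_leftLim_eq_rightLim,
    StieltjesFunction.rightLim_eq]
  linarith

variable {d : ℕ} {Ω : Type*} [MeasurableSpace Ω] {μ : Measure Ω}
  {A Sig0 Psi : Matrix (Fin d) (Fin d) ℝ} {X W : ℤ → Ω → EuclideanSpace ℝ (Fin d)}
  {M ε C : ℝ} {s sv : ℕ} {k m : Fin d}

/-- Otherwise the norm bound forces `Sig0⁻¹` to vanish, which is impossible in positive dimension.
-/
lemma pos_of_mem_classL (hd : 2 ≤ d) (hS : Sig0 ∈ classL M) : 0 < M := by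
  obtain ⟨hdet, h1, -⟩ := hS
  by_contra hM
  let i : Fin d := ⟨0, by omega⟩
  have h0 : Sig0⁻¹ = 0 := by
    ext a b
    have h2 := (sum_abs_col_le_opNorm_one Sig0⁻¹ b).trans h1
    have h3 := Finset.single_le_sum (f := fun i => |Sig0⁻¹ i b|) (fun i _ => abs_nonneg _)
      (Finset.mem_univ a)
    have h4 := abs_nonneg (Sig0⁻¹ a b)
    simpa using abs_eq_zero.1 (by linarith : |Sig0⁻¹ a b| = 0)
  have h2 := Matrix.mul_nonsing_inv Sig0 hdet
  rw [h0, mul_zero] at h2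
  have := congrFun (congrFun h2 i) i
  simp at this

lemma IsStationaryVAR.populationBounds (h : IsStationaryVAR μ A Sig0 Psi X W) (hd : 2 ≤ d)
    (hS : Sig0 ∈ classL M) (hA : A ∈ classM M ε s)
    (hsv : l0 (fun i => Sig0⁻¹ k i) = sv) : PopulationBounds M A Sig0 k m (max sv s) := by
  have hM := pos_of_mem_classL hd hS
  obtain ⟨hdet, h1, h2⟩ := hS
  obtain ⟨a0, a1, -⟩ := hA
  have hsymm : ∀ i j, Sig0⁻¹ i j = Sig0⁻¹ j i := fun i j => by
    simpa using h.posSemidef_Sig0.isHermitian.inv.apply j i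
  have hmul : Sig0 *ᵥ Sig0⁻¹ k = Pi.single k 1 := by
    have e : Sig0⁻¹ k = Sig0⁻¹ *ᵥ Pi.single k 1 := by
      funext i
      simp [hsymm k i]
    rw [e, Matrix.mulVec_mulVec, Matrix.mul_nonsing_inv _ hdet, Matrix.one_mulVec]
  refine ⟨hM.le, hdet, fun i => ?_, fun i j => (abs_apply_le_opNorm_two Sig0 i j).trans h2,
    (sum_abs_col_le_opNorm_one A m).trans a1, (a0 m).trans (le_max_right _ _),
    hsv.le.trans (le_max_left _ _), ?_, hmul⟩
  · refine le_trans (le_of_eq ?_) ((sum_abs_col_le_opNorm_one Sig0⁻¹ i).trans h1)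
    exact Finset.sum_congr rfl fun j _ => by rw [hsymm]
  -- A row of an invertible matrix is nonzero, so the sparsity is at least 1. Hence the growth
  -- condition alone forces log d = o(√T).
  · refine le_max_of_le_left (hsv ▸ Finset.card_pos.2 ?_)
    by_contra hcon
    have h0 : Sig0⁻¹ k = 0 := by
      funext i
      by_contra hi
      exact hcon ⟨i, Finset.mem_filter.2 ⟨Finset.mem_univ _, hi⟩⟩
    rw [h0, Matrix.mulVec_zero] at hmul
    have := congrFun hmul k
    simp at this

lemma IsStationaryVAR.varianceBounds [IsProbabilityMeasure μ]
    (h : IsStationaryVAR μ A Sig0 Psi X W) (hC : 0 < C)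
    (hd : 2 ≤ d) (hS : Sig0 ∈ classL M) (hp : PopulationBounds M A Sig0 k m s)
    (hPsi : ∀ j, C ≤ Psi j j) : VarianceBounds M C A Sig0 Psi k m := by
  have hM := pos_of_mem_classL hd hS
  have hdec : Sig0 m m = A.col m ⬝ᵥ Sig0 *ᵥ A.col m + Psi m m := by
    have h1 := h.sig0_eq (Pi.single m 1)
    simpa using h1
  refine ⟨hdec, hC, hM, hPsi m, ?_, ?_⟩
  · have h2 := h.posSemidef_Sig0.dotProduct_mulVec_nonneg (A.col m)
    have h3 := (le_abs_self _).trans (hp.entry m m)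
    simp only [star_trivial] at h2
    linarith
  -- Positivity at e_k - M v* reads 0 ≤ Σ_kk - 2M + M²γ with Σ_kk ≤ M, whence γ ≥ 1/M.
  · have h2 := h.posSemidef_Sig0.dotProduct_mulVec_nonneg (Pi.single k 1 - M • Sig0⁻¹ k)
    have h3 := (le_abs_self _).trans (hp.entry k k)
    have hsymm : Sig0⁻¹ k ⬝ᵥ Sig0 *ᵥ (Pi.single k 1) = 1 := by
      have hT : Sig0ᵀ = Sig0 := by
        ext i j
        simpa using h.posSemidef_Sig0.isHermitian.apply i j
      rw [Matrix.dotProduct_mulVec, ← Matrix.mulVec_transpose, hT, hp.mulVec_row]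
      simp
    simp only [star_trivial, Matrix.mulVec_sub, Matrix.mulVec_smul, dotProduct_sub,
      sub_dotProduct, smul_dotProduct, dotProduct_smul, smul_eq_mul, hsymm] at h2
    rw [hp.mulVec_row] at h2 ⊢
    simp at h2 ⊢
    rw [inv_le_iff_one_le_mul₀ hM]
    nlinarith

end VARInference
-- Rates implied by the growth condition.
namespace VARInference

section Rates

variable {d sbar : ℕ → ℕ}

lemma tendsto_natCast_sub_one_inv : Tendsto (fun T : ℕ => ((T : ℝ) - 1)⁻¹) atTop (𝓝 0) :=
  tendsto_inv_atTop_zero.comp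
    (tendsto_atTop_add_const_right _ (-1) tendsto_natCast_atTop_atTop)

lemma tendsto_inv_sqrt_natCast : Tendsto (fun T : ℕ => (√(T : ℝ))⁻¹) atTop (𝓝 0) :=
  tendsto_inv_atTop_zero.comp (Real.tendsto_sqrt_atTop.comp tendsto_natCast_atTop_atTop)

lemma log_two_le_log {n : ℕ} (hn : 2 ≤ n) : Real.log 2 ≤ Real.log n :=
  Real.log_le_log two_pos (by exact_mod_cast hn)

/-- Since d ≥ 2, log d is bounded below and √(log d) is at most a constant times log d. -/
lemma tendsto_mul_rate (hd : ∀ T, 2 ≤ d T)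
    (hf : Tendsto (fun T => (sbar T : ℝ) * Real.log (d T) / √T) atTop (𝓝 0)) :
    Tendsto (fun T => (sbar T : ℝ) * rate (d T) T) atTop (𝓝 0) := by
  have h2 : (0 : ℝ) < Real.log 2 := Real.log_pos one_lt_two
  have h3 := hf.const_mul (√(Real.log 2))⁻¹
  rw [mul_zero] at h3
  refine squeeze_zero (fun T => mul_nonneg (Nat.cast_nonneg _) (Real.sqrt_nonneg _))
    (fun T => ?_) h3
  have hL := log_two_le_log (hd T)
  have hs2 : 0 < √(Real.log 2) := Real.sqrt_pos.2 h2
  have h4 : √(Real.log (d T)) ≤ (√(Real.log 2))⁻¹ * Real.log (d T) := by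
    rw [le_inv_mul_iff₀ hs2]
    calc √(Real.log 2) * √(Real.log (d T)) ≤ √(Real.log (d T)) * √(Real.log (d T)) :=
          mul_le_mul_of_nonneg_right (Real.sqrt_le_sqrt hL) (Real.sqrt_nonneg _)
      _ = Real.log (d T) := Real.mul_self_sqrt (h2.le.trans hL)
  rw [rate, Real.sqrt_div (h2.le.trans hL), ← mul_div_assoc, ← mul_div_assoc, mul_left_comm]
  gcongr

lemma tendsto_rate (hd : ∀ T, 2 ≤ d T) (hs : ∀ T, 1 ≤ sbar T)
    (hf : Tendsto (fun T => (sbar T : ℝ) * Real.log (d T) / √T) atTop (𝓝 0)) :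
    Tendsto (fun T => rate (d T) T) atTop (𝓝 0) := by
  refine squeeze_zero (fun T => Real.sqrt_nonneg _) (fun T => ?_) (tendsto_mul_rate hd hf)
  have : (1 : ℝ) ≤ sbar T := by exact_mod_cast hs T
  exact le_mul_of_one_le_left (Real.sqrt_nonneg _) this

/-- For T ≥ 1 the expression equals s log d / √T; this second-order term is the one that needs the
full growth condition. -/
lemma tendsto_sqrt_mul_rate_mul_rate
    (hf : Tendsto (fun T => (sbar T : ℝ) * Real.log (d T) / √T) atTop (𝓝 0)) :
    Tendsto (fun T : ℕ => √(T : ℝ) * (rate (d T) T * ((sbar T : ℝ) * rate (d T) T)))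
      atTop (𝓝 0) := by
  refine hf.congr' ?_
  filter_upwards [eventually_ge_atTop 1] with T hT
  have hT' : (0 : ℝ) < T := by exact_mod_cast hT
  have h1 : rate (d T) T * rate (d T) T = Real.log (d T) / T :=
    Real.mul_self_sqrt (div_nonneg (Real.log_natCast_nonneg _) hT'.le)
  have h2 : (√(T : ℝ)) * √T = T := Real.mul_self_sqrt hT'.le
  have h3 : √(T : ℝ) ≠ 0 := (Real.sqrt_pos.2 hT').ne'
  calc (sbar T : ℝ) * Real.log (d T) / √T
      = √T * (sbar T * (Real.log (d T) / (√T * √T))) := by field_simp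
    _ = √T * (sbar T * (rate (d T) T * rate (d T) T)) := by rw [h1, h2]
    _ = _ := by ring

lemma tendsto_sqrt_mul_boundary (hs : ∀ T, 1 ≤ sbar T) {M a : ℝ} (hM : 0 ≤ M) (ha : 0 ≤ a)
    (hf : Tendsto (fun T => (sbar T : ℝ) * Real.log (d T) / √T) atTop (𝓝 0)) :
    Tendsto (fun T : ℕ => √(T : ℝ) * boundary (d T) T M a) atTop (𝓝 0) := by
  have h1 := (hf.const_mul (2 * a * M)).add (tendsto_inv_sqrt_natCast.const_mul (4 * M ^ 2))
  rw [mul_zero, mul_zero, add_zero] at h1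
  refine squeeze_zero' ?_ ?_ h1
  · filter_upwards [eventually_ge_atTop 2] with T hT
    have hT2 : (2 : ℝ) ≤ T := by exact_mod_cast hT
    have := Real.log_natCast_nonneg (d T)
    exact mul_nonneg (Real.sqrt_nonneg _) (div_nonneg (by positivity) (by linarith))
  · filter_upwards [eventually_ge_atTop 2] with T hT
    have hT2 : (2 : ℝ) ≤ T := by exact_mod_cast hT
    have hT0 : (0 : ℝ) < T := by linarith
    have hL := Real.log_natCast_nonneg (d T)
    have h2 : (√(T : ℝ)) * √T = T := Real.mul_self_sqrt hT0.le
    have h3 : 0 < √(T : ℝ) := Real.sqrt_pos.2 hT0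
    have hs' : (1 : ℝ) ≤ sbar T := by exact_mod_cast hs T
    have h4 : √(T : ℝ) / ((T : ℝ) - 1) ≤ 2 / √T := by
      rw [div_le_div_iff₀ (by linarith) h3, h2]
      linarith
    calc √(T : ℝ) * boundary (d T) T M a
        = (√(T : ℝ) / ((T : ℝ) - 1)) * (a * M * Real.log (d T) + 2 * M ^ 2) := by
          rw [boundary]; ring
      _ ≤ 2 / √T * (a * M * (sbar T * Real.log (d T)) + 2 * M ^ 2) := by
          have : Real.log (d T) ≤ sbar T * Real.log (d T) := le_mul_of_one_le_left hL hs'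
          gcongr
      _ = _ := by field_simp; ring

/-- After scaling by √T the boundary tends to 0, while the rate stays above √(log 2). -/
lemma eventually_boundary_le_rate (hd : ∀ T, 2 ≤ d T) (hs : ∀ T, 1 ≤ sbar T) {M a : ℝ}
    (hM : 0 ≤ M) (ha : 0 ≤ a)
    (hf : Tendsto (fun T => (sbar T : ℝ) * Real.log (d T) / √T) atTop (𝓝 0)) :
    ∀ᶠ T in atTop, boundary (d T) T M a ≤ rate (d T) T := by
  have h2 : (0 : ℝ) < √(Real.log 2) := Real.sqrt_pos.2 (Real.log_pos one_lt_two)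
  filter_upwards [(tendsto_sqrt_mul_boundary hs hM ha hf).eventually_le_const h2,
    eventually_ge_atTop 1] with T h1 hT
  have hT' : (0 : ℝ) < T := by exact_mod_cast hT
  rw [rate, Real.sqrt_div (Real.log_natCast_nonneg _), le_div_iff₀ (Real.sqrt_pos.2 hT'), mul_comm]
  exact h1.trans (Real.sqrt_le_sqrt (log_two_le_log (hd T)))

end Rates

/-- At T = 0 division by zero makes the rate 0, so positivity needs a separate value there. -/
lemma sameOrder_rate {d : ℕ → ℕ} (hd : ∀ T, 2 ≤ d T) {K : ℝ} (hK : 0 < K) :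
    SameOrder (fun T => if T = 0 then 1 else K * rate (d T) T)
      (fun T => √(Real.log (d T) / T)) := by
  refine ⟨fun T => ?_, ?_⟩
  · by_cases hT : T = 0
    · simp [hT]
    · have hT' : (0 : ℝ) < T := by exact_mod_cast Nat.pos_of_ne_zero hT
      have hL : 0 < Real.log (d T) := Real.log_pos (by exact_mod_cast hd T)
      simp only [hT, if_false]
      exact mul_pos hK (Real.sqrt_pos.2 (by positivity))
  · have h1 : (fun T => K * rate (d T) T) =Θ[atTop] fun T => √(Real.log (d T) / T) :=
      (Asymptotics.isTheta_const_mul_left hK.ne').2 (Asymptotics.isTheta_refl _ _)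
    refine (Filter.EventuallyEq.trans_isTheta ?_ h1)
    filter_upwards [eventually_ge_atTop 1] with T hT
    rw [if_neg (by omega)]

lemma GoodPath.mono {d T : ℕ} {A Sig0 : Matrix (Fin d) (Fin d) ℝ} {m : Fin d} {a b : ℝ}
    {x : ℤ → EuclideanSpace ℝ (Fin d)} (h : GoodPath T A Sig0 m a x) (hab : a ≤ b) :
    GoodPath T A Sig0 m b x where
  cov i j := (h.cov i j).trans (mul_le_mul_of_nonneg_right hab (Real.sqrt_nonneg _))
  noise i := (h.noise i).trans (mul_le_mul_of_nonneg_right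
    (mul_le_mul_of_nonneg_right hab (Nat.cast_nonneg _)) (Real.sqrt_nonneg _))
  last i := (h.last i).trans (mul_le_mul_of_nonneg_right hab (Real.log_natCast_nonneg _))

lemma EstimationBounds.mono {d T : ℕ} {x : ℤ → EuclideanSpace ℝ (Fin d)}
    {A Sig0 : Matrix (Fin d) (Fin d) ℝ} {k m : Fin d} {lam r r' : ℝ} {β v : Fin d → ℝ}
    (h : EstimationBounds T x A Sig0 k m lam r β v) (hr : r ≤ r') :
    EstimationBounds T x A Sig0 k m lam r' β v :=
  ⟨h.feasible_beta, h.feasible_v, h.beta.trans hr, h.v.trans hr⟩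

/-- A constant `a` for which paths are good with probability at least `1 - 10 d⁻ᵍ`. -/
noncomputable def goodConst (M ε g : ℝ) : ℝ :=
  (g + 2 + 4 * (2 * M * 4 / ε) ^ 2) + (g + 1 + M ^ 2) + (g + 1) * (4 * (2 * M * 4 / ε))

lemma goodConst_pos {M ε g : ℝ} (hM : 0 < M) (hε : 0 < ε) (hg : 0 ≤ g) :
    0 < goodConst M ε g := by
  unfold goodConst; positivity

lemma goodConst_mono {M ε g g' : ℝ} (hM : 0 < M) (hε : 0 < ε) (hg : g ≤ g') :
    goodConst M ε g ≤ goodConst M ε g' := by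
  unfold goodConst; gcongr

theorem IsStationaryVAR.measureReal_not_goodPath_goodConst_le {d : ℕ} {Ω : Type*}
    [MeasurableSpace Ω] {μ : Measure Ω} [IsProbabilityMeasure μ]
    {A Sig0 Psi : Matrix (Fin d) (Fin d) ℝ} {X W : ℤ → Ω → EuclideanSpace ℝ (Fin d)}
    (h : IsStationaryVAR μ A Sig0 Psi X W) {M ε g : ℝ} (hε : 0 < ε) (hε1 : ε < 1)
    (hM : 0 < M) (hS : opNorm 2 Sig0 ≤ M) (hA : opNorm 2 A ≤ 1 - ε) (hd2 : 2 ≤ d)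
    (m : Fin d) {T : ℕ} (hT : 1 ≤ T) (hρ : rate d T * (2 * M * 4 / ε) ≤ 1 / 4)
    (hg : 0 ≤ g) (haρ : goodConst M ε g * rate d T ≤ M) :
    μ.real {ω | ¬ GoodPath T A Sig0 m (goodConst M ε g) (fun t => X t ω)} ≤
      10 * Real.exp (-g * Real.log d) := by
  have hκ : 0 < 2 * M * 4 / ε := by positivity
  have h1 : 0 ≤ (g + 1) * (4 * (2 * M * 4 / ε)) := by positivity
  have h2 : 0 ≤ 4 * (2 * M * 4 / ε) ^ 2 := by positivity
  have h3 : 0 ≤ M ^ 2 := by positivity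
  refine h.measureReal_not_goodPath_le hε hε1 hM hS hA hd2 m hT hρ haρ ?_ ?_ ?_
  · unfold goodConst; linarith
  · unfold goodConst; linarith
  · rw [le_div_iff₀ (by positivity)]
    unfold goodConst; linarith

/-! ### Assembly along the sequence of models. -/

section Sequences

variable {M ε C : ℝ} {d s sv : ℕ → ℕ} {k m : ∀ T, Fin (d T)}
  {A Sig0 Psi : ∀ T, Matrix (Fin (d T)) (Fin (d T)) ℝ}
  {Ω : ℕ → Type*} [∀ T, MeasurableSpace (Ω T)] {μ : ∀ T, Measure (Ω T)}
  [∀ T, IsProbabilityMeasure (μ T)] {X W : ∀ T, ℤ → Ω T → EuclideanSpace ℝ (Fin (d T))}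

/-- The normalized score. -/
noncomputable def score {d : ℕ} (T : ℕ) (A Sig0 Psi : Matrix (Fin d) (Fin d) ℝ) (k m : Fin d)
    (x : ℤ → EuclideanSpace ℝ (Fin d)) : ℝ :=
  Sig0⁻¹ k ⬝ᵥ scoreNoise T A m x / √(T * asympVar Sig0 Psi k m)

theorem tendsto_measureReal_score_le (hε : 0 < ε) (hε1 : ε < 1)
    (hSig0 : ∀ T, Sig0 T ∈ classL M) (hA : ∀ T, A T ∈ classM M ε (s T))
    (h : ∀ T, IsStationaryVAR (μ T) (A T) (Sig0 T) (Psi T) (X T) (W T))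
    (hp : ∀ T, PopulationBounds M (A T) (Sig0 T) (k T) (m T) (max (sv T) (s T)))
    (hv : ∀ T, VarianceBounds M C (A T) (Sig0 T) (Psi T) (k T) (m T)) (t : ℝ) :
    Tendsto (fun T => (μ T).real {ω | score T (A T) (Sig0 T) (Psi T) (k T) (m T)
      (fun r => X T r ω) ≤ t}) atTop (𝓝 (cdf (gaussianReal 0 1) t)) := by
  have hM := (hv 0).M_pos
  refine tendsto_measureReal_le_of_charFun (fun T => (measurable_dotProduct_scoreNoise
    (h T).measurable_X T (A T) (m T) _).div_const _) (fun y => ?_) t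
  set κ : ℝ := 2 * M * M ^ 2 / ε with hκ
  have hκ0 : 0 < κ := by positivity
  have hγ : ∀ T, M⁻¹ ≤ (Sig0 T)⁻¹ (k T) ⬝ᵥ Sig0 T *ᵥ (Sig0 T)⁻¹ (k T) := fun T => (hv T).row_lower
  have hMi : 0 < M⁻¹ := inv_pos.2 hM
  have hlbound : ∀ T : ℕ, 1 ≤ T → y ^ 2 / (2 * T *
      ((Sig0 T)⁻¹ (k T) ⬝ᵥ Sig0 T *ᵥ (Sig0 T)⁻¹ (k T))) ≤ y ^ 2 * M / 2 * (T : ℝ)⁻¹ := by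
    intro T hT
    have hT' : (0 : ℝ) < T := by exact_mod_cast hT
    calc _ ≤ y ^ 2 / (2 * T * M⁻¹) := by gcongr; exact hγ T
      _ = _ := by field_simp
  have hinv : Tendsto (fun T : ℕ => (T : ℝ)⁻¹) atTop (𝓝 0) := tendsto_inv_atTop_nhds_zero_nat
  have hdiff : Tendsto (fun T : ℕ => charFun ((μ T).map fun ω =>
      score T (A T) (Sig0 T) (Psi T) (k T) (m T) (fun r => X T r ω)) y -
      Complex.exp ((-(y ^ 2 / 2 * (((T : ℝ) - 1) / T)) : ℝ) : ℂ)) atTop (𝓝 0) := by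
    have hlim : Tendsto (fun T : ℕ =>
        √(Real.exp (16 * (y ^ 2 * M / 2) ^ 2 * κ ^ 2 * (T : ℝ)⁻¹) - 1)) atTop (𝓝 0) := by
      have h1 := (((Real.continuous_exp.tendsto _).comp
        (hinv.const_mul (16 * (y ^ 2 * M / 2) ^ 2 * κ ^ 2))).sub_const 1).sqrt
      simpa [Function.comp_def] using h1
    refine squeeze_zero_norm' ?_ hlim
    have hsmall := (hinv.const_mul (2 * (y ^ 2 * M / 2) * κ)).eventually_le_const
      (by norm_num : 2 * (y ^ 2 * M / 2) * κ * 0 < 1 / 4)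
    filter_upwards [eventually_ge_atTop 1, hsmall] with T hT hT2
    have hT' : (0 : ℝ) < T := by exact_mod_cast hT
    have hγT := hMi.trans_le (hγ T)
    have hψ := hv T |>.C_pos.trans_le (hv T).lower
    have hu : (Sig0 T)⁻¹ (k T) ⬝ᵥ (Sig0 T)⁻¹ (k T) ≤ M ^ 2 :=
      (dotProduct_self_le_l1_sq _).trans (pow_le_pow_left₀ (l1_nonneg _) ((hp T).row _) 2)
    have hl := hlbound T hT
    have hl0 : 0 ≤ y ^ 2 / (2 * T *
      ((Sig0 T)⁻¹ (k T) ⬝ᵥ Sig0 T *ᵥ (Sig0 T)⁻¹ (k T))) := by positivity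
    refine ((h T).norm_charFun_score_sub_le hε hε1 (hSig0 T).2.2 (hA T).2.2 _ hu (m T) hT hγT hψ
      y ?_).trans ?_
    · rw [← hκ]
      refine le_trans ?_ hT2
      calc _ ≤ 2 * (y ^ 2 * M / 2 * (T : ℝ)⁻¹) * κ := by gcongr
        _ = _ := by ring
    · rw [← hκ]
      refine Real.sqrt_le_sqrt (sub_le_sub_right (Real.exp_le_exp.2 ?_) _)
      calc _ ≤ 16 * (y ^ 2 * M / 2 * (T : ℝ)⁻¹) ^ 2 * T * κ ^ 2 := by gcongr
        _ = _ := by field_simp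
  have hexp : Tendsto (fun T : ℕ => Complex.exp ((-(y ^ 2 / 2 * (((T : ℝ) - 1) / T)) : ℝ) : ℂ))
      atTop (𝓝 (Complex.exp ((-(y ^ 2 / 2) : ℝ) : ℂ))) := by
    have h1 : Tendsto (fun T : ℕ => ((T : ℝ) - 1) / T) atTop (𝓝 1) := by
      have h2 := hinv.const_sub 1
      rw [sub_zero] at h2
      refine h2.congr' ?_
      filter_upwards [eventually_ge_atTop 1] with T hT
      have hT' : (0 : ℝ) < T := by exact_mod_cast hT
      field_simp
    have h2 := (h1.const_mul (y ^ 2 / 2)).neg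
    rw [mul_one] at h2
    exact (Complex.continuous_exp.tendsto _).comp ((Complex.continuous_ofReal.tendsto _).comp h2)
  have := hdiff.add hexp
  simp only [sub_add_cancel, zero_add] at this
  exact this

/-- With probability close to one the path is good and both programs estimate well. -/
theorem eventually_measureReal_estimationBounds (hε : 0 < ε) (hε1 : ε < 1) (hM : 0 < M)
    (hd : ∀ T, 2 ≤ d T)
    (hSig0 : ∀ T, Sig0 T ∈ classL M) (hA : ∀ T, A T ∈ classM M ε (s T))
    (h : ∀ T, IsStationaryVAR (μ T) (A T) (Sig0 T) (Psi T) (X T) (W T))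
    (hp : ∀ T, PopulationBounds M (A T) (Sig0 T) (k T) (m T) (max (sv T) (s T)))
    (hf : Tendsto (fun T => ((max (sv T) (s T) : ℕ) : ℝ) * Real.log (d T) / √T) atTop (𝓝 0))
    {K : ℝ} (hK : 2 * goodConst M ε 1 + 1 + goodConst M ε 1 * M ≤ K)
    {βhat vhat : ∀ T, Ω T → Fin (d T) → ℝ} {θtilde : ∀ T, Ω T → ℝ}
    (hz : ∀ T, 1 ≤ T → ∀ ω, IsZEstimate T (fun t => X T t ω) (k T) (m T) (K * rate (d T) T)
      (K * rate (d T) T) (βhat T ω) (vhat T ω) (θtilde T ω)) {η : ℝ} (hη : 0 < η) :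
    ∃ a D : ℝ, 0 ≤ a ∧ 0 ≤ D ∧ ∀ᶠ T in atTop, (μ T).real {ω |
      ¬ (GoodPath T (A T) (Sig0 T) (m T) a (fun t => X T t ω) ∧
        EstimationBounds T (fun t => X T t ω) (A T) (Sig0 T) (k T) (m T) (K * rate (d T) T)
          (D * ((max (sv T) (s T) : ℕ) * rate (d T) T)) (βhat T ω) (vhat T ω))} ≤ η := by
  have hs := fun T => (hp T).one_le
  have hlog2 : 0 < Real.log 2 := Real.log_pos one_lt_two
  -- `N` is the threshold beyond which 10/d ≤ η. Below it, `g` is chosen so that 10 · 2⁻ᵍ ≤ η, which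
  -- suffices because d ≥ 2.
  obtain ⟨N, hN⟩ := exists_nat_ge (10 / η)
  set g : ℝ := max 1 (Real.log (10 / η) / Real.log 2) with hg
  have hg1 : 1 ≤ g := le_max_left _ _
  have hg2 : Real.log (10 / η) ≤ g * Real.log 2 := by
    rw [← div_le_iff₀ hlog2]; exact le_max_right _ _
  set a₁ := goodConst M ε 1 with ha₁
  set a₂ := goodConst M ε g with ha₂
  have ha₁0 : 0 < a₁ := goodConst_pos hM hε zero_le_one
  have ha₂0 : 0 < a₂ := goodConst_pos hM hε (by linarith)
  have ha12 : a₁ ≤ a₂ := goodConst_mono hM hε hg1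
  have hK0 : 0 ≤ K := le_trans (by positivity) hK
  set D₁ := 4 * M * (K + M * a₁) with hD₁
  set D₂ := 2 * (N : ℝ) * M * (K + 2 * a₂ + 1 + a₂ * M) with hD₂
  refine ⟨a₂, max D₁ D₂, ha₂0.le, le_max_of_le_left (by positivity), ?_⟩
  have hrate := tendsto_rate hd hs hf
  have c1 := (hrate.mul_const (2 * M * 4 / ε)).eventually_le_const
    (by norm_num : 0 * (2 * M * 4 / ε) < 1 / 4)
  have c2 := (hrate.const_mul a₂).eventually_le_const (by simpa using hM : a₂ * 0 < M)
  have c3 := (hrate.const_mul (M * a₂ * N)).eventually_le_const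
    (by norm_num : M * a₂ * N * 0 < 1 / 2)
  filter_upwards [c1, c2, c3, eventually_boundary_le_rate hd hs hM.le ha₂0.le hf,
    eventually_ge_atTop 2] with T h1 h2 h3 h4 hT
  have hρ0 : 0 ≤ rate (d T) T := Real.sqrt_nonneg _
  have h2' : a₁ * rate (d T) T ≤ M := (mul_le_mul_of_nonneg_right ha12 hρ0).trans h2
  have hT2 : (2 : ℝ) ≤ T := by exact_mod_cast hT
  have h4' : boundary (d T) T M a₁ ≤ rate (d T) T := by
    refine le_trans ?_ h4
    have := Real.log_natCast_nonneg (d T)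
    have : (0 : ℝ) ≤ (T : ℝ) - 1 := by linarith
    unfold boundary
    gcongr
  have hsr : 0 ≤ ((max (sv T) (s T) : ℕ) : ℝ) * rate (d T) T := by positivity
  have hdpos : (0 : ℝ) < d T := by
    have := hd T
    exact_mod_cast (by omega : 0 < d T)
  rcases le_or_gt N (d T) with hcase | hcase
  -- High dimension: the constant for g = 1, to which `K` is tuned, already holds with high
  -- probability.
  · refine (measureReal_mono ?_).trans (((h T).measureReal_not_goodPath_goodConst_le hε hε1 hM
      (hSig0 T).2.2 (hA T).2.2 (hd T) (m T) (by omega) h1 zero_le_one h2').trans ?_)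
    · intro ω hω hgood
      exact hω ⟨hgood.mono ha12, (hgood.estimationBounds_sparse hT (hp T) h2' ha₁0.le h4' hK
        (hz T (by omega) ω)).mono (mul_le_mul_of_nonneg_right (le_max_left _ _) hsr)⟩
    · rw [neg_one_mul, Real.exp_neg, Real.exp_log hdpos, ← div_eq_mul_inv, div_le_comm₀ hdpos hη]
      exact hN.trans (by exact_mod_cast hcase)
  -- Bounded dimension: the constant `a₂` may exceed what `K` allows for, but d < N makes the
  -- invertibility condition hold eventually.
  · refine (measureReal_mono ?_).trans (((h T).measureReal_not_goodPath_goodConst_le hε hε1 hM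
      (hSig0 T).2.2 (hA T).2.2 (hd T) (m T) (by omega) h1 (by linarith) h2).trans ?_)
    · intro ω hω hgood
      refine hω ⟨hgood, (hgood.estimationBounds_low_dim hT (hp T) h2 ha₂0.le h4 hK0 hcase.le ?_
        (hz T (by omega) ω)).mono (mul_le_mul_of_nonneg_right (le_max_right _ _) hsr)⟩
      refine le_trans ?_ h3
      have : (d T : ℝ) ≤ N := by exact_mod_cast hcase.le
      calc M * (a₂ * rate (d T) T) * d T ≤ M * (a₂ * rate (d T) T) * N := by gcongr
        _ = _ := by ring
    · have e1 : -g * Real.log (d T) ≤ -Real.log (10 / η) := by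
        have := mul_le_mul_of_nonneg_left (log_two_le_log (hd T)) (by linarith : 0 ≤ g)
        linarith
      have e2 := Real.exp_le_exp.2 e1
      rw [Real.exp_neg, Real.exp_log (by positivity), inv_div] at e2
      linarith

/-- The score bound `B` depends on η only, so the tolerance is fixed before T grows. The exceptional
set consists of bad paths (η/2) and the two tails of the score (η/8 each). -/
theorem eventually_measureReal_wellPosed_and_close (hε : 0 < ε) (hε1 : ε < 1) (hM : 0 < M)
    (hC : 0 < C) (hd : ∀ T, 2 ≤ d T)
    (hSig0 : ∀ T, Sig0 T ∈ classL M) (hA : ∀ T, A T ∈ classM M ε (s T))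
    (h : ∀ T, IsStationaryVAR (μ T) (A T) (Sig0 T) (Psi T) (X T) (W T))
    (hp : ∀ T, PopulationBounds M (A T) (Sig0 T) (k T) (m T) (max (sv T) (s T)))
    (hv : ∀ T, VarianceBounds M C (A T) (Sig0 T) (Psi T) (k T) (m T))
    (hf : Tendsto (fun T => ((max (sv T) (s T) : ℕ) : ℝ) * Real.log (d T) / √T) atTop (𝓝 0))
    {K : ℝ} (hK : 2 * goodConst M ε 1 + 1 + goodConst M ε 1 * M ≤ K)
    {βhat vhat : ∀ T, Ω T → Fin (d T) → ℝ} {θtilde : ∀ T, Ω T → ℝ}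
    (hz : ∀ T, 1 ≤ T → ∀ ω, IsZEstimate T (fun t => X T t ω) (k T) (m T) (K * rate (d T) T)
      (K * rate (d T) T) (βhat T ω) (vhat T ω) (θtilde T ω)) {η : ℝ} (hη : 0 < η) :
    ∀ᶠ T in atTop, (μ T).real {ω | ¬ (WellPosed T (fun t => X T t ω) (k T) (m T)
        (K * rate (d T) T) (K * rate (d T) T) (βhat T ω) (vhat T ω) ∧
      |UHat T (fun t => X T t ω) (m T) (βhat T ω) (vhat T ω) (θtilde T ω) (A T (k T) (m T)) -
        score T (A T) (Sig0 T) (Psi T) (k T) (m T) (fun t => X T t ω)| ≤ η)} ≤ η := by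
  have hs := fun T => (hp T).one_le
  obtain ⟨a, D, ha, hD, hgood⟩ := eventually_measureReal_estimationBounds hε hε1 hM hd hSig0 hA h
    hp hf hK hz (half_pos hη)
  have hK0 : 0 ≤ K := by
    have := goodConst_pos hM hε (zero_le_one (α := ℝ))
    exact le_trans (by positivity) hK
  obtain ⟨B, hB0, hB1, hB2⟩ : ∃ B : ℝ, 0 ≤ B ∧ cdf (gaussianReal 0 1) (-B) < η / 8 ∧
      1 - η / 8 < cdf (gaussianReal 0 1) B := by
    have t1 := ((tendsto_cdf_atBot (gaussianReal 0 1)).comp tendsto_neg_atTop_atBot)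
      |>.eventually_lt_const (by positivity : (0 : ℝ) < η / 8)
    have t2 := (tendsto_cdf_atTop (gaussianReal 0 1)).eventually_const_lt
      (by linarith : 1 - η / 8 < 1)
    obtain ⟨B, hB⟩ := ((t1.and t2).and (eventually_ge_atTop 0)).exists
    exact ⟨B, hB.2, hB.1.1, hB.1.2⟩
  obtain ⟨τ, hτ, hdet⟩ := exists_deterministic_tolerance hM hC ha hK0 hB0 hη
  have hclt := fun t => tendsto_measureReal_score_le hε hε1 hSig0 hA h hp hv t
  have q1 := (hclt (-B)).eventually_lt_const hB1
  have q2 := (hclt B).eventually_const_lt hB2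
  have r0 := tendsto_rate hd hs hf
  have r1 := (r0.const_mul a).eventually_le_const (by simpa using hM : a * 0 < M)
  have r2 := r0.eventually_le_const hτ
  have r3 := ((tendsto_mul_rate hd hf).const_mul D).eventually_le_const
    (by simpa using hτ : D * 0 < τ)
  have r4 := ((tendsto_sqrt_mul_rate_mul_rate hf).const_mul D).eventually_le_const
    (by simpa using hτ : D * 0 < τ)
  have r5 := (tendsto_sqrt_mul_boundary hs hM.le ha hf).eventually_le_const hτ
  have r6 := tendsto_natCast_sub_one_inv.eventually_le_const hτ
  have r7 := eventually_boundary_le_rate hd hs hM.le ha hf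
  filter_upwards [hgood, q1, q2, r1, r2, r3, r4, r5, r6, r7, eventually_ge_atTop 2] with
    T g1 p1 p2 b1 b2 b3 b4 b5 b6 b7 hT
  set N : Ω T → ℝ := fun ω => score T (A T) (Sig0 T) (Psi T) (k T) (m T) (fun t => X T t ω)
    with hN
  have hNm : Measurable N := (measurable_dotProduct_scoreNoise (h T).measurable_X T (A T) (m T)
    _).div_const _
  have hcompl : (μ T).real {ω | B < N ω} = 1 - (μ T).real {ω | N ω ≤ B} := by
    have e1 := probReal_compl_eq_one_sub (μ := μ T) (measurableSet_le hNm measurable_const :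
      MeasurableSet {ω | N ω ≤ B})
    rw [← e1]
    congr 1
    ext ω
    simp
  refine (measureReal_mono (s₂ := {ω |
      ¬ (GoodPath T (A T) (Sig0 T) (m T) a (fun t => X T t ω) ∧
        EstimationBounds T (fun t => X T t ω) (A T) (Sig0 T) (k T) (m T) (K * rate (d T) T)
          (D * ((max (sv T) (s T) : ℕ) * rate (d T) T)) (βhat T ω) (vhat T ω))} ∪
      ({ω | N ω ≤ -B} ∪ {ω | B < N ω})) ?_).trans ?_
  · intro ω hω
    by_contra hcon
    simp only [Set.mem_union, Set.mem_ofPred_eq, not_or, not_not, not_le, not_lt] at hcon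
    obtain ⟨⟨hg, he⟩, n1, n2⟩ := hcon
    exact hω (hdet (d T) T _ (A T) (Sig0 T) (Psi T) (k T) (m T) _ _ _ _ (θtilde T ω) hT hg (hp T)
      (hv T) (hz T (by omega) ω) he b1 b7 b2 b3 (by
        refine le_trans (le_of_eq ?_) b4
        ring) b5 b6 (abs_le.2 ⟨n1.le, n2⟩))
  · refine (measureReal_union_le _ _).trans ?_
    have := measureReal_union_le (μ := μ T) {ω | N ω ≤ -B} {ω | B < N ω}
    linarith

end Sequences

end VARInference

theorem mainTheorem7
    (M ε C : ℝ) (hε : 0 < ε) (hε1 : ε < 1) (hC : 0 < C)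
    (d : ℕ → ℕ) (hd : ∀ T, 2 ≤ d T)
    (k m : ∀ T, Fin (d T)) (hk : ∀ T, (k T : ℕ) = 0)
    (s sv : ℕ → ℕ)
    (A Sig0 Psi : ∀ T, Matrix (Fin (d T)) (Fin (d T)) ℝ)
    (hSig0 : ∀ T, Sig0 T ∈ VARInference.classL M)
    (hA : ∀ T, A T ∈ VARInference.classM M ε (s T))
    (hPsi : ∀ T j, C ≤ Psi T j j)
    (hsv : ∀ T, VARInference.l0 (fun i => (Sig0 T)⁻¹ (k T) i) = sv T) :
    ∃ lam lam' : ℕ → ℝ,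
      VARInference.SameOrder lam (fun T => Real.sqrt (Real.log (d T) / T)) ∧
      VARInference.SameOrder lam' (fun T => Real.sqrt (Real.log (d T) / T)) ∧
      ((fun T : ℕ => (max (sv T) (s T) : ℝ) * Real.log (d T)) =o[atTop]
          (fun T : ℕ => Real.sqrt T) →
        ∀ (Ω : ℕ → Type*) [∀ T, MeasurableSpace (Ω T)]
          (μ : ∀ T, Measure (Ω T)) [∀ T, IsProbabilityMeasure (μ T)]
          (X W : ∀ T, ℤ → Ω T → EuclideanSpace ℝ (Fin (d T))),
          (∀ T, VARInference.IsStationaryVAR (μ T) (A T) (Sig0 T) (Psi T) (X T) (W T)) →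
        ∀ (βhat vhat : ∀ T, Ω T → Fin (d T) → ℝ) (θtilde : ∀ T, Ω T → ℝ),
          (∀ T ω, VARInference.IsZEstimate T (fun t => X T t ω) (k T) (m T) (lam T) (lam' T)
            (βhat T ω) (vhat T ω) (θtilde T ω)) →
          Tendsto (fun T => (μ T).real {ω | ¬ VARInference.WellPosed T (fun t => X T t ω)
            (k T) (m T) (lam T) (lam' T) (βhat T ω) (vhat T ω)}) atTop (𝓝 0) ∧
          ∀ t : ℝ, Tendsto (fun T => |(μ T).real {ω | VARInference.UHat T (fun t => X T t ω)
              (m T) (βhat T ω) (vhat T ω) (θtilde T ω) (A T (k T) (m T)) ≤ t}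
            - cdf (gaussianReal 0 1) t|) atTop (𝓝 0)) := by
  have hM := VARInference.pos_of_mem_classL (hd 0) (hSig0 0)
  have hcpos := VARInference.goodConst_pos hM hε (zero_le_one (α := ℝ))
  -- The constant uses g = 1 and depends on `M` and `ε` alone; both programs share the same tuning
  -- parameter.
  set K : ℝ := 2 * VARInference.goodConst M ε 1 + 1 + VARInference.goodConst M ε 1 * M with hK
  have hK0 : 0 < K := by positivity
  refine ⟨_, _, VARInference.sameOrder_rate hd hK0, VARInference.sameOrder_rate hd hK0, ?_⟩
  intro ho Ω _ μ _ X W h βhat vhat θtilde hz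
  have hp := fun T => (h T).populationBounds (m := m T) (hd T) (hSig0 T) (hA T) (hsv T)
  have hv := fun T => (h T).varianceBounds hC (hd T) (hSig0 T) (hp T) (hPsi T)
  have hf : Tendsto (fun T => ((max (sv T) (s T) : ℕ) : ℝ) * Real.log (d T) / √T) atTop
      (𝓝 0) := by
    simpa only [Nat.cast_max] using ho.tendsto_div_nhds_zero
  have hlam : ∀ T : ℕ, 1 ≤ T → (if T = 0 then 1 else K * VARInference.rate (d T) T) =
      K * VARInference.rate (d T) T := fun T hT => if_neg (by omega)
  have key := fun (η : ℝ) (hη : 0 < η) =>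
    VARInference.eventually_measureReal_wellPosed_and_close hε hε1 hM hC hd hSig0 hA h hp hv hf
      (K := K) le_rfl (βhat := βhat) (vhat := vhat) (θtilde := θtilde) (fun T hT ω => by
        have := hz T ω
        simp only [hlam T hT] at this
        exact this) hη
  constructor
  · rw [Metric.tendsto_atTop']
    intro η hη
    obtain ⟨T₀, hT₀⟩ := eventually_atTop.1 (key (η / 2) (half_pos hη))
    refine ⟨T₀, fun T hT => ?_⟩
    rw [Real.dist_eq, sub_zero, abs_of_nonneg measureReal_nonneg]
    refine lt_of_le_of_lt (le_trans (measureReal_mono ?_) (hT₀ T hT.le)) (half_lt_self hη)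
    intro ω hω hcon
    refine hω ?_
    simp only [hlam T (by omega)]
    exact hcon.1
  · intro t
    refine VARInference.tendsto_measureReal_le_of_close
      (N := fun T ω => VARInference.score T (A T) (Sig0 T) (Psi T) (k T) (m T)
        (fun r => X T r ω)) VARInference.continuous_cdf_gaussianReal
      (fun t => VARInference.tendsto_measureReal_score_le hε hε1 hSig0 hA h hp hv t)
      (fun η hη => ?_) t
    filter_upwards [key η hη] with T hT
    refine le_trans (measureReal_mono ?_) hT
    intro ω hω hcon
    exact hω hcon.2
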